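/- Let $X(1),X(2),\dots$ be independent standard complex Gaussian random variables (the real and imaginary parts of each $X(k)$ are independent, centered, of variance $\tfrac12$). For real $K>1$ and $z\in\mathbb C$ put $F_K(z)=\exp\big(\sum_{1\le k\le K}\frac{X(k)}{\sqrt k}z^k\big)$. For $t\in\mathbb R$ and an integer $m\ge1$ put $$Z_t(m)=\sum_{e^{m-1}<k\le e^m}\frac{\Re\big(X(k)e^{ikt}\big)}{\sqrt k},\qquad \sigma_m^2=\mathbb E[Z_t(m)^2]=\sum_{e^{m-1}<k\le e^m}\frac1{2k},$$ where the term $k=1$ is included when $m=1$. Let $\Vert t\Vert$ denote the distance of $t$ to the nearest multiple of $2\pi$. Given $N$ and $K$, let $\mathcal D_t$ be the event that $\sum_{m=1}^j(Z_t(m)-2\sigma_m^2)\le 12\log\log N$ for all integers $1\le j\le\log K$, and let $\mathcal A_t$ be the event that $\mathcal D_t$ holds and $\sum_{m=1}^j(Z_t(m)-2\sigma_m^2)\le-2000\log\log N$ for all integers $j$ with $0.01\log K\le j\le\log K$. For integers $m,n$ put $$I_{m,n}=\iint\limits_{\substack{[0,2\pi]\times[0,2\pi]\\ \Vert t_2-t_1\Vert\le(\log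 N)^{100}/N}}\mathbb 1(\mathcal A_{t_1})F_K(e^{it_1})\,\mathbb 1(\mathcal A_{t_2})\overline{F_K(e^{it_2})}\,e^{it_1(m+1)-it_2(n+1)}\sum_{N<k\le\frac{4N}3}\frac{e^{i(t_2-t_1)k}}k\,dt_1\,dt_2 .$$ Proposition. There are absolute constants $N_0,C,B_1,B_2>0$ such that for every real $N\ge N_0$, every $K$ with $\frac N3\le K\le N$ for which $\log K$ is an integer, and every integer $p$ with $2\le p\le N^{1/4}$, the following holds with probability at least $1-B_2(\log N)^{-2p}$: $$\max_{\frac{8N}7<m\le\frac{4N}3}\ \sum_{\frac{8N}7<n\le\frac{4N}3}|I_{m,n}|^{2p}\le B_1\left(N^{2/3}\Big(\frac{C\log\log N}N\int_0^{2\pi}|F_K(e^{it})|^2\,dt\Big)^{2p}+N^{2/3}\big(p^{25}(\log N)^{27}\big)^{2p}+N\Big(\frac{p^{25}}{(\log N)^{985}}\Big)^{2p}\right).$$ -/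

import Mathlib

open MeasureTheory ProbabilityTheory

noncomputable section

namespace ModelChaos

/-- `X 1, X 2, …` are independent standard complex Gaussian random variables: the real and the
imaginary part of each are independent centred real Gaussians of variance `1 / 2`.
(The value `X 0` is not constrained and is never used.) -/
structure IsStdComplexGaussianSeq {Ω : Type*} [MeasurableSpace Ω] (μ : Measure Ω)
    (X : ℕ → Ω → ℂ) : Prop where
  measurable : ∀ k : ℕ, 1 ≤ k → Measurable (X k)
  indep : iIndepFun (fun k : ℕ+ => X (k : ℕ)) μ
  indep_re_im : ∀ k : ℕ, 1 ≤ k → IndepFun (fun ω => (X k ω).re) (fun ω => (X k ω).im) μ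
  law_re : ∀ k : ℕ, 1 ≤ k → μ.map (fun ω => (X k ω).re) = gaussianReal 0 (1 / 2)
  law_im : ∀ k : ℕ, 1 ≤ k → μ.map (fun ω => (X k ω).im) = gaussianReal 0 (1 / 2)

/-- `F_K(z) = exp (∑_{1 ≤ k ≤ K} X(k) z ^ k / √k)`. -/
def F {Ω : Type*} (X : ℕ → Ω → ℂ) (K : ℝ) (z : ℂ) (ω : Ω) : ℂ :=
  Complex.exp (∑ k ∈ Finset.Icc 1 ⌊K⌋₊, X k ω / (Real.sqrt k : ℂ) * z ^ k)

/-- The integers `k` with `e ^ (m - 1) < k ≤ e ^ m`, where by convention `k = 1` is included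
when `m = 1`. -/
def block (m : ℕ) : Finset ℕ :=
  (Finset.Icc 1 ⌊Real.exp m⌋₊).filter
    (fun k => Real.exp ((m : ℝ) - 1) < (k : ℝ) ∨ (k = 1 ∧ m = 1))

/-- `Z_t(m) = ∑_{e ^ (m - 1) < k ≤ e ^ m} Re (X(k) e ^ (i k t)) / √k`. -/
def Z {Ω : Type*} (X : ℕ → Ω → ℂ) (t : ℝ) (m : ℕ) (ω : Ω) : ℝ :=
  ∑ k ∈ block m, (X k ω * Complex.exp (Complex.I * k * t)).re / Real.sqrt k

/-- `σ_m ^ 2 = ∑_{e ^ (m - 1) < k ≤ e ^ m} 1 / (2 k)`, the variance of `Z_t(m)`. -/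
def sigmaSq (m : ℕ) : ℝ :=
  ∑ k ∈ block m, 1 / (2 * (k : ℝ))

/-- The event `𝒟_t`: `∑_{m ≤ j} (Z_t(m) - 2 σ_m ^ 2) ≤ 12 log log N` for `1 ≤ j ≤ log K`. -/
def eventD {Ω : Type*} (X : ℕ → Ω → ℂ) (N K t : ℝ) : Set Ω :=
  {ω | ∀ j : ℕ, 1 ≤ j → (j : ℝ) ≤ Real.log K →
    ∑ m ∈ Finset.Icc 1 j, (Z X t m ω - 2 * sigmaSq m) ≤ 12 * Real.log (Real.log N)}

/-- The event `𝒜_t`: `∑_{m ≤ j} (Z_t(m) - 2 σ_m ^ 2) ≤ - 2000 log log N` for all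
`0.01 log K ≤ j ≤ log K`, and `𝒟_t` holds. -/
def eventA {Ω : Type*} (X : ℕ → Ω → ℂ) (N K t : ℝ) : Set Ω :=
  {ω | ∀ j : ℕ, (1 / 100 : ℝ) * Real.log K ≤ (j : ℝ) → (j : ℝ) ≤ Real.log K →
    ∑ m ∈ Finset.Icc 1 j, (Z X t m ω - 2 * sigmaSq m) ≤ -2000 * Real.log (Real.log N)}
  ∩ eventD X N K t

/-- `𝟙(𝒜_t) F_K(e ^ (i t))`. -/
def restrictedF {Ω : Type*} (X : ℕ → Ω → ℂ) (N K t : ℝ) (ω : Ω) : ℂ :=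
  (eventA X N K t).indicator (F X K (Complex.exp (Complex.I * t))) ω

/-- The pairs `(t₁, t₂) ∈ [0, 2π]²` for which the distance of `t₂ - t₁` to the nearest multiple
of `2π` (the norm on the circle `ℝ / 2πℤ`) is at most `(log N) ^ 100 / N`. -/
def nearDiagonal (N : ℝ) : Set (ℝ × ℝ) :=
  {t | t.1 ∈ Set.Icc 0 (2 * Real.pi) ∧ t.2 ∈ Set.Icc 0 (2 * Real.pi) ∧
    ‖((t.2 - t.1 : ℝ) : AddCircle (2 * Real.pi))‖ ≤ Real.log N ^ 100 / N}

/-- The kernel `∑_{N < k ≤ 4N/3} e ^ (i s k) / k`. -/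
def kernel (N s : ℝ) : ℂ :=
  ∑ k ∈ Finset.Ioc ⌊N⌋₊ ⌊4 * N / 3⌋₊, Complex.exp (Complex.I * s * k) / k

/-- The double integral of
`𝟙(𝒜_{t₁}) F_K(e^{i t₁}) 𝟙(𝒜_{t₂}) conj (F_K(e^{i t₂})) e^{i t₁ (m+1) - i t₂ (n+1)}
  ∑_{N < k ≤ 4N/3} e^{i (t₂ - t₁) k} / k` over the near-diagonal region. -/
def restrictedIntegral {Ω : Type*} (X : ℕ → Ω → ℂ) (N K : ℝ) (m n : ℕ) (ω : Ω) : ℂ :=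
  ∫ t in nearDiagonal N,
    restrictedF X N K t.1 ω * (starRingEnd ℂ) (restrictedF X N K t.2 ω)
      * Complex.exp (Complex.I * t.1 * (m + 1) - Complex.I * t.2 * (n + 1))
      * kernel N (t.2 - t.1)

/-- The integers `n` with `8N/7 < n ≤ 4N/3`. -/
def window (N : ℝ) : Finset ℕ :=
  Finset.Ioc ⌊8 * N / 7⌋₊ ⌊4 * N / 3⌋₊

end ModelChaos

end

/-! Write l = log N, q = log l, r = m - n, L = log K, and split the sum over n at |r| = N^(2/3)/4.

Near pairs: there are at most N^(2/3) such n for each m. Since |G(t) G(t+s)| is at most the mean of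
the two squares, |I_{m,n}| is at most the L¹ norm of the kernel on |s| ≤ l^100/N times the mean
square of F. That L¹ norm is O(q/N), because the kernel is bounded by min(1, 2π/(N|s|)) and the
integral of 1/|s| from 1/N to l^100/N is 100 q. This is `norm_restrictedIntegral_le`, and it gives
the first term of the bound.

Far pairs: outside an event of probability at most 2 l^(-2p), all of them satisfy |I_{m,n}| ≤
p^25/l^985 (`measure_bad_le`). This gives the third term. The middle term is not needed.

For a far pair, I_{m,n} is e^{V_L} times an integral over shifts s of the twisted correlations ∫
e^{irt} g(t) conj g(t+s) dt, where g is the restricted product normalised by e^{-V_L/2}. Their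
exponential moments are bounded by integrating out the blocks from the last to the first. Given the
earlier blocks, the integrand at t depends on the Gaussian vector of block m only through a space
U_t spanned by two waves. These spaces are almost orthogonal for different t: ‖∫ v_t‖² ≤ κ_m ∫
‖v_t‖² for v_t in U_t, with κ_m of order e^{-m} (`isBessel_block`). A Gaussian Brascamp–Lieb
inequality then gives E exp ∫φ_t ≤ exp ∫(E φ_t + κ_m E φ_t²) as long as κ_m |φ_t| ≤ 1
(`integral_exp_integral_le`).

On the barrier event |g|² ≤ e^{V_m + 2u_m}, and V_m ≤ m + 1, so κ_m max|g|² is O(e^{2u_m}). This is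
O(l^(-4000)) in the high blocks m ≥ L/100, which leaves room for an exponential parameter λ =
l^1200, and O(l^24) in the low blocks. The second-moment cost is paid by a small multiple μ_m of θ =
|g|², a supermartingale, with μ_m growing by l^(-100) per block (`avg_exp_le`). Once the high blocks
are averaged, what remains of g is built from a trigonometric polynomial of degree about N^(1/100),
cut by boundedly many level sets per block. It varies far more slowly than e^{irt} with |r| ≥
N^(2/3)/4, so the averaged twisted integral is negligible (`norm_integral_corr_low_le`). The
recursion continues through the low blocks with λ = 0 and ends at θ = 1. Jensen over the shifts,
Markov's inequality and a union bound over at most N² pairs finish the far part.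

The Brascamp–Lieb inequality is proved by a discretised heat flow. One Gaussian step of size r
increases the ratio of the two sides by a factor at most 1 + Cr³, because the second-order terms
cancel under the Bessel condition. With 2^j steps of size 2^(-j/2) the total error is O(2^(-j/2)).
-/

open scoped RealInnerProductSpace

noncomputable section

set_option linter.unusedSectionVars false

namespace GaussianBL

/-! ### Elementary expansions and Gaussian smoothing. -/

section

lemma exp_le_cubic {y y₀ : ℝ} (hy : |y| ≤ y₀) :
    Real.exp y ≤ 1 + y + y ^ 2 / 2 + Real.exp y₀ * |y| ^ 3 := by
  have h := Complex.norm_exp_sub_sum_le_norm_mul_exp (y : ℂ) 3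
  have e : Complex.exp (y : ℂ) - ∑ m ∈ Finset.range 3, (y : ℂ) ^ m / (m.factorial : ℂ)
      = ((Real.exp y - (1 + y + y ^ 2 / 2) : ℝ) : ℂ) := by
    simp [Finset.sum_range_succ, Nat.factorial]
  rw [e, Complex.norm_real, Complex.norm_real, Real.norm_eq_abs, Real.norm_eq_abs] at h
  have h2 : |y| ^ 3 * Real.exp |y| ≤ Real.exp y₀ * |y| ^ 3 := by
    rw [mul_comm]; gcongr
  linarith [le_abs_self (Real.exp y - (1 + y + y ^ 2 / 2))]

/-- The difference of the two sides has derivative z³/(1+z), which has the sign of z, so the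
difference is minimal at 0, where it vanishes. -/
lemma log_one_add_le_cubic {y : ℝ} (hy : -1 < y) :
    Real.log (1 + y) ≤ y - y ^ 2 / 2 + y ^ 3 / 3 := by
  let f : ℝ → ℝ := fun z => z - z ^ 2 / 2 + z ^ 3 / 3 - Real.log (1 + z)
  have hd : ∀ z : ℝ, -1 < z → HasDerivAt f (z ^ 3 / (1 + z)) z := by
    intro z hz
    have h1 : (1 + z) ≠ 0 := by linarith
    have := ((((hasDerivAt_id z).sub ((hasDerivAt_pow 2 z).div_const 2)).add
      ((hasDerivAt_pow 3 z).div_const 3)).sub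
      (((hasDerivAt_id z).const_add 1).log h1))
    refine this.congr_deriv ?_
    simp only [id_eq, Nat.cast_ofNat]
    field_simp
    ring
  have f0 : f 0 = 0 := by simp [f]
  suffices 0 ≤ f y by simp only [f] at this; linarith
  rw [← f0]
  rcases le_total 0 y with h | h
  · have : MonotoneOn f (Set.Ici 0) := by
      apply monotoneOn_of_deriv_nonneg (convex_Ici 0)
      · exact fun z hz => (hd z (by have : (0:ℝ) ≤ z := hz; linarith)).continuousAt.continuousWithinAt
      · intro z hz
        rw [interior_Ici] at hz
        exact (hd z (by have : (0:ℝ) < z := hz; linarith)).differentiableAt.differentiableWithinAt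
      · intro z hz
        rw [interior_Ici] at hz
        have hz' : (0:ℝ) < z := hz
        rw [(hd z (by linarith)).deriv]; positivity
    exact this (Set.mem_Ici.2 le_rfl) h h
  · have : AntitoneOn f (Set.Ioc (-1) 0) := by
      apply antitoneOn_of_deriv_nonpos (convex_Ioc _ _)
      · exact fun z hz => (hd z hz.1).continuousAt.continuousWithinAt
      · intro z hz
        rw [interior_Ioc] at hz
        exact (hd z hz.1).differentiableAt.differentiableWithinAt
      · intro z hz
        rw [interior_Ioc] at hz
        rw [(hd z hz.1).deriv]
        have h1 : 0 < 1 + z := by linarith [hz.1]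
        have h2 : z ^ 3 ≤ 0 := by
          have := hz.2
          nlinarith [sq_nonneg z]
        exact div_nonpos_of_nonpos_of_nonneg h2 h1.le
    exact this ⟨hy, h⟩ ⟨by norm_num, le_rfl⟩ h

lemma abs_log_one_add_sub_le {y ρ : ℝ} (hρ : 0 < ρ) (hy : ρ ≤ 1 + y) :
    |Real.log (1 + y) - y| ≤ ρ⁻¹ * y ^ 2 := by
  have h0 : 0 < 1 + y := lt_of_lt_of_le hρ hy
  have h1 := Real.log_le_sub_one_of_pos h0
  have h2 := Real.one_sub_inv_le_log_of_pos h0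
  have h3 : (1 + y)⁻¹ ≤ ρ⁻¹ := inv_anti₀ hρ hy
  have h4 : 1 - (1 + y)⁻¹ = y - (1 + y)⁻¹ * y ^ 2 := by field_simp; ring
  have h5 : (1 + y)⁻¹ * y ^ 2 ≤ ρ⁻¹ * y ^ 2 := by gcongr
  rw [abs_le]; constructor
  · linarith
  · have : 0 ≤ ρ⁻¹ * y ^ 2 := by positivity
    linarith

section

variable {E : Type*} [NormedAddCommGroup E] [InnerProductSpace ℝ E] [FiniteDimensional ℝ E]
  [MeasurableSpace E] [BorelSpace E]

lemma integrable_norm_pow (n : ℕ) : Integrable (fun η : E => ‖η‖ ^ n) (stdGaussian E) := by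
  have h := (IsGaussian.memLp_id (stdGaussian E) (n : ENNReal) (by simp))
  exact h.integrable_norm_pow' 

lemma integrable_one_add_sq_pow (n : ℕ) :
    Integrable (fun η : E => (1 + ‖η‖ ^ 2) ^ n) (stdGaussian E) := by
  have h : (fun η : E => (1 + ‖η‖ ^ 2) ^ n)
      = fun η => ∑ m ∈ Finset.range (n + 1), ‖η‖ ^ (2 * m) * (n.choose m) := by
    ext η
    rw [add_comm, add_pow]
    simp [pow_mul]
  rw [h]
  exact integrable_finsetSum _ fun m _ => (integrable_norm_pow _).mul_const _

lemma integral_inner_stdGaussian (w : E) : ∫ η, ⟪w, η⟫ ∂(stdGaussian E) = 0 := by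
  have := integral_strongDual_stdGaussian (E := E) (innerSL ℝ w)
  simpa using this

lemma integral_inner_sq_stdGaussian (w : E) : ∫ η, ⟪w, η⟫ ^ 2 ∂(stdGaussian E) = ‖w‖ ^ 2 := by
  have h := variance_dual_stdGaussian (E := E) (innerSL ℝ w)
  rw [variance_of_integral_eq_zero (by fun_prop)
    (integral_strongDual_stdGaussian (E := E) (innerSL ℝ w))] at h
  simpa using h

lemma integrable_of_bound {α F : Type*} [MeasurableSpace α] {μ : Measure α} [IsFiniteMeasure μ]
    [NormedAddCommGroup F] [MeasurableSpace F] [BorelSpace F] [SecondCountableTopology F]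
    {f : α → F} (hf : Measurable f) {C : ℝ}
    (h : ∀ x, ‖f x‖ ≤ C) : Integrable f μ :=
  Integrable.of_bound hf.aestronglyMeasurable C (Filter.Eventually.of_forall h)

/-- Convolution with a Gaussian of standard deviation `r`. -/
def smooth (r : ℝ) (φ : E → ℝ) (x : E) : ℝ := ∫ η, φ (x + r • η) ∂(stdGaussian E)

/-- A pair of independent standard Gaussian vectors is invariant under rotation, so cos θ ξ + sin θ
η is again standard. This is the semigroup law of the heat flow, parametrised by an angle. -/
lemma smooth_smooth (ρ θ : ℝ) {φ : E → ℝ} (hφ : Measurable φ) {C : ℝ} (hC : ∀ x, ‖φ x‖ ≤ C)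
    (x : E) : smooth (ρ * Real.cos θ) (smooth (ρ * Real.sin θ) φ) x = smooth ρ φ x := by
  unfold smooth
  have hm : Measurable (fun z : E × E => φ (x + ρ • z.1)) := by fun_prop
  have h0 : ∫ η : E, id η ∂(stdGaussian E) = 0 := by simp [integral_id_stdGaussian]
  have hrot := IsGaussian.map_rotation_eq_self (μ := stdGaussian E) h0 θ
  have e1 : ∫ ξ, φ (x + ρ • ξ) ∂(stdGaussian E)
      = ∫ z, φ (x + ρ • z.1) ∂((stdGaussian E).prod (stdGaussian E)) := by
    rw [integral_prod _ (integrable_of_bound hm (fun _ => hC _))]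
    simp
  rw [e1, ← hrot, integral_map (by fun_prop) (by rw [hrot]; exact hm.aestronglyMeasurable),
    integral_prod]
  · simp only [ContinuousLinearMap.rotation_apply, smul_add, smul_smul, add_assoc]
  · exact integrable_of_bound (by fun_prop) (fun _ => hC _)

end

end

/-! ### Infinitesimal Brascamp–Lieb: second-order expansion of the exponential of a log-integral. -/

section

variable {E : Type*} [NormedAddCommGroup E] [InnerProductSpace ℝ E] [FiniteDimensional ℝ E]
  [MeasurableSpace E] [BorelSpace E]

lemma norm_le_one_add_sq {E : Type*} [SeminormedAddCommGroup E] (η : E) : ‖η‖ ≤ 1 + ‖η‖ ^ 2 := by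
  nlinarith [sq_nonneg (‖η‖ - 1), norm_nonneg η]

lemma abs_inner_le_of_norm_le {w : E} {B : ℝ} (hw : ‖w‖ ≤ B) (η : E) :
    |⟪w, η⟫| ≤ B * (1 + ‖η‖ ^ 2) := by
  calc |⟪w, η⟫| ≤ ‖w‖ * ‖η‖ := abs_real_inner_le_norm w η
    _ ≤ B * (1 + ‖η‖ ^ 2) :=
      mul_le_mul hw (norm_le_one_add_sq η) (norm_nonneg _) ((norm_nonneg _).trans hw)

lemma abs_integral_le_of_abs_le {T : Type*} [MeasurableSpace T] {ν : Measure T} [IsFiniteMeasure ν]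
    {f : T → ℝ} {C : ℝ} (h : ∀ t, |f t| ≤ C) : |∫ t, f t ∂ν| ≤ ν.real Set.univ * C := by
  have := norm_integral_le_of_norm_le_const (μ := ν) (f := f) (C := C)
    (Filter.Eventually.of_forall h)
  rwa [mul_comm] at this

/-- Second order expansion of `exp (c ∫ log (1 + Y))` for a small centred perturbation `Y`. -/
lemma exp_integral_log_le {T : Type*} [MeasurableSpace T] (ν : Measure T) [IsFiniteMeasure ν]
    {c ρ B : ℝ} (hc : 0 < c) (hρ : 0 < ρ) (hB : 0 ≤ B) :
    ∃ C : ℝ, 0 ≤ C ∧ ∀ (r q : ℝ) (Y i : T → ℝ), 0 < r → r ≤ 1 → 1 ≤ q → Measurable Y →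
      Measurable i → (∀ t, ρ ≤ 1 + Y t) → (∀ t, 1 + Y t ≤ ρ⁻¹) → (∀ t, |Y t| ≤ B * r * q) →
      (∀ t, |i t| ≤ B * q) → (∀ t, |Y t - r * i t| ≤ B * r ^ 2 * q) →
      Real.exp (c * ∫ t, Real.log (1 + Y t) ∂ν) ≤ 1 + c * ∫ t, Y t ∂ν
        - c / 2 * r ^ 2 * ∫ t, i t ^ 2 ∂ν + c ^ 2 / 2 * r ^ 2 * (∫ t, i t ∂ν) ^ 2
        + C * r ^ 3 * q ^ 6 := by
  set M := ν.real Set.univ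
  have hM : 0 ≤ M := measureReal_nonneg
  set A := c * ρ⁻¹ * M * B ^ 2 with hA
  set D := c * M * B + A with hD
  set T₀ := c * M * ρ⁻¹ with hT₀
  have hA0 : 0 ≤ A := by positivity
  have hD0 : 0 ≤ D := by positivity
  -- In order, the summands pay for replacing ∫Y² by r²∫i², for the cubic remainder of log, for
  -- replacing (∫Y)² by r²(∫i)², for replacing (c∫log(1+Y))² by (c∫Y)², and for the cubic remainder
  -- of exp.
  refine ⟨c * M * B ^ 2 + c / 3 * M * B ^ 3 + 3 / 2 * c ^ 2 * M ^ 2 * B ^ 2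
    + (c * M * B * A + A ^ 2 / 2) + Real.exp T₀ * D ^ 3, by positivity, ?_⟩
  intro r q Y i hr hr1 hq hYm him hY1 hY2 hYb hib hYi
  have hq0 : 0 < q := by linarith
  have hYint : Integrable Y ν := integrable_of_bound hYm hYb
  have hiint : Integrable i ν := integrable_of_bound him hib
  have hY2b : ∀ t, Y t ^ 2 ≤ (B * r * q) ^ 2 := fun t => by
    rw [← sq_abs]; exact pow_le_pow_left₀ (abs_nonneg _) (hYb t) 2
  have hY2int : Integrable (fun t => Y t ^ 2) ν := integrable_of_bound (by fun_prop)
    (fun t => by rw [Real.norm_eq_abs, abs_of_nonneg (sq_nonneg _)]; exact hY2b t)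
  have hi2int : Integrable (fun t => i t ^ 2) ν := integrable_of_bound (C := (B * q) ^ 2)
    (by fun_prop) (fun t => by
      rw [Real.norm_eq_abs, abs_pow]; exact pow_le_pow_left₀ (abs_nonneg _) (hib t) 2)
  have hlogb : ∀ t, |Real.log (1 + Y t)| ≤ ρ⁻¹ := fun t => by
    have h0 : 0 < 1 + Y t := hρ.trans_le (hY1 t)
    rw [abs_le]; constructor
    · have h1 : Real.log ρ ≤ Real.log (1 + Y t) := Real.log_le_log hρ (hY1 t)
      have h2 := Real.log_le_self (inv_nonneg.2 hρ.le)
      rw [Real.log_inv] at h2; linarith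
    · exact (Real.log_le_self h0.le).trans (hY2 t)
  have hlogint : Integrable (fun t => Real.log (1 + Y t)) ν :=
    integrable_of_bound (by fun_prop) hlogb
  set Z := ∫ t, Y t ∂ν
  set Q := ∫ t, Y t ^ 2 ∂ν
  set P := ∫ t, i t ^ 2 ∂ν
  set I := ∫ t, i t ∂ν
  set L := ∫ t, Real.log (1 + Y t) ∂ν
  have hconst : ∀ a : ℝ, ∫ _, a ∂ν = M * a := fun a => by simp [M]
  have hZ : |Z| ≤ M * (B * r * q) := abs_integral_le_of_abs_le hYb
  have hI : |I| ≤ M * (B * q) := abs_integral_le_of_abs_le hib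
  have hZI : |Z - r * I| ≤ M * (B * r ^ 2 * q) := by
    have h1 : Z - r * I = ∫ t, (Y t - r * i t) ∂ν := by
      rw [integral_sub hYint (hiint.const_mul r), integral_const_mul]
    rw [h1]
    exact abs_integral_le_of_abs_le hYi
  have hL0 : |L| ≤ M * ρ⁻¹ := abs_integral_le_of_abs_le hlogb
  have hQ0 : 0 ≤ Q := integral_nonneg fun t => sq_nonneg _
  have hQ : Q ≤ M * (B * r * q) ^ 2 := by
    rw [← hconst]; exact integral_mono hY2int (integrable_const _) hY2b
  have hQP : r ^ 2 * P - M * (2 * B ^ 2 * r ^ 3 * q ^ 2) ≤ Q := by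
    rw [← hconst, ← integral_const_mul, ← integral_sub (hi2int.const_mul _) (integrable_const _)]
    refine integral_mono ((hi2int.const_mul _).sub (integrable_const _)) hY2int fun t => ?_
    have h1 : |r * i t| * |Y t - r * i t| ≤ (r * (B * q)) * (B * r ^ 2 * q) := by
      rw [abs_mul, abs_of_pos hr]
      exact mul_le_mul (mul_le_mul_of_nonneg_left (hib t) hr.le) (hYi t) (abs_nonneg _)
        (by positivity)
    rw [← abs_mul] at h1
    have h2 := neg_abs_le (r * i t * (Y t - r * i t))
    simp only
    nlinarith [sq_nonneg (Y t - r * i t)]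
  have hLup : L ≤ Z - Q / 2 + M * ((B * r * q) ^ 3 / 3) := by
    have hsub : Integrable (fun t => Y t - Y t ^ 2 / 2) ν := hYint.sub (hY2int.div_const 2)
    rw [← hconst, ← integral_div, ← integral_sub hYint (hY2int.div_const 2),
      ← integral_add hsub (integrable_const _)]
    refine integral_mono hlogint (hsub.add (integrable_const _)) fun t => ?_
    have h1 := log_one_add_le_cubic (y := Y t) (by linarith [hY1 t])
    have h2 : Y t ^ 3 ≤ (B * r * q) ^ 3 := by
      refine (le_abs_self _).trans ?_
      rw [abs_pow]; exact pow_le_pow_left₀ (abs_nonneg _) (hYb t) 3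
    simp only
    linarith
  have hLZ : |L - Z| ≤ ρ⁻¹ * Q := by
    rw [← integral_sub hlogint hYint, ← integral_const_mul]
    exact norm_integral_le_of_norm_le (f := fun t => Real.log (1 + Y t) - Y t)
      (hY2int.const_mul _) (Filter.Eventually.of_forall fun t => abs_log_one_add_sub_le hρ (hY1 t))
  clear_value Z Q P I L
  clear hconst hlogint hlogb hi2int hY2int hY2b hYint hiint hYi hib hYb hY1 hY2 hYm him
  clear_value M
  have hX0 : |c * L| ≤ T₀ := by
    rw [abs_mul, abs_of_pos hc, hT₀, mul_assoc]; gcongr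
  have hdiff : |c * L - c * Z| ≤ A * r ^ 2 * q ^ 2 := by
    rw [← mul_sub, abs_mul, abs_of_pos hc]
    calc c * |L - Z| ≤ c * (ρ⁻¹ * (M * (B * r * q) ^ 2)) := by gcongr; exact hLZ.trans (by gcongr)
      _ = A * r ^ 2 * q ^ 2 := by rw [hA]; ring
  have hcZ : |c * Z| ≤ c * M * B * r * q := by
    rw [abs_mul, abs_of_pos hc]
    calc c * |Z| ≤ c * (M * (B * r * q)) := by gcongr
      _ = _ := by ring
  -- As r ≤ 1 ≤ q, all error monomials collapse into this single one.
  have hpow : ∀ m n : ℕ, 3 ≤ m → n ≤ 6 → r ^ m * q ^ n ≤ r ^ 3 * q ^ 6 := fun m n hm hn =>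
    mul_le_mul (pow_le_pow_of_le_one hr.le hr1 hm) (pow_le_pow_right₀ hq hn) (by positivity)
      (by positivity)
  have hX : |c * L| ≤ D * (r * q ^ 2) := by
    have h1 : |c * L| ≤ |c * L - c * Z| + |c * Z| := by
      have := abs_add_le (c * L - c * Z) (c * Z); rwa [sub_add_cancel] at this
    have h2 : r * q ≤ r * q ^ 2 := by gcongr; nlinarith
    have h3 : r ^ 2 * q ^ 2 ≤ r * q ^ 2 := by gcongr; nlinarith
    rw [hD]
    nlinarith [mul_le_mul_of_nonneg_left h2 (by positivity : 0 ≤ c * M * B),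
      mul_le_mul_of_nonneg_left h3 hA0]
  have hcube : |c * L| ^ 3 ≤ D ^ 3 * (r ^ 3 * q ^ 6) := by
    calc |c * L| ^ 3 ≤ (D * (r * q ^ 2)) ^ 3 := pow_le_pow_left₀ (abs_nonneg _) hX 3
      _ = _ := by ring
  have hsq : (c * L) ^ 2 ≤ c ^ 2 * Z ^ 2 + (2 * (c * M * B * A) + A ^ 2) * (r ^ 3 * q ^ 6) := by
    have h1 : |c * Z| * |c * L - c * Z| ≤ (c * M * B * r * q) * (A * r ^ 2 * q ^ 2) :=
      mul_le_mul hcZ hdiff (abs_nonneg _) (by positivity)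
    rw [← abs_mul] at h1
    have h2 : (c * L - c * Z) ^ 2 ≤ (A * r ^ 2 * q ^ 2) ^ 2 := by
      rw [← sq_abs]; exact pow_le_pow_left₀ (abs_nonneg _) hdiff 2
    have h3 := mul_le_mul_of_nonneg_left (hpow 3 3 le_rfl (by norm_num))
      (by positivity : 0 ≤ c * M * B * A)
    have h4 := mul_le_mul_of_nonneg_left (hpow 4 4 (by norm_num) (by norm_num)) (sq_nonneg A)
    have h5 := le_abs_self (c * Z * (c * L - c * Z))
    have e1 : (c * L) ^ 2 = c ^ 2 * Z ^ 2 + 2 * (c * Z * (c * L - c * Z))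
      + (c * L - c * Z) ^ 2 := by ring
    have e2 : (c * M * B * r * q) * (A * r ^ 2 * q ^ 2) = c * M * B * A * (r ^ 3 * q ^ 3) := by ring
    have e3 : (A * r ^ 2 * q ^ 2) ^ 2 = A ^ 2 * (r ^ 4 * q ^ 4) := by ring
    linarith
  have hZsq : Z ^ 2 ≤ r ^ 2 * I ^ 2 + 3 * M ^ 2 * B ^ 2 * (r ^ 3 * q ^ 6) := by
    have h1 : |r * I| * |Z - r * I| ≤ (r * (M * (B * q))) * (M * (B * r ^ 2 * q)) := by
      rw [abs_mul, abs_of_pos hr]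
      exact mul_le_mul (mul_le_mul_of_nonneg_left hI hr.le) hZI (abs_nonneg _) (by positivity)
    rw [← abs_mul] at h1
    have h2 : (Z - r * I) ^ 2 ≤ (M * (B * r ^ 2 * q)) ^ 2 := by
      rw [← sq_abs]; exact pow_le_pow_left₀ (abs_nonneg _) hZI 2
    have h3 := mul_le_mul_of_nonneg_left (hpow 3 2 le_rfl (by norm_num))
      (by positivity : 0 ≤ M ^ 2 * B ^ 2)
    have h4 := mul_le_mul_of_nonneg_left (hpow 4 2 (by norm_num) (by norm_num))
      (by positivity : 0 ≤ M ^ 2 * B ^ 2)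
    have h5 := le_abs_self (r * I * (Z - r * I))
    have e1 : Z ^ 2 = r ^ 2 * I ^ 2 + 2 * (r * I * (Z - r * I)) + (Z - r * I) ^ 2 := by ring
    have e2 : (r * (M * (B * q))) * (M * (B * r ^ 2 * q)) = M ^ 2 * B ^ 2 * (r ^ 3 * q ^ 2) := by
      ring
    have e3 : (M * (B * r ^ 2 * q)) ^ 2 = M ^ 2 * B ^ 2 * (r ^ 4 * q ^ 2) := by ring
    linarith
  clear_value A D T₀
  have hexp := exp_le_cubic hX0
  have k1 : Real.exp T₀ * |c * L| ^ 3 ≤ Real.exp T₀ * (D ^ 3 * (r ^ 3 * q ^ 6)) := by gcongr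
  have k2 := mul_le_mul_of_nonneg_left hLup hc.le
  have k3 := mul_le_mul_of_nonneg_left (hpow 3 3 le_rfl (by norm_num))
    (by positivity : 0 ≤ c / 3 * M * B ^ 3)
  have k4 := mul_le_mul_of_nonneg_left hQP (by positivity : 0 ≤ c / 2)
  have k5 := mul_le_mul_of_nonneg_left (hpow 3 2 le_rfl (by norm_num))
    (by positivity : 0 ≤ c * M * B ^ 2)
  have k6 := mul_le_mul_of_nonneg_left hZsq (by positivity : 0 ≤ c ^ 2 / 2)
  have k7 : c * (M * ((B * r * q) ^ 3 / 3)) = c / 3 * M * B ^ 3 * (r ^ 3 * q ^ 3) := by ring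
  have k8 : c / 2 * (M * (2 * B ^ 2 * r ^ 3 * q ^ 2)) = c * M * B ^ 2 * (r ^ 3 * q ^ 2) := by ring
  linarith

/-- Averaging the expansion over η kills the linear term. The quadratic terms become -(κ⁻¹/2) r²
∫‖w‖² and (κ⁻²/2) r² ‖∫w‖², and κ⁻¹ is exactly the exponent for which the Bessel bound makes their
sum nonpositive. The remainder is a polynomial in ‖η‖, hence integrable, and only r³ is left. -/
lemma integral_exp_integral_log_le {T : Type*} [MeasurableSpace T] (ν : Measure T)
    [IsFiniteMeasure ν] {κ ρ B : ℝ} (hκ : 0 < κ) (hρ : 0 < ρ) (hB : 0 ≤ B) :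
    ∃ C : ℝ, 0 ≤ C ∧ ∀ (r : ℝ) (Y : T → E → ℝ) (w : T → E), 0 < r → r ≤ 1 →
      Measurable (Function.uncurry Y) → Measurable w → (∀ t η, ρ ≤ 1 + Y t η) →
      (∀ t η, 1 + Y t η ≤ ρ⁻¹) → (∀ t η, |Y t η| ≤ B * r * (1 + ‖η‖ ^ 2)) →
      (∀ t, ‖w t‖ ≤ B) → (∀ t η, |Y t η - r * ⟪w t, η⟫| ≤ B * r ^ 2 * (1 + ‖η‖ ^ 2)) →
      (∀ t, ∫ η, Y t η ∂(stdGaussian E) = 0) →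
      ‖∫ t, w t ∂ν‖ ^ 2 ≤ κ * ∫ t, ‖w t‖ ^ 2 ∂ν →
      ∫ η, Real.exp (κ⁻¹ * ∫ t, Real.log (1 + Y t η) ∂ν) ∂(stdGaussian E) ≤ 1 + C * r ^ 3 := by
  obtain ⟨C, hC, hmain⟩ := exp_integral_log_le ν (inv_pos.2 hκ) hρ hB
  refine ⟨C * ∫ η : E, (1 + ‖η‖ ^ 2) ^ 6 ∂(stdGaussian E), by positivity, ?_⟩
  intro r Y w hr hr1 hYm hwm hY1 hY2 hYb hwb hYw hY0 hbessel
  set γ := stdGaussian E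
  have hYint : Integrable (fun p : T × E => Y p.1 p.2) (ν.prod γ) :=
    integrable_of_bound (C := max (1 - ρ) (ρ⁻¹ - 1)) hYm fun p => by
      rw [Real.norm_eq_abs, abs_le]
      have h1 := hY1 p.1 p.2
      have h2 := hY2 p.1 p.2
      constructor
      · linarith [le_max_left (1 - ρ) (ρ⁻¹ - 1)]
      · linarith [le_max_right (1 - ρ) (ρ⁻¹ - 1)]
  have hwint : Integrable w ν := integrable_of_bound hwm hwb
  have hinner : ∀ η : E, ∫ t, ⟪w t, η⟫ ∂ν = ⟪∫ t, w t ∂ν, η⟫ := fun η => by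
    simp_rw [real_inner_comm η]
    exact integral_inner hwint η
  have hi2int : Integrable (fun p : T × E => ⟪w p.1, p.2⟫ ^ 2) (ν.prod γ) := by
    have hb : Integrable (fun p : T × E => B ^ 2 * ‖p.2‖ ^ 2) (ν.prod γ) :=
      ((integrable_norm_pow 2).const_mul _).comp_snd ν
    refine hb.mono' (by fun_prop) (Filter.Eventually.of_forall fun p => ?_)
    rw [Real.norm_eq_abs, abs_of_nonneg (sq_nonneg _), ← sq_abs, ← mul_pow]
    refine pow_le_pow_left₀ (abs_nonneg _) ((abs_real_inner_le_norm _ _).trans ?_) 2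
    exact mul_le_mul_of_nonneg_right (hwb _) (norm_nonneg _)
  have hlogm : Measurable fun η => ∫ t, Real.log (1 + Y t η) ∂ν := by
    have : StronglyMeasurable (fun p : E × T => Real.log (1 + Y p.2 p.1)) := by
      apply Measurable.stronglyMeasurable
      have : Measurable fun p : E × T => Y p.2 p.1 := hYm.comp measurable_swap
      fun_prop
    exact this.integral_prod_right.measurable
  have hS1 : Integrable (fun η => ∫ t, Y t η ∂ν) γ := hYint.integral_prod_right
  have hS2 : Integrable (fun η => ∫ t, ⟪w t, η⟫ ^ 2 ∂ν) γ := hi2int.integral_prod_right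
  have hS3 : Integrable (fun η => ⟪∫ t, w t ∂ν, η⟫ ^ 2) γ := by
    have hb : Integrable (fun η : E => ‖∫ t, w t ∂ν‖ ^ 2 * ‖η‖ ^ 2) γ :=
      (integrable_norm_pow 2).const_mul _
    refine hb.mono' (by fun_prop) (Filter.Eventually.of_forall fun η => ?_)
    rw [Real.norm_eq_abs, abs_of_nonneg (sq_nonneg _), ← sq_abs, ← mul_pow]
    exact pow_le_pow_left₀ (abs_nonneg _) (abs_real_inner_le_norm _ _) 2
  have hS4 : Integrable (fun η : E => (1 + ‖η‖ ^ 2) ^ 6) γ := integrable_one_add_sq_pow 6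
  have I1 : ∫ η, ∫ t, Y t η ∂ν ∂γ = 0 := by
    rw [← integral_integral_swap hYint]; simp [γ, hY0]
  have I2 : ∫ η, ∫ t, ⟪w t, η⟫ ^ 2 ∂ν ∂γ = ∫ t, ‖w t‖ ^ 2 ∂ν := by
    rw [← integral_integral_swap hi2int]; simp [γ, integral_inner_sq_stdGaussian]
  have I3 : ∫ η, ⟪∫ t, w t ∂ν, η⟫ ^ 2 ∂γ = ‖∫ t, w t ∂ν‖ ^ 2 := integral_inner_sq_stdGaussian _
  let G : E → ℝ := fun η => 1 + κ⁻¹ * ∫ t, Y t η ∂ν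
        - κ⁻¹ / 2 * r ^ 2 * ∫ t, ⟪w t, η⟫ ^ 2 ∂ν + κ⁻¹ ^ 2 / 2 * r ^ 2 * ⟪∫ t, w t ∂ν, η⟫ ^ 2
        + C * r ^ 3 * (1 + ‖η‖ ^ 2) ^ 6
  have hpt : ∀ η, Real.exp (κ⁻¹ * ∫ t, Real.log (1 + Y t η) ∂ν) ≤ G η := fun η => by
    have := hmain r (1 + ‖η‖ ^ 2) (fun t => Y t η) (fun t => ⟪w t, η⟫) hr hr1
      (by nlinarith [sq_nonneg ‖η‖]) (hYm.comp (by fun_prop : Measurable fun t => (t, η))) (by fun_prop)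
      (fun t => hY1 t η) (fun t => hY2 t η) (fun t => hYb t η)
      (fun t => abs_inner_le_of_norm_le (hwb t) η) (fun t => hYw t η)
    rw [hinner] at this
    exact this
  have hG1 : Integrable (fun η => 1 + κ⁻¹ * ∫ t, Y t η ∂ν) γ :=
    (integrable_const _).add (hS1.const_mul _)
  have hG2 : Integrable (fun η => 1 + κ⁻¹ * ∫ t, Y t η ∂ν
      - κ⁻¹ / 2 * r ^ 2 * ∫ t, ⟪w t, η⟫ ^ 2 ∂ν) γ := hG1.sub (hS2.const_mul _)
  have hG3 : Integrable (fun η => 1 + κ⁻¹ * ∫ t, Y t η ∂ν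
      - κ⁻¹ / 2 * r ^ 2 * ∫ t, ⟪w t, η⟫ ^ 2 ∂ν
      + κ⁻¹ ^ 2 / 2 * r ^ 2 * ⟪∫ t, w t ∂ν, η⟫ ^ 2) γ := hG2.add (hS3.const_mul _)
  have hG : Integrable G γ := hG3.add (hS4.const_mul _)
  calc ∫ η, Real.exp (κ⁻¹ * ∫ t, Real.log (1 + Y t η) ∂ν) ∂γ
      ≤ ∫ η, G η ∂γ := by
        refine integral_mono (hG.mono' (hlogm.const_mul _).exp.aestronglyMeasurable
          (Filter.Eventually.of_forall fun η => ?_)) hG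
          hpt
        rw [Real.norm_eq_abs, abs_of_pos (Real.exp_pos _)]; exact hpt η
    _ = 1 + κ⁻¹ * 0 - κ⁻¹ / 2 * r ^ 2 * ∫ t, ‖w t‖ ^ 2 ∂ν
        + κ⁻¹ ^ 2 / 2 * r ^ 2 * ‖∫ t, w t ∂ν‖ ^ 2
        + C * r ^ 3 * ∫ η : E, (1 + ‖η‖ ^ 2) ^ 6 ∂γ := by
      simp only [G]
      rw [integral_add hG3 (hS4.const_mul _), integral_add hG2 (hS3.const_mul _),
        integral_sub hG1 (hS2.const_mul _), integral_add (integrable_const _) (hS1.const_mul _)]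
      simp only [integral_const_mul, I1, I2, I3]
      simp [γ]
    _ ≤ _ := by
      have h1 : κ⁻¹ ^ 2 / 2 * r ^ 2 * ‖∫ t, w t ∂ν‖ ^ 2
          ≤ κ⁻¹ ^ 2 / 2 * r ^ 2 * (κ * ∫ t, ‖w t‖ ^ 2 ∂ν) := by gcongr
      have h2 : κ⁻¹ ^ 2 / 2 * r ^ 2 * (κ * ∫ t, ‖w t‖ ^ 2 ∂ν)
          = κ⁻¹ / 2 * r ^ 2 * ∫ t, ‖w t‖ ^ 2 ∂ν := by field_simp
      linarith

end

/-! ### The geometric mean along the heat flow. -/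

section

variable {E : Type*} [NormedAddCommGroup E] [InnerProductSpace ℝ E] [FiniteDimensional ℝ E]
  [MeasurableSpace E] [BorelSpace E] {T : Type*} [MeasurableSpace T]

lemma integrable_fun_sub {α F : Type*} [MeasurableSpace α] {μ : Measure α} [NormedAddCommGroup F]
    {f g : α → F} (hf : Integrable f μ) (hg : Integrable g μ) :
    Integrable (fun x => f x - g x) μ := hf.sub hg

lemma integrable_fun_add {α F : Type*} [MeasurableSpace α] {μ : Measure α} [NormedAddCommGroup F]
    {f g : α → F} (hf : Integrable f μ) (hg : Integrable g μ) :
    Integrable (fun x => f x + g x) μ := hf.add hg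

lemma integrable_inner_stdGaussian (w : E) : Integrable (fun η => ⟪w, η⟫) (stdGaussian E) := by
  refine ((integrable_norm_pow (E := E) 1).const_mul ‖w‖).mono' (by fun_prop)
    (Filter.Eventually.of_forall fun η => ?_)
  simpa using abs_real_inner_le_norm w η

/-- Families of functions with values in `[a, b]`, `f t` depending only on the component in `U t`,
with a gradient bounded by `B` and a quadratic Taylor estimate. -/
structure RegularFamily (U : T → Submodule ℝ E) (a b B : ℝ) (f : T → E → ℝ) : Prop where
  measurable : Measurable (Function.uncurry f)
  lower : ∀ t x, a ≤ f t x
  upper : ∀ t x, f t x ≤ b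
  invariant : ∀ t x, ∀ h ∈ (U t)ᗮ, f t (x + h) = f t x
  grad : ∃ g : T → E → E, Measurable (Function.uncurry g) ∧ (∀ t x, ‖g t x‖ ≤ B) ∧
    ∀ t x h, |f t (x + h) - f t x - ⟪g t x, h⟫| ≤ B * ‖h‖ ^ 2

/-- Square functions of families of vectors `v t ∈ U t` are controlled with constant `κ`. -/
def IsBessel (ν : Measure T) (U : T → Submodule ℝ E) (κ : ℝ) : Prop :=
  ∀ v : T → E, Measurable v → (∃ C, ∀ t, ‖v t‖ ≤ C) → (∀ t, v t ∈ U t) →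
    ‖∫ t, v t ∂ν‖ ^ 2 ≤ κ * ∫ t, ‖v t‖ ^ 2 ∂ν

/-- `exp (c ∫ log f)`. -/
def geomMean (ν : Measure T) (c : ℝ) (f : T → E → ℝ) (x : E) : ℝ :=
  Real.exp (c * ∫ t, Real.log (f t x) ∂ν)

lemma measurable_smooth {r : ℝ} {φ : E → ℝ} (hφ : Measurable φ) : Measurable (smooth r φ) := by
  have : StronglyMeasurable (fun p : E × E => φ (p.1 + r • p.2)) :=
    Measurable.stronglyMeasurable (by fun_prop)
  exact this.integral_prod_right.measurable

lemma measurable_smooth_uncurry {r : ℝ} {f : T → E → ℝ} (hf : Measurable (Function.uncurry f)) :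
    Measurable (Function.uncurry fun t => smooth r (f t)) := by
  have : StronglyMeasurable (fun p : (T × E) × E => f p.1.1 (p.1.2 + r • p.2)) :=
    Measurable.stronglyMeasurable
      (hf.comp (by fun_prop : Measurable fun p : (T × E) × E => (p.1.1, p.1.2 + r • p.2)))
  exact this.integral_prod_right.measurable

lemma measurable_geomMean {ν : Measure T} [SFinite ν] {c : ℝ} {f : T → E → ℝ}
    (hf : Measurable (Function.uncurry f)) : Measurable (geomMean ν c f) := by
  have : StronglyMeasurable (fun p : E × T => Real.log (f p.2 p.1)) :=
    Measurable.stronglyMeasurable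
      (hf.comp (by fun_prop : Measurable fun p : E × T => (p.2, p.1))).log
  exact (this.integral_prod_right.measurable.const_mul c).exp

lemma abs_log_le_of_mem {a b y : ℝ} (ha : 0 < a) (h1 : a ≤ y) (h2 : y ≤ b) :
    |Real.log y| ≤ |Real.log a| + |Real.log b| := by
  have l1 := Real.log_le_log ha h1
  have l2 := Real.log_le_log (ha.trans_le h1) h2
  rw [abs_le]
  constructor
  · linarith [neg_abs_le (Real.log a), abs_nonneg (Real.log b)]
  · linarith [le_abs_self (Real.log b), abs_nonneg (Real.log a)]

lemma geomMean_le {ν : Measure T} [IsFiniteMeasure ν] {c a b : ℝ} (hc : 0 ≤ c) {f : T → E → ℝ}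
    (ha : 0 < a) (h1 : ∀ t x, a ≤ f t x) (h2 : ∀ t x, f t x ≤ b) (x : E) :
    ‖geomMean ν c f x‖ ≤ Real.exp (c * (ν.real Set.univ * (|Real.log a| + |Real.log b|))) := by
  rw [geomMean, Real.norm_eq_abs, Real.abs_exp]
  gcongr
  exact (le_abs_self _).trans
    (abs_integral_le_of_abs_le fun t => abs_log_le_of_mem ha (h1 t x) (h2 t x))

lemma smooth_mem {r a b : ℝ} {φ : E → ℝ} (hφ : Measurable φ) (ha : ∀ x, a ≤ φ x)
    (hb : ∀ x, φ x ≤ b) (x : E) : a ≤ smooth r φ x ∧ smooth r φ x ≤ b := by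
  have hint : Integrable (fun η => φ (x + r • η)) (stdGaussian E) :=
    integrable_of_bound (C := max (-a) b) (by fun_prop) fun η => by
      rw [Real.norm_eq_abs, abs_le]
      constructor
      · linarith [ha (x + r • η), le_max_left (-a) b]
      · linarith [hb (x + r • η), le_max_right (-a) b]
  constructor
  · have := integral_mono (integrable_const a) hint fun η => ha (x + r • η)
    simpa [smooth] using this
  · have := integral_mono hint (integrable_const b) fun η => hb (x + r • η)
    simpa [smooth] using this

/-- The averaged gradient is a gradient for the averaged function. None of the constants a, b, B
deteriorates, so one error constant serves every generation of the dyadic iteration. -/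
lemma RegularFamily.smooth {U : T → Submodule ℝ E} {a b B : ℝ} {f : T → E → ℝ}
    (hf : RegularFamily U a b B f) (r : ℝ) :
    RegularFamily U a b B (fun t => smooth r (f t)) := by
  have hft : ∀ t, Measurable (f t) := fun t => hf.measurable.comp measurable_prodMk_left
  obtain ⟨g, hgm, hgb, hg⟩ := hf.grad
  have hgt : ∀ t, Measurable (g t) := fun t => hgm.comp measurable_prodMk_left
  refine ⟨measurable_smooth_uncurry hf.measurable,
    fun t x => (smooth_mem (hft t) (hf.lower t) (hf.upper t) x).1,
    fun t x => (smooth_mem (hft t) (hf.lower t) (hf.upper t) x).2, fun t x h hh => ?_, ?_⟩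
  · simp only [GaussianBL.smooth]
    congr 1 with η
    rw [add_right_comm, hf.invariant t _ h hh]
  have hfi : ∀ t x, Integrable (fun η => f t (x + r • η)) (stdGaussian E) := fun t x =>
    integrable_of_bound (C := max (-a) b) ((hft t).comp (by fun_prop)) fun η => by
      rw [Real.norm_eq_abs, abs_le]
      constructor
      · linarith [hf.lower t (x + r • η), le_max_left (-a) b]
      · linarith [hf.upper t (x + r • η), le_max_right (-a) b]
  have hgi : ∀ t x, Integrable (fun η => g t (x + r • η)) (stdGaussian E) := fun t x =>
    integrable_of_bound ((hgt t).comp (by fun_prop)) fun η => hgb t _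
  refine ⟨fun t x => ∫ η, g t (x + r • η) ∂(stdGaussian E), ?_, fun t x => ?_, fun t x h => ?_⟩
  · have : StronglyMeasurable (fun p : (T × E) × E => g p.1.1 (p.1.2 + r • p.2)) :=
      Measurable.stronglyMeasurable
        (hgm.comp (by fun_prop : Measurable fun p : (T × E) × E => (p.1.1, p.1.2 + r • p.2)))
    exact this.integral_prod_right.measurable
  · have := norm_integral_le_of_norm_le_const (μ := stdGaussian E)
      (Filter.Eventually.of_forall fun η => hgb t (x + r • η))
    simpa using this
  · have e : GaussianBL.smooth r (f t) (x + h) - GaussianBL.smooth r (f t) x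
        - ⟪∫ η, g t (x + r • η) ∂(stdGaussian E), h⟫
        = ∫ η, (f t (x + r • η + h) - f t (x + r • η) - ⟪g t (x + r • η), h⟫)
          ∂(stdGaussian E) := by
      have hin : Integrable (fun η => ⟪g t (x + r • η), h⟫) (stdGaussian E) :=
        (hgi t x).inner_const h
      have hin' : Integrable (fun η => f t (x + r • η + h)) (stdGaussian E) := by
        simpa only [add_right_comm] using hfi t (x + h)
      rw [integral_sub (integrable_fun_sub hin' (hfi t x)) hin, integral_sub hin' (hfi t x), real_inner_comm,
        ← integral_inner (hgi t x)]
      simp only [GaussianBL.smooth, add_right_comm x h, real_inner_comm]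
    rw [e]
    have := abs_integral_le_of_abs_le (ν := stdGaussian E) fun η => hg t (x + r • η) h
    simpa using this

/-- Along a direction orthogonal to U t the function is constant, so the linear term of the Taylor
estimate is bounded by a quadratic one and must vanish. This is what allows the Bessel hypothesis to
be applied to the gradients. -/
lemma RegularFamily.grad_mem {U : T → Submodule ℝ E} {a b B : ℝ} {f : T → E → ℝ}
    (hf : RegularFamily U a b B f) {t : T} {x g : E}
    (hg : ∀ h, |f t (x + h) - f t x - ⟪g, h⟫| ≤ B * ‖h‖ ^ 2) : g ∈ U t := by
  rw [← Submodule.orthogonal_orthogonal (U t), Submodule.mem_orthogonal]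
  intro h hh
  by_contra hne
  rw [real_inner_comm] at hne
  set s := ⟪g, h⟫ with hs
  have key : ∀ y : ℝ, 0 < y → |s| ≤ y * (B * ‖h‖ ^ 2) := fun y hy => by
    have h1 := hg (y • h)
    rw [hf.invariant t x _ ((U t)ᗮ.smul_mem y hh), sub_self, zero_sub, abs_neg, inner_smul_right,
      norm_smul, abs_mul, Real.norm_eq_abs, abs_of_pos hy, mul_pow] at h1
    have : y * |s| ≤ y * (y * (B * ‖h‖ ^ 2)) := by linarith
    exact le_of_mul_le_mul_left this hy
  have hs0 : 0 < |s| := abs_pos.2 hne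
  have hb : 0 < B * ‖h‖ ^ 2 := by have := key 1 one_pos; linarith
  -- With this step size the estimate reads |s| ≤ |s|/2.
  have := key (|s| / (2 * (B * ‖h‖ ^ 2))) (by positivity)
  rw [div_mul_eq_mul_div, mul_div_mul_right _ _ hb.ne'] at this
  linarith

/-- Each f t is divided by its own smoothed value at x. The relative fluctuation Y t is then
centred, with linear part r⟨w t, η⟩ where w t is the logarithmic gradient, a vector of U t. The
infinitesimal inequality applies with a constant depending only on a, b, B, κ and ν, not on f, x or
r. -/
lemma geomMean_step {ν : Measure T} [IsFiniteMeasure ν] {U : T → Submodule ℝ E} {κ a b B : ℝ}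
    (hκ : 0 < κ) (ha : 0 < a) (hab : a ≤ b) (hB : 0 ≤ B) (hU : IsBessel ν U κ) :
    ∃ C : ℝ, 0 ≤ C ∧ ∀ f : T → E → ℝ, RegularFamily U a b B f → ∀ r : ℝ, 0 < r → r ≤ 1 → ∀ x,
      smooth r (geomMean ν κ⁻¹ f) x
        ≤ (1 + C * r ^ 3) * geomMean ν κ⁻¹ (fun t => smooth r (f t)) x := by
  set m := ∫ η : E, (1 + ‖η‖ ^ 2) ∂(stdGaussian E) with hm
  have hmi : Integrable (fun η : E => 1 + ‖η‖ ^ 2) (stdGaussian E) := by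
    simpa using integrable_one_add_sq_pow (E := E) 1
  have hm0 : 0 ≤ m := integral_nonneg fun η => by positivity
  have hb : 0 < b := ha.trans_le hab
  obtain ⟨C, hC, hmain⟩ := integral_exp_integral_log_le (E := E) ν (κ := κ) (ρ := a / b)
    (B := (2 + m) * B / a) hκ (by positivity) (by positivity)
  refine ⟨C, hC, fun f hf r hr hr1 x => ?_⟩
  obtain ⟨g, hgm, hgb, hg⟩ := hf.grad
  have hft : ∀ t, Measurable (f t) := fun t => hf.measurable.comp measurable_prodMk_left
  have hfb : ∀ t x, |f t x| ≤ b := fun t x => by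
    rw [abs_of_pos (ha.trans_le (hf.lower t x))]; exact hf.upper t x
  have hfi : ∀ t, Integrable (fun η => f t (x + r • η)) (stdGaussian E) := fun t =>
    integrable_of_bound ((hft t).comp (by fun_prop)) fun η => hfb t _
  let F : T → ℝ := fun t => smooth r (f t) x
  have hFa : ∀ t, a ≤ F t := fun t => (smooth_mem (hft t) (hf.lower t) (hf.upper t) x).1
  have hFb : ∀ t, F t ≤ b := fun t => (smooth_mem (hft t) (hf.lower t) (hf.upper t) x).2
  have hF0 : ∀ t, 0 < F t := fun t => ha.trans_le (hFa t)
  have hFm : Measurable F :=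
    (measurable_smooth_uncurry hf.measurable).comp (by fun_prop : Measurable fun t => (t, x))
  -- The gradient term has Gaussian mean zero, so replacing f by its smoothing at the base point
  -- costs only r², not r.
  have hfF : ∀ t, |f t x - F t| ≤ B * r ^ 2 * m := fun t => by
    have e : F t - f t x = ∫ η, (f t (x + r • η) - f t x - ⟪g t x, r • η⟫) ∂(stdGaussian E) := by
      have hi : Integrable (fun η => ⟪g t x, r • η⟫) (stdGaussian E) := by
        simp_rw [inner_smul_right]
        exact (integrable_inner_stdGaussian _).const_mul _
      rw [integral_sub (integrable_fun_sub (hfi t) (integrable_const _)) hi,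
        integral_sub (hfi t) (integrable_const _)]
      simp_rw [inner_smul_right, integral_const_mul, integral_inner_stdGaussian]
      simp [F, smooth]
    rw [abs_sub_comm, e]
    have h1 : ∀ η : E, ‖f t (x + r • η) - f t x - ⟪g t x, r • η⟫‖
        ≤ B * r ^ 2 * (1 + ‖η‖ ^ 2) := fun η => by
      refine (hg t x (r • η)).trans ?_
      rw [norm_smul, Real.norm_eq_abs, abs_of_pos hr]
      nlinarith [mul_nonneg hB (sq_nonneg r)]
    have := norm_integral_le_of_norm_le (hmi.const_mul (B * r ^ 2))
      (Filter.Eventually.of_forall h1)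
    rwa [integral_const_mul] at this
  have hfr : ∀ t η, |f t (x + r • η) - f t x| ≤ 2 * B * r * (1 + ‖η‖ ^ 2) := fun t η => by
    have h1 := hg t x (r • η)
    have h2 := (abs_real_inner_le_norm (g t x) (r • η)).trans
      (mul_le_mul_of_nonneg_right (hgb t x) (norm_nonneg _))
    rw [norm_smul, Real.norm_eq_abs, abs_of_pos hr] at h1 h2
    have h3 : |f t (x + r • η) - f t x| ≤ B * (r * ‖η‖) ^ 2 + B * (r * ‖η‖) := by
      have := abs_add_le (f t (x + r • η) - f t x - ⟪g t x, r • η⟫) ⟪g t x, r • η⟫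
      rw [sub_add_cancel] at this; linarith
    have h4 : r ^ 2 ≤ r := by nlinarith
    have h5 : B * (r * ‖η‖) ^ 2 ≤ B * (r * ‖η‖ ^ 2) := by
      rw [mul_pow]; gcongr
    have h6 := mul_le_mul_of_nonneg_left (norm_le_one_add_sq η) (mul_nonneg hB hr.le)
    nlinarith [mul_nonneg hB hr.le]
  have hrr : r ^ 2 ≤ r := by nlinarith
  have hq : ∀ η : E, 1 ≤ 1 + ‖η‖ ^ 2 := fun η => by nlinarith [sq_nonneg ‖η‖]
  let Y : T → E → ℝ := fun t η => f t (x + r • η) / F t - 1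
  let w : T → E := fun t => (F t)⁻¹ • g t x
  have hYm : Measurable (Function.uncurry Y) :=
    ((hf.measurable.comp (by fun_prop : Measurable fun p : T × E => (p.1, x + r • p.2))).div
      (hFm.comp measurable_fst)).sub_const 1
  have hgx : Measurable fun t => g t x :=
    hgm.comp (by fun_prop : Measurable fun t => (t, x))
  have hwm : Measurable w := hFm.inv.smul hgx
  have hwb : ∀ t, ‖w t‖ ≤ B / a := fun t => by
    rw [norm_smul, norm_inv, Real.norm_eq_abs, abs_of_pos (hF0 t), inv_mul_eq_div]
    gcongr
    · exact hgb t x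
    · exact hFa t
  have hfF' : ∀ t, |f t x - F t| ≤ B * r ^ 2 * m := hfF
  have hY1 : ∀ t η, 1 + Y t η = f t (x + r • η) / F t := fun t η => by simp [Y]
  have hstep := hmain r Y w hr hr1 hYm hwm
    (fun t η => by
      rw [hY1]; gcongr
      · exact ha.le.trans (hf.lower _ _)
      · exact hF0 t
      · exact hf.lower _ _
      · exact hFb t)
    (fun t η => by
      rw [hY1, inv_div]; gcongr
      · exact hf.upper _ _
      · exact hFa t)
    (fun t η => by
      have e : Y t η = (f t (x + r • η) - F t) / F t := by
        simp only [Y]; rw [sub_div, div_self (hF0 t).ne']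
      rw [e, abs_div, abs_of_pos (hF0 t), div_mul_eq_mul_div, div_mul_eq_mul_div]
      refine div_le_div₀ (by positivity) ?_ ha (hFa t)
      · have h1 := abs_add_le (f t (x + r • η) - f t x) (f t x - F t)
        rw [sub_add_sub_cancel] at h1
        have h2 := hfr t η
        have h3 := hfF t
        have h4 : B * r ^ 2 * m ≤ B * r * m := by gcongr
        have h5 := mul_le_mul_of_nonneg_left (hq η) (by positivity : 0 ≤ B * r * m)
        nlinarith)
    (fun t => (hwb t).trans (by gcongr; nlinarith))
    (fun t η => by
      have e : Y t η - r * ⟪w t, η⟫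
          = (f t (x + r • η) - f t x - ⟪g t x, r • η⟫ + (f t x - F t)) / F t := by
        simp only [Y, w, inner_smul_left, inner_smul_right]
        have := (hF0 t).ne'
        simp only [map_inv₀, conj_trivial]
        field_simp
        ring
      rw [e, abs_div, abs_of_pos (hF0 t), div_mul_eq_mul_div, div_mul_eq_mul_div]
      refine div_le_div₀ (by positivity) ?_ ha (hFa t)
      · have h1 := abs_add_le (f t (x + r • η) - f t x - ⟪g t x, r • η⟫) (f t x - F t)
        have h2 := hg t x (r • η)
        rw [norm_smul, Real.norm_eq_abs, abs_of_pos hr, mul_pow] at h2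
        have h3 := hfF t
        have h4 := mul_le_mul_of_nonneg_left (hq η) (by positivity : 0 ≤ B * r ^ 2 * m)
        have h5 : 0 ≤ B * r ^ 2 := by positivity
        nlinarith [mul_nonneg h5 (sq_nonneg ‖η‖)])
    (fun t => by
      simp only [Y]
      rw [integral_sub ((hfi t).div_const _) (integrable_const _), integral_div]
      have : ∫ η, f t (x + r • η) ∂(stdGaussian E) = F t := rfl
      rw [this, div_self (hF0 t).ne']; simp)
    (hU w hwm ⟨_, hwb⟩ fun t => (U t).smul_mem _ (hf.grad_mem (hg t x)))
  have e : ∀ η, geomMean ν κ⁻¹ f (x + r • η) = geomMean ν κ⁻¹ (fun t => smooth r (f t)) x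
      * Real.exp (κ⁻¹ * ∫ t, Real.log (1 + Y t η) ∂ν) := fun η => by
    rw [geomMean, geomMean, ← Real.exp_add, ← mul_add, ← integral_add]
    · congr 2
      refine integral_congr_ae (Filter.Eventually.of_forall fun t => ?_)
      simp only [hY1]
      rw [Real.log_div (ha.trans_le (hf.lower _ _)).ne' (hF0 t).ne']
      simp [F]
    · exact integrable_of_bound hFm.log fun t => abs_log_le_of_mem ha (hFa t) (hFb t)
    · simp only [hY1]
      refine integrable_of_bound (C := |Real.log (a / b)| + |Real.log (b / a)|) ?_ fun t => ?_
      · exact ((hf.measurable.comp (by fun_prop : Measurable fun t => (t, x + r • η))).div hFm).log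
      · refine abs_log_le_of_mem (by positivity) ?_ ?_
        · gcongr
          · exact ha.le.trans (hf.lower _ _)
          · exact hF0 t
          · exact hf.lower _ _
          · exact hFb t
        · gcongr
          · exact hf.upper _ _
          · exact hFa t
  calc smooth r (geomMean ν κ⁻¹ f) x
      = geomMean ν κ⁻¹ (fun t => smooth r (f t)) x
        * ∫ η, Real.exp (κ⁻¹ * ∫ t, Real.log (1 + Y t η) ∂ν) ∂(stdGaussian E) := by
        rw [smooth]; simp_rw [e]; rw [integral_const_mul]
    _ ≤ geomMean ν κ⁻¹ (fun t => smooth r (f t)) x * (1 + C * r ^ 3) :=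
        mul_le_mul_of_nonneg_left hstep (Real.exp_pos _).le
    _ = _ := mul_comm _ _

/-- A smoothing of size ρ is two successive smoothings of size ρ/√2, by the semigroup law at angle
π/4. Each generation therefore squares the accumulated factor and divides the step by √2. -/
lemma geomMean_dyadic {ν : Measure T} [IsFiniteMeasure ν] {U : T → Submodule ℝ E} {κ a b B C : ℝ}
    (hκ : 0 < κ) (ha : 0 < a) (hC : 0 ≤ C)
    (h : ∀ f : T → E → ℝ, RegularFamily U a b B f → ∀ r : ℝ, 0 < r → r ≤ 1 → ∀ x,
      smooth r (geomMean ν κ⁻¹ f) x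
        ≤ (1 + C * r ^ 3) * geomMean ν κ⁻¹ (fun t => smooth r (f t)) x) (j : ℕ) :
    ∀ f : T → E → ℝ, RegularFamily U a b B f → ∀ ρ : ℝ, 0 < ρ → ρ ≤ 1 → ∀ x,
      smooth ρ (geomMean ν κ⁻¹ f) x ≤ (1 + C * (ρ / √2 ^ j) ^ 3) ^ (2 ^ j)
        * geomMean ν κ⁻¹ (fun t => smooth ρ (f t)) x := by
  induction j with
  | zero => intro f hf ρ h0 h1 x; simpa using h f hf ρ h0 h1 x
  | succ j ih =>
    intro f hf ρ h0 h1 x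
    have hft : ∀ t, Measurable (f t) := fun t => hf.measurable.comp measurable_prodMk_left
    have hs2 : (0:ℝ) < √2 := by positivity
    set ρ' := ρ / √2 with hρ'
    have hcos : ρ * Real.cos (Real.pi / 4) = ρ' := by
      rw [Real.cos_pi_div_four, hρ', mul_div_assoc', div_eq_div_iff (by norm_num) hs2.ne',
        mul_assoc, Real.mul_self_sqrt (by norm_num)]
    have hsin : ρ * Real.sin (Real.pi / 4) = ρ' := by
      rw [Real.sin_pi_div_four, ← Real.cos_pi_div_four, hcos]
    have hρ0 : 0 < ρ' := by positivity
    have hρ1 : ρ' ≤ 1 := by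
      rw [hρ', div_le_one hs2]
      exact h1.trans (Real.one_le_sqrt.2 (by norm_num))
    have hdiv : ρ' / √2 ^ j = ρ / √2 ^ (j + 1) := by rw [hρ', div_div, pow_succ']
    have hgb := geomMean_le (ν := ν) (inv_nonneg.2 hκ.le) ha hf.lower hf.upper
    have hgm : Measurable (geomMean ν κ⁻¹ f) := measurable_geomMean hf.measurable
    set A := (1 + C * (ρ / √2 ^ (j + 1)) ^ 3) ^ (2 ^ j)
    have hA : 0 ≤ A := by positivity
    have hf' := hf.smooth ρ'
    have hgb' := geomMean_le (ν := ν) (inv_nonneg.2 hκ.le) ha hf'.lower hf'.upper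
    have hgm' : Measurable (geomMean ν κ⁻¹ fun t => smooth ρ' (f t)) :=
      measurable_geomMean hf'.measurable
    have e1 := smooth_smooth ρ (Real.pi / 4) hgm hgb x
    rw [hcos, hsin] at e1
    rw [← e1]
    have e2 : (fun t => smooth ρ (f t)) = fun t => smooth ρ' (smooth ρ' (f t)) := by
      ext t y
      have := smooth_smooth ρ (Real.pi / 4) (hft t) (C := max (-a) b) (fun z => by
        rw [Real.norm_eq_abs, abs_le]
        constructor
        · linarith [hf.lower t z, le_max_left (-a) b]
        · linarith [hf.upper t z, le_max_right (-a) b]) y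
      rw [hcos, hsin] at this
      exact this.symm
    have i1 := ih f hf ρ' hρ0 hρ1
    have i2 := ih _ hf' ρ' hρ0 hρ1 x
    rw [hdiv] at i1 i2
    have hint : ∀ φ : E → ℝ, Measurable φ → (∃ D, ∀ y, ‖φ y‖ ≤ D) →
        Integrable (fun η => φ (x + ρ' • η)) (stdGaussian E) := fun φ hφ ⟨D, hD⟩ =>
      integrable_of_bound (by fun_prop) fun η => hD _
    have hsb : ∃ D, ∀ y, ‖smooth ρ' (geomMean ν κ⁻¹ f) y‖ ≤ D := ⟨_, fun y => by
      have := norm_integral_le_of_norm_le_const (μ := stdGaussian E)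
        (Filter.Eventually.of_forall fun η => hgb (y + ρ' • η))
      simpa [smooth] using this⟩
    calc smooth ρ' (smooth ρ' (geomMean ν κ⁻¹ f)) x
        ≤ smooth ρ' (fun y => A * geomMean ν κ⁻¹ (fun t => smooth ρ' (f t)) y) x :=
          integral_mono (hint _ (measurable_smooth hgm) hsb)
            ((hint _ hgm' ⟨_, hgb'⟩).const_mul A) fun η => i1 _
      _ = A * smooth ρ' (geomMean ν κ⁻¹ (fun t => smooth ρ' (f t))) x :=
          integral_const_mul _ _
      _ ≤ A * (A * geomMean ν κ⁻¹ (fun t => smooth ρ' (smooth ρ' (f t))) x) := by gcongr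
      _ = _ := by rw [e2, pow_succ 2 j, pow_mul, ← mul_assoc, ← sq]

/-- After j halvings the error factor is at most exp(2^j C (ρ 2^(-j/2))³) = exp(Cρ³ 2^(-j/2)), which
tends to 1. -/
lemma smooth_geomMean_le {ν : Measure T} [IsFiniteMeasure ν] {U : T → Submodule ℝ E} {κ a b B : ℝ}
    (hκ : 0 < κ) (ha : 0 < a) (hab : a ≤ b) (hB : 0 ≤ B) (hU : IsBessel ν U κ)
    {f : T → E → ℝ} (hf : RegularFamily U a b B f) {ρ : ℝ} (h0 : 0 < ρ) (h1 : ρ ≤ 1) (x : E) :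
    smooth ρ (geomMean ν κ⁻¹ f) x ≤ geomMean ν κ⁻¹ (fun t => smooth ρ (f t)) x := by
  obtain ⟨C, hC, h⟩ := geomMean_step hκ ha hab hB hU
  have hj := fun j => geomMean_dyadic hκ ha hC h j f hf ρ h0 h1 x
  set G := geomMean ν κ⁻¹ (fun t => smooth ρ (f t)) x
  have hG : 0 ≤ G := (Real.exp_pos _).le
  have hs2 : (0:ℝ) < √2 := by positivity
  have hs1 : (1:ℝ) < √2 := Real.lt_sqrt_of_sq_lt (by norm_num)
  have hbound : ∀ j : ℕ, smooth ρ (geomMean ν κ⁻¹ f) x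
      ≤ Real.exp (C * ρ ^ 3 * ((√2)⁻¹) ^ j) * G := fun j => by
    refine (hj j).trans (mul_le_mul_of_nonneg_right ?_ hG)
    have e : C * ρ ^ 3 * ((√2)⁻¹) ^ j = (2 ^ j : ℕ) * (C * (ρ / √2 ^ j) ^ 3) := by
      have h2 : ((2 ^ j : ℕ) : ℝ) = (√2 ^ j) ^ 2 := by
        rw [← pow_mul, mul_comm j 2, pow_mul, Real.sq_sqrt (by norm_num)]; simp
      rw [h2, inv_pow]
      field_simp
    rw [e, Real.exp_nat_mul]
    gcongr
    rw [add_comm]; exact Real.add_one_le_exp _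
  have hlim : Filter.Tendsto (fun j : ℕ => Real.exp (C * ρ ^ 3 * ((√2)⁻¹) ^ j) * G) Filter.atTop
      (nhds (Real.exp (C * ρ ^ 3 * 0) * G)) := by
    refine Filter.Tendsto.mul_const _ (Real.continuous_exp.continuousAt.tendsto.comp ?_)
    exact (tendsto_pow_atTop_nhds_zero_of_lt_one (by positivity)
      (inv_lt_one_of_one_lt₀ hs1)).const_mul _
  have := ge_of_tendsto' hlim hbound
  simpa using this

end

/-! ### Cameron–Martin formula and regularity of smoothed functions. -/

section

variable {E : Type*} [NormedAddCommGroup E] [InnerProductSpace ℝ E] [FiniteDimensional ℝ E]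
  [MeasurableSpace E] [BorelSpace E]

lemma integrable_exp_norm (c : ℝ) :
    Integrable (fun η : E => Real.exp (c * ‖η‖)) (stdGaussian E) := by
  obtain ⟨C, hC, h⟩ := IsGaussian.exists_integrable_exp_sq (stdGaussian E)
  refine (h.const_mul (Real.exp (c ^ 2 / (4 * C)))).mono' (by fun_prop)
    (Filter.Eventually.of_forall fun η => ?_)
  rw [Real.norm_eq_abs, Real.abs_exp, ← Real.exp_add]
  gcongr
  have : c ^ 2 / (4 * C) + C * ‖η‖ ^ 2 - c * ‖η‖ = C * (‖η‖ - c / (2 * C)) ^ 2 := by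
    field_simp; ring
  nlinarith [mul_nonneg hC.le (sq_nonneg (‖η‖ - c / (2 * C)))]

lemma integrable_exp_inner (h : E) :
    Integrable (fun η : E => Real.exp ⟪h, η⟫) (stdGaussian E) := by
  refine (integrable_exp_norm ‖h‖).mono' (by fun_prop) (Filter.Eventually.of_forall fun η => ?_)
  rw [Real.norm_eq_abs, Real.abs_exp]
  gcongr
  exact real_inner_le_norm h η

lemma integral_cexp_inner (a h : E) :
    ∫ η, Complex.exp ((⟪a, η⟫ : ℂ) * Complex.I + (⟪h, η⟫ : ℂ)) ∂(stdGaussian E)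
      = Complex.exp (-(‖a‖ : ℂ) ^ 2 / 2 + (⟪a, h⟫ : ℂ) * Complex.I + (‖h‖ : ℂ) ^ 2 / 2) := by
  let b := stdOrthonormalBasis ℝ E
  have hin : ∀ u v : E, ⟪u, v⟫ = ∑ i, b.repr u i * b.repr v i := fun u v => by
    rw [← b.repr.inner_map_map u v, PiLp.inner_apply]
    simp [mul_comm]
  rw [stdGaussian_eq_map_pi_orthonormalBasis b, integral_map
    (Measurable.aemeasurable (by fun_prop)) (by fun_prop)]
  have e : ∀ y : Fin (Module.finrank ℝ E) → ℝ,
      Complex.exp ((⟪a, ∑ i, y i • b i⟫ : ℂ) * Complex.I + (⟪h, ∑ i, y i • b i⟫ : ℂ))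
        = ∏ i, Complex.exp (((b.repr a i : ℂ) * Complex.I + (b.repr h i : ℂ)) * (y i : ℂ)) := by
    intro y
    rw [← Complex.exp_sum]
    congr 1
    simp only [inner_sum, inner_smul_right]
    push_cast
    rw [Finset.sum_mul, ← Finset.sum_add_distrib]
    refine Finset.sum_congr rfl fun i _ => ?_
    have h1 : ⟪a, b i⟫ = b.repr a i := by rw [b.repr_apply_apply, real_inner_comm]
    have h2 : ⟪h, b i⟫ = b.repr h i := by rw [b.repr_apply_apply, real_inner_comm]
    rw [h1, h2]; ring
  simp_rw [e]
  rw [integral_fintype_prod_eq_prod (𝕜 := ℂ)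
    (fun i (y : ℝ) => Complex.exp (((b.repr a i : ℂ) * Complex.I + (b.repr h i : ℂ)) * (y : ℂ)))]
  have e1 : ∀ z : ℂ, ∫ y : ℝ, Complex.exp (z * y) ∂(gaussianReal 0 1) = Complex.exp (z ^ 2 / 2) := by
    intro z
    have := complexMGF_id_gaussianReal (μ := 0) (v := 1) z
    simpa [complexMGF] using this
  simp_rw [e1]
  rw [← Complex.exp_sum]
  congr 1
  rw [← Complex.ofReal_pow, ← Complex.ofReal_pow, ← real_inner_self_eq_norm_sq,
    ← real_inner_self_eq_norm_sq, hin a a, hin a h, hin h h]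
  push_cast
  rw [neg_div, Finset.sum_div, Finset.sum_div, Finset.sum_mul, ← Finset.sum_neg_distrib,
    ← Finset.sum_add_distrib, ← Finset.sum_add_distrib]
  refine Finset.sum_congr rfl fun i _ => ?_
  ring_nf
  rw [Complex.I_sq]; ring

/-- Cameron–Martin formula for the standard Gaussian measure. -/
lemma stdGaussian_map_add (h : E) : (stdGaussian E).map (· + h)
    = (stdGaussian E).withDensity fun η => ENNReal.ofReal (Real.exp (⟪h, η⟫ - ‖h‖ ^ 2 / 2)) := by
  have hint : Integrable (fun η : E => Real.exp (⟪h, η⟫ - ‖h‖ ^ 2 / 2)) (stdGaussian E) := by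
    simp_rw [sub_eq_add_neg, Real.exp_add]
    exact (integrable_exp_inner h).mul_const _
  have : IsFiniteMeasure ((stdGaussian E).withDensity
      fun η => ENNReal.ofReal (Real.exp (⟪h, η⟫ - ‖h‖ ^ 2 / 2))) :=
    isFiniteMeasure_withDensity_ofReal hint.2
  refine Measure.ext_of_charFun ?_
  ext a
  have hshift : charFun ((stdGaussian E).map (· + h)) a
      = Complex.exp ((⟪a, h⟫ : ℂ) * Complex.I) * charFun (stdGaussian E) a := by
    rw [charFun_apply, charFun_apply, integral_map (by fun_prop) (by fun_prop),
      ← integral_const_mul]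
    congr 1 with η
    rw [← Complex.exp_add, inner_add_left, real_inner_comm a h]
    push_cast; ring_nf
  rw [hshift, charFun_stdGaussian, charFun_apply,
    integral_withDensity_eq_integral_toReal_smul (by fun_prop) (by simp)]
  have e : ∀ η : E, (ENNReal.ofReal (Real.exp (⟪h, η⟫ - ‖h‖ ^ 2 / 2))).toReal
      • Complex.exp ((⟪η, a⟫ : ℂ) * Complex.I)
      = Complex.exp (-(‖h‖ : ℂ) ^ 2 / 2)
        * Complex.exp ((⟪a, η⟫ : ℂ) * Complex.I + (⟪h, η⟫ : ℂ)) := fun η => by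
    rw [ENNReal.toReal_ofReal (Real.exp_pos _).le, Complex.real_smul, Complex.ofReal_exp,
      ← Complex.exp_add, ← Complex.exp_add, real_inner_comm a η]
    congr 1
    push_cast; ring
  simp_rw [e]
  rw [integral_const_mul, integral_cexp_inner, ← Complex.exp_add, ← Complex.exp_add]
  congr 1; ring

lemma integral_comp_add_stdGaussian {φ : E → ℝ} (hφ : Measurable φ) (h : E) :
    ∫ η, φ (η + h) ∂(stdGaussian E)
      = ∫ η, φ η * Real.exp (⟪h, η⟫ - ‖h‖ ^ 2 / 2) ∂(stdGaussian E) := by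
  have h1 : ∫ η, φ (η + h) ∂(stdGaussian E) = ∫ η, φ η ∂((stdGaussian E).map (· + h)) := by
    rw [integral_map (by fun_prop) hφ.aestronglyMeasurable]
  rw [h1, stdGaussian_map_add,
    integral_withDensity_eq_integral_toReal_smul (by fun_prop) (by simp)]
  congr 1 with η
  rw [ENNReal.toReal_ofReal (Real.exp_pos _).le, smul_eq_mul, mul_comm]

/-- A second-order Taylor estimate in L¹ for the Cameron–Martin density. It moves the
differentiation from the function to the Gaussian weight. -/
lemma exists_integral_abs_density_le :
    ∃ C : ℝ, 0 ≤ C ∧ ∀ k : E, ‖k‖ ≤ 1 →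
      Integrable (fun η => Real.exp (⟪k, η⟫ - ‖k‖ ^ 2 / 2) - 1 - ⟪k, η⟫) (stdGaussian E) ∧
      ∫ η, |Real.exp (⟪k, η⟫ - ‖k‖ ^ 2 / 2) - 1 - ⟪k, η⟫| ∂(stdGaussian E) ≤ C * ‖k‖ ^ 2 := by
  let D : E → ℝ := fun η => 1 / 2 + 2 * Real.exp (2 * (‖η‖ + 1))
  have hD : Integrable D (stdGaussian E) := by
    have := ((integrable_exp_norm (E := E) 2).mul_const (Real.exp 2)).const_mul 2
    refine (integrable_const _).add (this.congr (Filter.Eventually.of_forall fun η => ?_))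
    simp only [← Real.exp_add]; ring_nf
  refine ⟨∫ η, D η ∂(stdGaussian E), integral_nonneg fun η => by positivity, fun k hk => ?_⟩
  have hpt : ∀ η : E, |Real.exp (⟪k, η⟫ - ‖k‖ ^ 2 / 2) - 1 - ⟪k, η⟫| ≤ D η * ‖k‖ ^ 2 := by
    intro η
    set y := ⟪k, η⟫ - ‖k‖ ^ 2 / 2 with hy
    have hk2 : ‖k‖ ^ 2 ≤ ‖k‖ := by nlinarith [norm_nonneg k]
    have hin := abs_real_inner_le_norm k η
    have hyk : |y| ≤ ‖k‖ * (‖η‖ + 1) := by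
      have := abs_sub ⟪k, η⟫ (‖k‖ ^ 2 / 2)
      rw [abs_of_nonneg (by positivity : 0 ≤ ‖k‖ ^ 2 / 2)] at this
      nlinarith [norm_nonneg k]
    have hy1 : |y| ≤ ‖η‖ + 1 := hyk.trans (by nlinarith [norm_nonneg η])
    have h := Complex.norm_exp_sub_sum_le_norm_mul_exp (y : ℂ) 2
    have e : Complex.exp (y : ℂ) - ∑ m ∈ Finset.range 2, (y : ℂ) ^ m / (m.factorial : ℂ)
        = ((Real.exp y - (1 + y) : ℝ) : ℂ) := by
      simp [Finset.sum_range_succ, Nat.factorial]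
    rw [e, Complex.norm_real, Complex.norm_real, Real.norm_eq_abs, Real.norm_eq_abs] at h
    have h3 : |y| ^ 2 * Real.exp |y| ≤ (‖k‖ * (‖η‖ + 1)) ^ 2 * Real.exp (‖η‖ + 1) := by gcongr
    have h4 : (‖η‖ + 1) ^ 2 ≤ 2 * Real.exp (‖η‖ + 1) := by
      have := Real.quadratic_le_exp_of_nonneg (by positivity : 0 ≤ ‖η‖ + 1)
      nlinarith [norm_nonneg η]
    have h5 : (‖k‖ * (‖η‖ + 1)) ^ 2 * Real.exp (‖η‖ + 1)
        ≤ ‖k‖ ^ 2 * (2 * Real.exp (2 * (‖η‖ + 1))) := by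
      rw [mul_pow, mul_assoc]
      refine mul_le_mul_of_nonneg_left ?_ (sq_nonneg _)
      calc (‖η‖ + 1) ^ 2 * Real.exp (‖η‖ + 1)
          ≤ 2 * Real.exp (‖η‖ + 1) * Real.exp (‖η‖ + 1) := by gcongr
        _ = _ := by rw [mul_assoc, ← Real.exp_add]; ring_nf
    have h6 : |Real.exp y - 1 - ⟪k, η⟫| ≤ |Real.exp y - (1 + y)| + ‖k‖ ^ 2 / 2 := by
      have e2 : Real.exp y - 1 - ⟪k, η⟫ = (Real.exp y - (1 + y)) - ‖k‖ ^ 2 / 2 := by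
        rw [hy]; ring
      rw [e2]
      refine (abs_sub _ _).trans ?_
      rw [abs_of_nonneg (by positivity : 0 ≤ ‖k‖ ^ 2 / 2)]
    simp only [D]
    nlinarith
  have hi := hD.mul_const (‖k‖ ^ 2)
  have hint : Integrable (fun η => Real.exp (⟪k, η⟫ - ‖k‖ ^ 2 / 2) - 1 - ⟪k, η⟫)
      (stdGaussian E) := hi.mono' (by fun_prop) (Filter.Eventually.of_forall hpt)
  refine ⟨hint, ?_⟩
  rw [← integral_mul_const]
  exact integral_mono hint.abs hi hpt

variable {T : Type*} [MeasurableSpace T]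

/-- A positive amount of smoothing makes any bounded measurable family regular. By Gaussian
integration by parts the gradient is r⁻¹ E[f(x + rη) η], which makes sense without any smoothness of
f. -/
lemma exists_regularFamily_smooth {U : T → Submodule ℝ E} {a b r : ℝ} (ha : 0 < a) (hr : 0 < r)
    {f : T → E → ℝ} (hfm : Measurable (Function.uncurry f)) (h1 : ∀ t x, a ≤ f t x)
    (h2 : ∀ t x, f t x ≤ b) (hinv : ∀ t x, ∀ h ∈ (U t)ᗮ, f t (x + h) = f t x) :
    ∃ B : ℝ, 0 ≤ B ∧ RegularFamily U a b B (fun t => smooth r (f t)) := by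
  obtain ⟨C, hC, hdens⟩ := exists_integral_abs_density_le (E := E)
  set m := ∫ η : E, ‖η‖ ∂(stdGaussian E) with hm
  have hm0 : 0 ≤ m := integral_nonneg fun η => norm_nonneg _
  have hmi : Integrable (fun η : E => ‖η‖) (stdGaussian E) := by
    simpa using integrable_norm_pow (E := E) 1
  have hft : ∀ t, Measurable (f t) := fun t => hfm.comp measurable_prodMk_left
  set b' := |b| with hb'
  have hfb : ∀ t x, ‖f t x‖ ≤ b' := fun t x => by
    rw [Real.norm_eq_abs, abs_of_pos (ha.trans_le (h1 t x))]
    exact (h2 t x).trans (le_abs_self b)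
  have hb0 : 0 ≤ b' := abs_nonneg b
  have hfi : ∀ t x, Integrable (fun η => f t (x + r • η)) (stdGaussian E) := fun t x =>
    integrable_of_bound ((hft t).comp (by fun_prop)) fun η => hfb t _
  have hvm : Measurable fun p : (T × E) × E => f p.1.1 (p.1.2 + r • p.2) • p.2 :=
    (hfm.comp (by fun_prop : Measurable fun p : (T × E) × E =>
      (p.1.1, p.1.2 + r • p.2))).smul measurable_snd
  have hvb : ∀ t (x η : E), ‖f t (x + r • η) • η‖ ≤ b' * ‖η‖ := fun t x η => by
    rw [norm_smul]; gcongr; exact hfb t _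
  have hvi : ∀ t x, Integrable (fun η => f t (x + r • η) • η) (stdGaussian E) := fun t x =>
    (hmi.const_mul b').mono' ((((hft t).comp (by fun_prop : Measurable fun η => x + r • η)).smul
      measurable_id).aestronglyMeasurable) (Filter.Eventually.of_forall (hvb t x))
  have hgb : ∀ t x, ‖∫ η, f t (x + r • η) • η ∂(stdGaussian E)‖ ≤ b' * m := fun t x => by
    rw [hm, ← integral_const_mul]
    exact norm_integral_le_of_norm_le (hmi.const_mul b')
      (Filter.Eventually.of_forall (hvb t x))
  refine ⟨b' * (2 + m + C) * (r⁻¹ ^ 2 + r⁻¹), by positivity, measurable_smooth_uncurry hfm,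
    fun t x => (smooth_mem (hft t) (h1 t) (h2 t) x).1,
    fun t x => (smooth_mem (hft t) (h1 t) (h2 t) x).2, fun t x h hh => ?_,
    fun t x => r⁻¹ • ∫ η, f t (x + r • η) • η ∂(stdGaussian E), ?_, fun t x => ?_, ?_⟩
  · simp only [smooth]
    congr 1 with η
    rw [add_right_comm, hinv t _ h hh]
  · have : StronglyMeasurable fun p : (T × E) × E => f p.1.1 (p.1.2 + r • p.2) • p.2 :=
      hvm.stronglyMeasurable
    exact this.integral_prod_right.measurable.const_smul r⁻¹
  · rw [norm_smul, Real.norm_eq_abs, abs_of_pos (inv_pos.2 hr)]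
    have h3 := mul_le_mul_of_nonneg_left (hgb t x) (inv_pos.2 hr).le
    have h4 : 0 ≤ b' * (2 + m + C) * r⁻¹ ^ 2 := by positivity
    have h5 : 0 ≤ b' * (2 + C) * r⁻¹ := by positivity
    nlinarith
  · intro t x h
    set k := r⁻¹ • h with hk
    have hrk : r • k = h := by rw [hk, smul_smul, mul_inv_cancel₀ hr.ne', one_smul]
    have hkn : ‖k‖ = r⁻¹ * ‖h‖ := by
      rw [hk, norm_smul, Real.norm_eq_abs, abs_of_pos (inv_pos.2 hr)]
    have eg : ⟪r⁻¹ • ∫ η, f t (x + r • η) • η ∂(stdGaussian E), h⟫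
        = ∫ η, f t (x + r • η) * ⟪k, η⟫ ∂(stdGaussian E) := by
      rw [real_inner_smul_left, ← real_inner_smul_right, ← hk, real_inner_comm,
        ← integral_inner (hvi t x)]
      simp only [inner_smul_right]
    rw [eg]
    suffices |smooth r (f t) (x + h) - smooth r (f t) x
        - ∫ η, f t (x + r • η) * ⟪k, η⟫ ∂(stdGaussian E)| ≤ b' * (2 + m + C) * ‖k‖ ^ 2 by
      refine this.trans ?_
      rw [hkn]
      have : 0 ≤ b' * (2 + m + C) * r⁻¹ * ‖h‖ ^ 2 := by positivity
      nlinarith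
    have hki : Integrable (fun η => f t (x + r • η) * ⟪k, η⟫) (stdGaussian E) := by
      have := (hvi t x).const_inner (𝕜 := ℝ) k
      simpa only [inner_smul_right] using this
    have hkb : |∫ η, f t (x + r • η) * ⟪k, η⟫ ∂(stdGaussian E)| ≤ b' * ‖k‖ * m := by
      rw [hm, ← integral_const_mul]
      refine norm_integral_le_of_norm_le (f := fun η => f t (x + r • η) * ⟪k, η⟫)
        (hmi.const_mul _) (Filter.Eventually.of_forall fun η => ?_)
      rw [norm_mul, mul_assoc]
      exact mul_le_mul (hfb _ _) (abs_real_inner_le_norm k η) (norm_nonneg _) hb0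
    have hsb : ∀ y, |smooth r (f t) y| ≤ b' := fun y => by
      have := norm_integral_le_of_norm_le_const (μ := stdGaussian E)
        (Filter.Eventually.of_forall fun η => hfb t (y + r • η))
      simpa [smooth] using this
    -- Small translations use the density expansion. For ‖k‖ ≥ 1 boundedness is enough, because then
    -- both 1 and ‖k‖ are at most ‖k‖².
    rcases le_total ‖k‖ 1 with hk1 | hk1
    · obtain ⟨di, dle⟩ := hdens k hk1
      have hshift : smooth r (f t) (x + h)
          = ∫ η, f t (x + r • η) * Real.exp (⟪k, η⟫ - ‖k‖ ^ 2 / 2) ∂(stdGaussian E) := by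
        rw [← integral_comp_add_stdGaussian (φ := fun η => f t (x + r • η))
          ((hft t).comp (by fun_prop)) k]
        simp only [smooth, smul_add, hrk]
        congr 1 with η
        congr 1; abel
      have hei : Integrable (fun η => f t (x + r • η) * Real.exp (⟪k, η⟫ - ‖k‖ ^ 2 / 2))
          (stdGaussian E) := by
        have h3 : Integrable (fun η : E => Real.exp (⟪k, η⟫ - ‖k‖ ^ 2 / 2)) (stdGaussian E) := by
          simp_rw [sub_eq_add_neg, Real.exp_add]
          exact (integrable_exp_inner k).mul_const _
        exact h3.bdd_mul ((hft t).comp (by fun_prop)).aestronglyMeasurable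
          (Filter.Eventually.of_forall fun η => hfb t _)
      have e : smooth r (f t) (x + h) - smooth r (f t) x
          - ∫ η, f t (x + r • η) * ⟪k, η⟫ ∂(stdGaussian E)
          = ∫ η, f t (x + r • η) * (Real.exp (⟪k, η⟫ - ‖k‖ ^ 2 / 2) - 1 - ⟪k, η⟫)
            ∂(stdGaussian E) := by
        rw [hshift, smooth, ← integral_sub hei (hfi t x),
          ← integral_sub (integrable_fun_sub hei (hfi t x)) hki]
        congr 1 with η; ring
      rw [e]
      have h3 := norm_integral_le_of_norm_le (μ := stdGaussian E)
        (f := fun η => f t (x + r • η) * (Real.exp (⟪k, η⟫ - ‖k‖ ^ 2 / 2) - 1 - ⟪k, η⟫))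
        (di.abs.const_mul b')
        (Filter.Eventually.of_forall fun η => by
          rw [norm_mul, Real.norm_eq_abs (_ - _)]
          exact mul_le_mul_of_nonneg_right (hfb _ _) (abs_nonneg _))
      rw [integral_const_mul] at h3
      refine h3.trans ((mul_le_mul_of_nonneg_left dle hb0).trans ?_)
      have : 0 ≤ b' * (2 + m) * ‖k‖ ^ 2 := by positivity
      nlinarith
    · have h3 := abs_sub (smooth r (f t) (x + h) - smooth r (f t) x)
        (∫ η, f t (x + r • η) * ⟪k, η⟫ ∂(stdGaussian E))
      have h4 := abs_sub (smooth r (f t) (x + h)) (smooth r (f t) x)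
      have h5 := hsb (x + h)
      have h6 := hsb x
      have h7 : ‖k‖ ≤ ‖k‖ ^ 2 := by nlinarith
      have h8 : b' * ‖k‖ * m ≤ b' * m * ‖k‖ ^ 2 := by
        rw [mul_right_comm]; gcongr
      have h9 : b' * 2 * 1 ≤ b' * 2 * ‖k‖ ^ 2 := by gcongr; nlinarith
      have h10 : 0 ≤ b' * C * ‖k‖ ^ 2 := by positivity
      nlinarith

end

/-! ### The Gaussian Brascamp–Lieb inequality for measurable families. -/

section

variable {E : Type*} [NormedAddCommGroup E] [InnerProductSpace ℝ E] [FiniteDimensional ℝ E]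
  [MeasurableSpace E] [BorelSpace E] {T : Type*} [MeasurableSpace T]

lemma abs_exp_sub_exp_le {u v D : ℝ} (hu : |u| ≤ D) (hv : |v| ≤ D) :
    |Real.exp u - Real.exp v| ≤ Real.exp D * |u - v| := by
  wlog h : v ≤ u generalizing u v
  · rw [abs_sub_comm, abs_sub_comm u v]; exact this hv hu (le_of_not_ge h)
  rw [abs_of_nonneg (sub_nonneg.2 (Real.exp_le_exp.2 h)), abs_of_nonneg (sub_nonneg.2 h)]
  have h1 := Real.add_one_le_exp (v - u)
  have h2 : Real.exp v = Real.exp u * Real.exp (v - u) := by rw [← Real.exp_add]; ring_nf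
  have h3 : Real.exp u ≤ Real.exp D := Real.exp_le_exp.2 ((le_abs_self u).trans hu)
  have h4 : Real.exp u * (v - u + 1) ≤ Real.exp v := by rw [h2]; gcongr
  nlinarith [mul_le_mul_of_nonneg_right h3 (sub_nonneg.2 h)]

lemma integral_comp_rotation {φ : E → ℝ} (hφ : Measurable φ) {C : ℝ} (hC : ∀ x, ‖φ x‖ ≤ C)
    (θ : ℝ) : ∫ ξ, ∫ η, φ (Real.cos θ • ξ + Real.sin θ • η) ∂(stdGaussian E) ∂(stdGaussian E)
      = ∫ ξ, φ ξ ∂(stdGaussian E) := by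
  have := smooth_smooth 1 θ hφ hC 0
  simpa [smooth] using this

/-- The rotated function `φ (cos θ ξ + sin θ η)` tends to `φ ξ` in mean as `θ → 0`. -/
lemma tendsto_integral_rotation_sub {φ : E → ℝ} (hφ : Measurable φ) {D : ℝ}
    (hD : ∀ x, ‖φ x‖ ≤ D) {θ : ℕ → ℝ} (hθ : Filter.Tendsto θ Filter.atTop (nhds 0)) :
    Filter.Tendsto (fun n => ∫ ξ, ∫ η, |φ (Real.cos (θ n) • ξ + Real.sin (θ n) • η) - φ ξ|
      ∂(stdGaussian E) ∂(stdGaussian E)) Filter.atTop (nhds 0) := by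
  set γ := stdGaussian E
  have hφi : Integrable φ γ := integrable_of_bound hφ hD
  -- replace the mean square by an integral over the product
  have hprod : ∀ (ψ : E → ℝ) (n : ℕ), Measurable ψ → (∃ C, ∀ x, ‖ψ x‖ ≤ C) →
      Integrable (fun p : E × E => |ψ (Real.cos (θ n) • p.1 + Real.sin (θ n) • p.2) - ψ p.1|)
        (γ.prod γ) := fun ψ n hψ ⟨C, hC⟩ => by
    refine integrable_of_bound (C := C + C) ?_ fun p => ?_
    · have h1 : Measurable fun p : E × E => ψ (Real.cos (θ n) • p.1 + Real.sin (θ n) • p.2) :=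
        hψ.comp (by fun_prop)
      have h2 : Measurable fun p : E × E => ψ p.1 := hψ.comp measurable_fst
      exact (h1.sub h2).abs
    · rw [Real.norm_eq_abs, abs_abs]
      exact (abs_sub _ _).trans (add_le_add (hC _) (hC _))
  have hnn : ∀ n, 0 ≤ ∫ ξ, ∫ η, |φ (Real.cos (θ n) • ξ + Real.sin (θ n) • η) - φ ξ| ∂γ ∂γ :=
    fun n => integral_nonneg fun ξ => integral_nonneg fun η => abs_nonneg _
  rw [Metric.tendsto_atTop]
  intro ε hε
  -- For a bounded continuous g the claim is dominated convergence. The two replacement errors are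
  -- each at most ε/4, since the rotated point has the same law as ξ.
  obtain ⟨g, hg, -⟩ := hφi.exists_boundedContinuous_integral_sub_le (ε := ε / 4) (by positivity)
  have hgm : Measurable g := g.continuous.measurable
  have hgb : ∀ x, ‖g x‖ ≤ ‖g‖ := g.norm_coe_le_norm
  have hglim : Filter.Tendsto (fun n => ∫ p, |g (Real.cos (θ n) • p.1 + Real.sin (θ n) • p.2)
      - g p.1| ∂(γ.prod γ)) Filter.atTop (nhds (∫ _ : E × E, (0:ℝ) ∂(γ.prod γ))) := by
    refine tendsto_integral_of_dominated_convergence (fun _ => ‖g‖ + ‖g‖)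
      (fun n => (hprod g n hgm ⟨_, hgb⟩).aestronglyMeasurable) (integrable_const _)
      (fun n => Filter.Eventually.of_forall fun p => ?_) (Filter.Eventually.of_forall fun p => ?_)
    · rw [Real.norm_eq_abs, abs_abs]
      exact (abs_sub _ _).trans (add_le_add (hgb _) (hgb _))
    · have hc : Continuous fun y : ℝ => |g (Real.cos y • p.1 + Real.sin y • p.2) - g p.1| := by
        fun_prop
      have := (hc.tendsto 0).comp hθ
      simpa [Function.comp_def] using this
  rw [integral_zero, Metric.tendsto_atTop] at hglim
  obtain ⟨n₀, hn₀⟩ := hglim (ε / 4) (by positivity)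
  refine ⟨n₀, fun n hn => ?_⟩
  have h1 := hn₀ n hn
  have hgi := hprod g n hgm ⟨_, hgb⟩
  rw [Real.dist_eq, sub_zero, abs_of_nonneg (integral_nonneg fun p => abs_nonneg _)] at h1
  rw [Real.dist_eq, sub_zero, abs_of_nonneg (hnn n)]
  have hdm : Measurable fun x => |φ x - g x| := (hφ.sub hgm).abs
  have hdb : ∀ x, ‖|φ x - g x|‖ ≤ D + ‖g‖ := fun x => by
    rw [Real.norm_eq_abs, abs_abs]
    exact (abs_sub _ _).trans (add_le_add (hD x) (hgb x))
  have hA : Integrable (fun p : E × E => |φ (Real.cos (θ n) • p.1 + Real.sin (θ n) • p.2)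
      - g (Real.cos (θ n) • p.1 + Real.sin (θ n) • p.2)|) (γ.prod γ) :=
    integrable_of_bound (hdm.comp (by fun_prop)) fun p => hdb _
  have hB : Integrable (fun p : E × E => |φ p.1 - g p.1|) (γ.prod γ) :=
    integrable_of_bound (hdm.comp measurable_fst) fun p => hdb _
  have hAe : ∫ p : E × E, |φ (Real.cos (θ n) • p.1 + Real.sin (θ n) • p.2)
      - g (Real.cos (θ n) • p.1 + Real.sin (θ n) • p.2)| ∂(γ.prod γ) ≤ ε / 4 := by
    rw [integral_prod _ hA]
    have := integral_comp_rotation hdm hdb (θ n)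
    rw [this]; exact hg
  have hBe : ∫ p : E × E, |φ p.1 - g p.1| ∂(γ.prod γ) ≤ ε / 4 := by
    rw [integral_prod _ hB]
    simpa [γ] using hg
  calc ∫ ξ, ∫ η, |φ (Real.cos (θ n) • ξ + Real.sin (θ n) • η) - φ ξ| ∂γ ∂γ
      = ∫ p : E × E, |φ (Real.cos (θ n) • p.1 + Real.sin (θ n) • p.2) - φ p.1| ∂(γ.prod γ) := by
        rw [integral_prod _ (hprod φ n hφ ⟨D, hD⟩)]
    _ ≤ ∫ p : E × E, (|φ (Real.cos (θ n) • p.1 + Real.sin (θ n) • p.2)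
          - g (Real.cos (θ n) • p.1 + Real.sin (θ n) • p.2)|
        + |g (Real.cos (θ n) • p.1 + Real.sin (θ n) • p.2) - g p.1| + |φ p.1 - g p.1|)
          ∂(γ.prod γ) := by
        refine integral_mono (hprod φ n hφ ⟨D, hD⟩) ((hA.add hgi).add hB) fun p => ?_
        have h2 := abs_sub_le (φ (Real.cos (θ n) • p.1 + Real.sin (θ n) • p.2))
          (g (Real.cos (θ n) • p.1 + Real.sin (θ n) • p.2)) (φ p.1)
        have h3 := abs_sub_le (g (Real.cos (θ n) • p.1 + Real.sin (θ n) • p.2)) (g p.1) (φ p.1)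
        rw [abs_sub_comm (g p.1)] at h3
        simp only
        linarith
    _ < ε := by
        rw [integral_add (integrable_fun_add hA hgi) hB, integral_add hA hgi]
        linarith

/-- A Brascamp–Lieb inequality for the standard Gaussian measure. -/
theorem integral_geomMean_le {ν : Measure T} [IsFiniteMeasure ν] {U : T → Submodule ℝ E}
    {κ a b : ℝ} (hκ : 0 < κ) (ha : 0 < a) (hab : a ≤ b) (hU : IsBessel ν U κ) {f : T → E → ℝ}
    (hfm : Measurable (Function.uncurry f)) (h1 : ∀ t x, a ≤ f t x) (h2 : ∀ t x, f t x ≤ b)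
    (hinv : ∀ t x, ∀ h ∈ (U t)ᗮ, f t (x + h) = f t x) :
    ∫ x, geomMean ν κ⁻¹ f x ∂(stdGaussian E)
      ≤ Real.exp (κ⁻¹ * ∫ t, Real.log (∫ x, f t x ∂(stdGaussian E)) ∂ν) := by
  set γ := stdGaussian E
  have hft : ∀ t, Measurable (f t) := fun t => hfm.comp measurable_prodMk_left
  have hfb : ∀ t x, ‖f t x‖ ≤ b := fun t x => by
    rw [Real.norm_eq_abs, abs_of_pos (ha.trans_le (h1 t x))]; exact h2 t x
  set D := κ⁻¹ * (ν.real Set.univ * (|Real.log a| + |Real.log b|)) with hD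
  have hκ' : 0 ≤ κ⁻¹ := (inv_pos.2 hκ).le
  have hlogb : ∀ t x, |Real.log (f t x)| ≤ |Real.log a| + |Real.log b| := fun t x =>
    abs_log_le_of_mem ha (h1 t x) (h2 t x)
  let Φ : E → ℝ := fun x => κ⁻¹ * ∫ t, Real.log (f t x) ∂ν
  have hΦm : Measurable Φ := by
    have : StronglyMeasurable (fun p : E × T => Real.log (f p.2 p.1)) :=
      Measurable.stronglyMeasurable
        (hfm.comp (by fun_prop : Measurable fun p : E × T => (p.2, p.1))).log
    exact this.integral_prod_right.measurable.const_mul _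
  have hΦb : ∀ x, ‖Φ x‖ ≤ D := fun x => by
    rw [Real.norm_eq_abs, abs_mul, abs_of_nonneg hκ']
    exact mul_le_mul_of_nonneg_left (abs_integral_le_of_abs_le fun t => hlogb t x) hκ'
  set R := Real.exp (κ⁻¹ * ∫ t, Real.log (∫ x, f t x ∂γ) ∂ν) with hR
  -- The angles tend to 0 inside (0, 1], where sine and cosine are both positive. A smoothing of
  -- size sin θ regularises the family and one of size cos θ carries the heat flow.
  let θ : ℕ → ℝ := fun n => 1 / ((n : ℝ) + 1)
  have hθ0 : ∀ n, 0 < θ n := fun n => by positivity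
  have hθ1 : ∀ n, θ n ≤ 1 := fun n => by
    simp only [θ]; rw [div_le_one (by positivity)]; linarith [Nat.cast_nonneg (α := ℝ) n]
  have hθlim : Filter.Tendsto θ Filter.atTop (nhds 0) := tendsto_one_div_add_atTop_nhds_zero_nat
  have hlim := tendsto_integral_rotation_sub hΦm hΦb hθlim
  have hkey : ∀ n, ∫ x, Real.exp (Φ x) ∂γ ≤ R + Real.exp D
      * ∫ ξ, ∫ η, |Φ (Real.cos (θ n) • ξ + Real.sin (θ n) • η) - Φ ξ| ∂γ ∂γ := by
    intro n
    set c := Real.cos (θ n) with hc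
    set s := Real.sin (θ n) with hs
    have hs0 : 0 < s := Real.sin_pos_of_pos_of_le_one (hθ0 n) (hθ1 n)
    have hc0 : 0 < c := Real.cos_pos_of_le_one (by rw [abs_of_pos (hθ0 n)]; exact hθ1 n)
    obtain ⟨B, hB, hreg⟩ := exists_regularFamily_smooth ha hs0 hfm h1 h2 hinv
    have hmain := smooth_geomMean_le hκ ha hab hB hU hreg hc0 (Real.cos_le_one _) 0
    -- Since c² + s² = 1, the two smoothings at the origin compose to the full Gaussian mean.
    have e1 : geomMean ν κ⁻¹ (fun t => smooth c (smooth s (f t))) 0 = R := by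
      rw [geomMean, hR]
      congr 3 with t
      congr 1
      have := smooth_smooth 1 (θ n) (hft t) (hfb t) 0
      rw [one_mul, one_mul] at this
      rw [this]
      simp [smooth, γ]
    rw [e1] at hmain
    have hSΦm : Measurable (smooth s Φ) := measurable_smooth hΦm
    have hSΦb : ∀ x, |smooth s Φ x| ≤ D := fun x => by
      have := abs_integral_le_of_abs_le (ν := γ) (f := fun η => Φ (x + s • η)) (fun η => hΦb _)
      simpa [smooth, γ] using this
    -- Jensen's inequality inside the geometric mean
    have hjensen : ∀ x, Real.exp (smooth s Φ x) ≤ geomMean ν κ⁻¹ (fun t => smooth s (f t)) x := by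
      intro x
      rw [geomMean]
      gcongr
      have hpi : Integrable (fun p : E × T => Real.log (f p.2 (x + s • p.1))) (γ.prod ν) := by
        refine integrable_of_bound (C := |Real.log a| + |Real.log b|) ?_ fun p => hlogb _ _
        exact (hfm.comp (by fun_prop : Measurable fun p : E × T => (p.2, x + s • p.1))).log
      have e2 : smooth s Φ x = κ⁻¹ * ∫ t, ∫ η, Real.log (f t (x + s • η)) ∂γ ∂ν := by
        simp only [smooth, Φ]
        rw [integral_const_mul]
        congr 1
        exact integral_integral_swap hpi
      rw [e2]
      gcongr
      · exact hpi.integral_prod_right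
      · refine integrable_of_bound (C := |Real.log a| + |Real.log b|) ?_ fun t => ?_
        · exact ((measurable_smooth_uncurry hfm).comp
            (by fun_prop : Measurable fun t => (t, x))).log
        · exact abs_log_le_of_mem ha (hreg.lower t x) (hreg.upper t x)
      · intro t
        have hfi : Integrable (fun η => f t (x + s • η)) γ :=
          integrable_of_bound ((hft t).comp (by fun_prop)) fun η => hfb t _
        have hli : Integrable (Real.log ∘ fun η => f t (x + s • η)) γ :=
          integrable_of_bound ((hft t).comp (by fun_prop : Measurable fun η => x + s • η)).log
            fun η => hlogb _ _
        exact ((strictConcaveOn_log_Ioi.concaveOn).subset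
          (fun y hy => ha.trans_le hy : Set.Ici a ⊆ Set.Ioi 0) (convex_Ici a)).le_map_integral
          (Real.continuousOn_log.mono fun y hy => (ha.trans_le hy).ne') isClosed_Ici
          (Filter.Eventually.of_forall fun η => h1 t _) hfi hli
    have hmean : ∫ ξ, Real.exp (smooth s Φ (c • ξ)) ∂γ ≤ R := by
      refine le_trans ?_ hmain
      have : smooth c (geomMean ν κ⁻¹ fun t => smooth s (f t)) 0
          = ∫ ξ, geomMean ν κ⁻¹ (fun t => smooth s (f t)) (c • ξ) ∂γ := by simp [smooth, γ]
      rw [this]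
      refine integral_mono ?_ ?_ fun ξ => hjensen _
      · refine integrable_of_bound (C := Real.exp D) (hSΦm.comp (by fun_prop)).exp fun ξ => ?_
        rw [Real.norm_eq_abs, Real.abs_exp]
        gcongr; exact (le_abs_self _).trans (hSΦb _)
      · exact integrable_of_bound ((measurable_geomMean hreg.measurable).comp (by fun_prop))
          fun ξ => geomMean_le hκ' ha hreg.lower hreg.upper _
    have hpi2 : Integrable (fun p : E × E => |Φ (c • p.1 + s • p.2) - Φ p.1|) (γ.prod γ) := by
      refine integrable_of_bound (C := D + D) ?_ fun p => ?_
      · have h3 : Measurable fun p : E × E => Φ (c • p.1 + s • p.2) := hΦm.comp (by fun_prop)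
        exact (h3.sub (hΦm.comp measurable_fst)).abs
      · rw [Real.norm_eq_abs, abs_abs]
        exact (abs_sub _ _).trans (add_le_add (hΦb _) (hΦb _))
    -- Undoing the regularisation costs only the mean displacement of Φ under a small rotation,
    -- which tends to 0 with the angle.
    have hdiff : ∀ ξ, Real.exp (Φ ξ) ≤ Real.exp (smooth s Φ (c • ξ))
        + Real.exp D * ∫ η, |Φ (c • ξ + s • η) - Φ ξ| ∂γ := fun ξ => by
      have h3 := abs_exp_sub_exp_le (hΦb ξ) (hSΦb (c • ξ))
      have h4 : |Φ ξ - smooth s Φ (c • ξ)| ≤ ∫ η, |Φ (c • ξ + s • η) - Φ ξ| ∂γ := by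
        have e3 : smooth s Φ (c • ξ) - Φ ξ = ∫ η, (Φ (c • ξ + s • η) - Φ ξ) ∂γ := by
          have h6 : Integrable (fun η => Φ (c • ξ + s • η)) γ :=
            integrable_of_bound (hΦm.comp (by fun_prop)) fun η => hΦb _
          rw [integral_sub h6 (integrable_const _)]
          simp [smooth, γ]
        rw [abs_sub_comm, e3]
        exact abs_integral_le_integral_abs
      have h5 := (le_abs_self _).trans
        (h3.trans (mul_le_mul_of_nonneg_left h4 (Real.exp_pos D).le))
      linarith
    have hi1 : Integrable (fun ξ => Real.exp (smooth s Φ (c • ξ))) γ := by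
      refine integrable_of_bound (C := Real.exp D) (hSΦm.comp (by fun_prop)).exp fun ξ => ?_
      rw [Real.norm_eq_abs, Real.abs_exp]
      gcongr; exact (le_abs_self _).trans (hSΦb _)
    have hi2 : Integrable (fun ξ => Real.exp D * ∫ η, |Φ (c • ξ + s • η) - Φ ξ| ∂γ) γ :=
      hpi2.integral_prod_left.const_mul _
    calc ∫ x, Real.exp (Φ x) ∂γ
        ≤ ∫ ξ, (Real.exp (smooth s Φ (c • ξ))
          + Real.exp D * ∫ η, |Φ (c • ξ + s • η) - Φ ξ| ∂γ) ∂γ := by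
          refine integral_mono ?_ (hi1.add hi2) hdiff
          refine integrable_of_bound (C := Real.exp D) hΦm.exp fun ξ => ?_
          rw [Real.norm_eq_abs, Real.abs_exp]
          gcongr; exact (le_abs_self _).trans (hΦb _)
      _ ≤ _ := by
          rw [integral_add hi1 hi2, integral_const_mul]
          linarith
  have hfinal : Filter.Tendsto (fun n => R + Real.exp D
      * ∫ ξ, ∫ η, |Φ (Real.cos (θ n) • ξ + Real.sin (θ n) • η) - Φ ξ| ∂γ ∂γ) Filter.atTop
      (nhds (R + Real.exp D * 0)) := (hlim.const_mul _).const_add _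
  have := ge_of_tendsto' hfinal hkey
  simpa [geomMean, Φ] using this

/-- Bernstein type bound for the exponential moment of an integral of bounded functions of
weakly dependent Gaussian vectors. -/
theorem integral_exp_integral_le {ν : Measure T} [IsFiniteMeasure ν] {U : T → Submodule ℝ E}
    {κ : ℝ} (hκ : 0 < κ) (hU : IsBessel ν U κ) {φ : T → E → ℝ}
    (hφm : Measurable (Function.uncurry φ)) (hφb : ∀ t x, κ * |φ t x| ≤ 1)
    (hinv : ∀ t x, ∀ h ∈ (U t)ᗮ, φ t (x + h) = φ t x) :
    ∫ x, Real.exp (∫ t, φ t x ∂ν) ∂(stdGaussian E)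
      ≤ Real.exp (∫ t, (∫ x, φ t x ∂(stdGaussian E) + κ * ∫ x, φ t x ^ 2 ∂(stdGaussian E)) ∂ν) := by
  set γ := stdGaussian E
  have hb : ∀ t x, |κ * φ t x| ≤ 1 := fun t x => by
    rw [abs_mul, abs_of_pos hκ]; exact hφb t x
  have hφb' : ∀ t x, |φ t x| ≤ κ⁻¹ := fun t x => by
    rw [← one_div, le_div_iff₀' hκ]; exact hφb t x
  have hφt : ∀ t, Measurable (φ t) := fun t => hφm.comp measurable_prodMk_left
  have h := integral_geomMean_le (ν := ν) (f := fun t x => Real.exp (κ * φ t x)) hκ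
    (Real.exp_pos (-1)) (Real.exp_le_exp.2 (by norm_num : (-1:ℝ) ≤ 1)) hU (hφm.const_mul κ).exp
    (fun t x => Real.exp_le_exp.2 (abs_le.1 (hb t x)).1)
    (fun t x => Real.exp_le_exp.2 (abs_le.1 (hb t x)).2)
    (fun t x h hh => by simp only [hinv t x h hh])
  have e : ∀ x, geomMean ν κ⁻¹ (fun t x => Real.exp (κ * φ t x)) x
      = Real.exp (∫ t, φ t x ∂ν) := fun x => by
    simp only [geomMean, Real.log_exp]
    rw [integral_const_mul, ← mul_assoc, inv_mul_cancel₀ hκ.ne', one_mul]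
  simp_rw [e] at h
  refine h.trans (Real.exp_le_exp.2 ?_)
  rw [← integral_const_mul]
  have hpi : Integrable (Function.uncurry φ) (ν.prod γ) :=
    integrable_of_bound hφm fun p => hφb' p.1 p.2
  have hsqb : ∀ t x, ‖φ t x ^ 2‖ ≤ κ⁻¹ ^ 2 := fun t x => by
    rw [Real.norm_eq_abs, abs_pow]; exact pow_le_pow_left₀ (abs_nonneg _) (hφb' t x) 2
  have hpi2 : Integrable (fun p : T × E => φ p.1 p.2 ^ 2) (ν.prod γ) :=
    integrable_of_bound (hφm.pow_const 2) fun p => hsqb p.1 p.2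
  have hexpb : ∀ t x, Real.exp (-1) ≤ Real.exp (κ * φ t x) ∧
      Real.exp (κ * φ t x) ≤ Real.exp 1 := fun t x =>
    ⟨Real.exp_le_exp.2 (abs_le.1 (hb t x)).1, Real.exp_le_exp.2 (abs_le.1 (hb t x)).2⟩
  have hei : ∀ t, Integrable (fun x => Real.exp (κ * φ t x)) γ := fun t =>
    integrable_of_bound (C := Real.exp 1) ((hφt t).const_mul κ).exp fun x => by
      rw [Real.norm_eq_abs, Real.abs_exp]; exact (hexpb t x).2
  have hElow : ∀ t, Real.exp (-1) ≤ ∫ x, Real.exp (κ * φ t x) ∂γ := fun t => by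
    have := integral_mono (integrable_const (Real.exp (-1))) (hei t) fun x => (hexpb t x).1
    simpa [γ] using this
  have hEup : ∀ t, ∫ x, Real.exp (κ * φ t x) ∂γ ≤ Real.exp 1 := fun t => by
    have := integral_mono (hei t) (integrable_const (Real.exp 1)) fun x => (hexpb t x).2
    simpa [γ] using this
  refine integral_mono ?_ (hpi.integral_prod_left.add (hpi2.integral_prod_left.const_mul κ))
    fun t => ?_
  · refine Integrable.const_mul (integrable_of_bound (C := |Real.log (Real.exp (-1))|
      + |Real.log (Real.exp 1)|) ?_ fun t =>
      abs_log_le_of_mem (Real.exp_pos _) (hElow t) (hEup t)) _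
    have : StronglyMeasurable (fun p : T × E => Real.exp (κ * φ p.1 p.2)) :=
      Measurable.stronglyMeasurable (hφm.const_mul κ).exp
    exact this.integral_prod_right.measurable.log
  · have hi1 : Integrable (φ t) γ := integrable_of_bound (hφt t) (hφb' t)
    have hi2 : Integrable (fun x => φ t x ^ 2) γ :=
      integrable_of_bound ((hφt t).pow_const 2) (hsqb t)
    have hi3 : Integrable (fun x => κ * φ t x + κ ^ 2 * φ t x ^ 2) γ :=
      (hi1.const_mul κ).add (hi2.const_mul _)
    -- From e^y ≤ 1 + y + y² for |y| ≤ 1. Combined with log z ≤ z - 1 this replaces the logarithm of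
    -- the exponential moment by the first two moments.
    have h3 : ∫ x, Real.exp (κ * φ t x) ∂γ
        ≤ 1 + (κ * ∫ x, φ t x ∂γ + κ ^ 2 * ∫ x, φ t x ^ 2 ∂γ) := by
      have := integral_mono (hei t) ((integrable_const (1:ℝ)).add hi3) fun x => by
        have h4 := Real.abs_exp_sub_one_sub_id_le (hb t x)
        have h5 := le_abs_self (Real.exp (κ * φ t x) - 1 - κ * φ t x)
        simp only [Pi.add_apply]
        nlinarith
      refine this.trans (le_of_eq ?_)
      simp only [Pi.add_apply]
      rw [integral_add (integrable_const _) hi3, integral_add (hi1.const_mul κ) (hi2.const_mul _),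
        integral_const_mul, integral_const_mul]
      simp [γ]
    have h4 := Real.log_le_sub_one_of_pos ((Real.exp_pos (-1)).trans_le (hElow t))
    simp only
    calc κ⁻¹ * Real.log (∫ x, Real.exp (κ * φ t x) ∂γ)
        ≤ κ⁻¹ * (κ * ∫ x, φ t x ∂γ + κ ^ 2 * ∫ x, φ t x ^ 2 ∂γ) := by
          gcongr; linarith
      _ = _ := by field_simp

end

/-! ### Complex Gaussian coordinates and Bessel inequalities for pairs of waves. -/

/-- The standard complex Gaussian law. -/
def stdComplex : Measure ℂ :=
  ((gaussianReal 0 (1 / 2)).prod (gaussianReal 0 (1 / 2))).map (fun p => (⟨p.1, p.2⟩ : ℂ))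

lemma measurable_complex_mk : Measurable fun p : ℝ × ℝ => (⟨p.1, p.2⟩ : ℂ) :=
  Complex.measurableEquivRealProd.symm.measurable

instance : IsProbabilityMeasure stdComplex :=
  Measure.isProbabilityMeasure_map measurable_complex_mk.aemeasurable

/-- Real coordinates for complex Gaussian vectors indexed by `s`. -/
abbrev RealCoord (s : Finset ℕ) := EuclideanSpace ℝ (s × Fin 2)

/-- The complex vector with the given real coordinates, normalised to unit variance. -/
def toC {s : Finset ℕ} (u : RealCoord s) (k : s) : ℂ := ⟨u (k, 0) / √2, u (k, 1) / √2⟩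

lemma measurable_toC {s : Finset ℕ} : Measurable (toC (s := s)) := by
  refine measurable_pi_lambda _ fun k => ?_
  exact measurable_complex_mk.comp
    (by fun_prop : Measurable fun u : RealCoord s => (u (k, 0) / √2, u (k, 1) / √2))

lemma map_pi_fin_two : (Measure.pi fun _ : Fin 2 => gaussianReal 0 1).map
    (fun w => (⟨w 0 / √2, w 1 / √2⟩ : ℂ)) = stdComplex := by
  have h1 := (measurePreserving_finTwoArrow (gaussianReal 0 1)).map_eq
  have h2 : gaussianReal 0 (1 / 2) = (gaussianReal 0 1).map (· / √2) := by
    rw [gaussianReal_map_div_const]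
    congr 1
    · simp
    · ext; simp
  rw [stdComplex, h2, Measure.map_prod_map _ _ (by fun_prop) (by fun_prop), ← h1,
    Measure.map_map (by fun_prop) (MeasurableEquiv.measurable _),
    Measure.map_map measurable_complex_mk]
  · rfl
  · exact Measurable.comp (by fun_prop) (MeasurableEquiv.measurable _)

lemma map_toC (s : Finset ℕ) :
    (stdGaussian (RealCoord s)).map toC = Measure.pi fun _ : s => stdComplex := by
  have hm : Measurable fun w : Fin 2 → ℝ => (⟨w 0 / √2, w 1 / √2⟩ : ℂ) :=
    measurable_complex_mk.comp (by fun_prop : Measurable fun w : Fin 2 → ℝ => (w 0 / √2, w 1 / √2))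
  rw [← map_pi_eq_stdGaussian, Measure.map_map measurable_toC (by fun_prop)]
  have e : toC ∘ WithLp.toLp 2 = (fun (w : s → Fin 2 → ℝ) k => (⟨w k 0 / √2, w k 1 / √2⟩ : ℂ))
      ∘ MeasurableEquiv.curry s (Fin 2) ℝ := by
    ext w k
    all_goals rfl
  rw [e, ← Measure.map_map ?_ (MeasurableEquiv.measurable _), ← Measure.infinitePi_eq_pi,
    Measure.infinitePi_map_curry (fun (_ : s) (_ : Fin 2) => gaussianReal 0 1),
    Measure.infinitePi_eq_pi]
  · simp_rw [Measure.infinitePi_eq_pi]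
    rw [Measure.pi_map_pi (fun _ => hm.aemeasurable)]
    simp_rw [map_pi_fin_two]
  · exact measurable_pi_lambda _ fun k => hm.comp (measurable_pi_apply k)

lemma integral_exp_int_mul {k : ℤ} (hk : k ≠ 0) :
    ∫ t in Set.Ioc 0 (2 * Real.pi), Complex.exp (Complex.I * k * t) = 0 := by
  rw [← intervalIntegral.integral_of_le (by positivity)]
  have h : (Complex.I * k) ≠ 0 := mul_ne_zero Complex.I_ne_zero (by exact_mod_cast hk)
  rw [integral_exp_mul_complex h]
  have : Complex.I * (k : ℂ) * ((2 * Real.pi : ℝ) : ℂ) = k * (2 * Real.pi * Complex.I) := by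
    push_cast; ring
  rw [this, Complex.exp_int_mul_two_pi_mul_I]
  simp

/-- Bessel's inequality for the Fourier coefficients of a bounded function on the circle. -/
lemma sum_norm_fourier_sq_le (s : Finset ℕ) {a : ℝ → ℂ} (ha : Measurable a) {C : ℝ}
    (hC : ∀ t, ‖a t‖ ≤ C) :
    ∑ k ∈ s, ‖∫ t in Set.Ioc 0 (2 * Real.pi), a t * Complex.exp (Complex.I * k * t)‖ ^ 2
      ≤ 2 * Real.pi * ∫ t in Set.Ioc 0 (2 * Real.pi), ‖a t‖ ^ 2 := by
  set ν := volume.restrict (Set.Ioc 0 (2 * Real.pi)) with hν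
  have : IsFiniteMeasure ν := by rw [hν]; infer_instance
  set c : ℕ → ℂ := fun k => ∫ t, a t * Complex.exp (Complex.I * k * t) ∂ν with hc
  set S := ∑ k ∈ s, ‖c k‖ ^ 2 with hS
  have hexpm : ∀ k : ℕ, Measurable fun t : ℝ => Complex.exp (Complex.I * k * t) := fun k => by
    fun_prop
  have hexpn : ∀ (k : ℕ) (t : ℝ), ‖Complex.exp (Complex.I * k * t)‖ = 1 := fun k t => by
    have : Complex.I * k * t = ((k * t : ℝ) : ℂ) * Complex.I := by push_cast; ring
    rw [this, Complex.norm_exp_ofReal_mul_I]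
  let q : ℝ → ℂ := fun t => ∑ k ∈ s, (starRingEnd ℂ) (c k) * Complex.exp (Complex.I * k * t)
  have hqm : Measurable q := by fun_prop
  have hcqm : Measurable fun t => (starRingEnd ℂ) (q t) := Complex.continuous_conj.measurable.comp hqm
  have hqb : ∀ t, ‖q t‖ ≤ ∑ k ∈ s, ‖c k‖ := fun t => by
    refine (norm_sum_le _ _).trans (Finset.sum_le_sum fun k _ => ?_)
    rw [norm_mul, hexpn, mul_one, RCLike.norm_conj]
  have hai : ∀ k : ℕ, Integrable (fun t => a t * Complex.exp (Complex.I * k * t)) ν := fun k =>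
    integrable_of_bound (C := C) (ha.mul (hexpm k)) fun t => by
      rw [norm_mul, hexpn, mul_one]; exact hC t
  have haq : ∫ t, a t * q t ∂ν = (S : ℂ) := by
    have : ∀ t, a t * q t = ∑ k ∈ s, (starRingEnd ℂ) (c k)
        * (a t * Complex.exp (Complex.I * k * t)) := fun t => by
      simp only [q, Finset.mul_sum]
      exact Finset.sum_congr rfl fun k _ => by ring
    simp_rw [this]
    rw [integral_finsetSum _ fun k _ => (hai k).const_mul _]
    simp_rw [integral_const_mul]
    rw [hS]; push_cast
    refine Finset.sum_congr rfl fun k _ => ?_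
    rw [mul_comm]; exact Complex.mul_conj' (c k)
  have hcross : ∀ k ∈ s, ∫ t, (starRingEnd ℂ) (q t) * Complex.exp (Complex.I * k * t) ∂ν
      = 2 * Real.pi * c k := fun k hk => by
    have e : ∀ t : ℝ, (starRingEnd ℂ) (q t) * Complex.exp (Complex.I * k * t)
        = ∑ l ∈ s, c l * Complex.exp (Complex.I * ((k : ℤ) - (l : ℤ) : ℤ) * t) := fun t => by
      simp only [q, map_sum, map_mul, Complex.conj_conj, Finset.sum_mul]
      refine Finset.sum_congr rfl fun l _ => ?_
      rw [← Complex.exp_conj, mul_assoc, ← Complex.exp_add]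
      congr 2
      simp only [map_mul, Complex.conj_I, Complex.conj_natCast, Complex.conj_ofReal]
      push_cast; ring
    simp_rw [e]
    rw [integral_finsetSum]
    · rw [Finset.sum_eq_single k]
      · simp only [sub_self, Int.cast_zero, mul_zero, zero_mul, Complex.exp_zero, mul_one]
        simp [hν, Real.pi_pos.le, mul_comm]
      · intro l _ hl
        rw [integral_const_mul, integral_exp_int_mul (by omega), mul_zero]
      · exact fun h => absurd hk h
    · intro l _
      refine Integrable.const_mul ?_ _
      refine integrable_of_bound (C := 1) (by fun_prop) fun t => ?_
      have : Complex.I * (((k : ℤ) - (l : ℤ) : ℤ) : ℂ) * t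
          = (((((k : ℤ) - (l : ℤ) : ℤ) : ℝ) * t : ℝ) : ℂ) * Complex.I := by push_cast; ring
      rw [this, Complex.norm_exp_ofReal_mul_I]
  have hqq : ∫ t, (starRingEnd ℂ) (q t) * q t ∂ν = ((2 * Real.pi * S : ℝ) : ℂ) := by
    have : ∀ t, (starRingEnd ℂ) (q t) * q t = ∑ k ∈ s, (starRingEnd ℂ) (c k)
        * ((starRingEnd ℂ) (q t) * Complex.exp (Complex.I * k * t)) := fun t => by
      conv_lhs => rw [show q t = ∑ k ∈ s, (starRingEnd ℂ) (c k)
        * Complex.exp (Complex.I * k * t) from rfl]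
      rw [Finset.mul_sum]
      exact Finset.sum_congr rfl fun k _ => by ring
    simp_rw [this]
    rw [integral_finsetSum]
    · simp_rw [integral_const_mul]
      rw [Finset.sum_congr rfl fun k hk => by rw [hcross k hk], hS]
      push_cast
      rw [Finset.mul_sum]
      refine Finset.sum_congr rfl fun k _ => ?_
      have := Complex.mul_conj' (c k)
      rw [← this]; ring
    · intro k _
      refine Integrable.const_mul (integrable_of_bound (C := ∑ k ∈ s, ‖c k‖)
        (f := fun t => (starRingEnd ℂ) (q t) * Complex.exp (Complex.I * k * t))
        (hcqm.mul (hexpm k)) fun t => ?_) _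
      rw [norm_mul, hexpn, mul_one, RCLike.norm_conj]; exact hqb t
  -- Expanded with ∫ a q = S and ∫ |q|² = 2πS, this reads 4π²∫|a|² - 4πS + 2πS ≥ 0, which is the
  -- claim.
  have hpos : 0 ≤ ∫ t, ‖(2 * Real.pi : ℂ) * a t - (starRingEnd ℂ) (q t)‖ ^ 2 ∂ν :=
    integral_nonneg fun t => sq_nonneg _
  have hexpand : ∀ t, ‖(2 * Real.pi : ℂ) * a t - (starRingEnd ℂ) (q t)‖ ^ 2
      = 4 * Real.pi ^ 2 * ‖a t‖ ^ 2 - 4 * Real.pi * (a t * q t).re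
        + ((starRingEnd ℂ) (q t) * q t).re := fun t => by
    rw [← Complex.normSq_eq_norm_sq, ← Complex.normSq_eq_norm_sq, Complex.normSq_apply,
      Complex.normSq_apply]
    simp
    ring
  have hi1 : Integrable (fun t => ‖a t‖ ^ 2) ν :=
    integrable_of_bound (C := C ^ 2) (ha.norm.pow_const 2) fun t => by
      rw [norm_pow, norm_norm]; exact pow_le_pow_left₀ (norm_nonneg _) (hC t) 2
  have hi2 : Integrable (fun t => a t * q t) ν :=
    integrable_of_bound (C := C * ∑ k ∈ s, ‖c k‖) (ha.mul hqm) fun t => by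
      rw [norm_mul]
      exact mul_le_mul (hC t) (hqb t) (norm_nonneg _) ((norm_nonneg _).trans (hC t))
  have hi3 : Integrable (fun t => (starRingEnd ℂ) (q t) * q t) ν :=
    integrable_of_bound (C := (∑ k ∈ s, ‖c k‖) * ∑ k ∈ s, ‖c k‖)
      (hcqm.mul hqm) fun t => by
      rw [norm_mul, RCLike.norm_conj]
      exact mul_le_mul (hqb t) (hqb t) (norm_nonneg _) ((norm_nonneg _).trans (hqb t))
  simp_rw [hexpand] at hpos
  have hi2' : Integrable (fun t => (a t * q t).re) ν := hi2.re
  have hi3' : Integrable (fun t => ((starRingEnd ℂ) (q t) * q t).re) ν := hi3.re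
  have hi4 : Integrable (fun t => 4 * Real.pi ^ 2 * ‖a t‖ ^ 2 - 4 * Real.pi * (a t * q t).re) ν :=
    integrable_fun_sub (hi1.const_mul _) (hi2.re.const_mul _)
  have r1 : ∫ t, (a t * q t).re ∂ν = S := by
    have := integral_re hi2
    simp only [RCLike.re_to_complex] at this
    rw [this, haq, Complex.ofReal_re]
  have r2 : ∫ t, ((starRingEnd ℂ) (q t) * q t).re ∂ν = 2 * Real.pi * S := by
    have := integral_re hi3
    simp only [RCLike.re_to_complex] at this
    rw [this, hqq, Complex.ofReal_re]
  rw [integral_add hi4 hi3', integral_sub (hi1.const_mul _) (hi2'.const_mul _),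
    integral_const_mul, integral_const_mul, r1, r2] at hpos
  have hpi := Real.pi_pos
  nlinarith

/-- A combination of two exponentials on `{0, …, w - 1}` is controlled by its value at `0` and one
difference. -/
lemma exists_two_exponential_bound {w : ℕ} (hw : 0 < w) (σ : ℝ) :
    ∃ h < w, ∃ c : ℕ → ℂ, (∀ j < w, ‖c j‖ ≤ 1) ∧ ∀ (α β : ℂ) (p : ℕ → ℂ),
      (∀ j < w, p j = α + β * Complex.exp (Complex.I * j * σ)) →
      (∀ j < w, p j = p 0 + (p h - p 0) * c j) ∧
      w * (‖p 0‖ ^ 2 + ‖p h - p 0‖ ^ 2) ≤ 98 * ∑ j ∈ Finset.range w, ‖p j‖ ^ 2 := by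
  let e : ℕ → ℂ := fun j => Complex.exp (Complex.I * j * σ)
  have e0 : e 0 = 1 := by simp [e]
  have eadd : ∀ i j, e (i + j) = e i * e j := fun i j => by
    simp only [e]; rw [← Complex.exp_add]; congr 1; push_cast; ring
  have en : ∀ j, ‖e j‖ = 1 := fun j => by
    have : Complex.I * j * σ = ((j * σ : ℝ) : ℂ) * Complex.I := by push_cast; ring
    simp only [e]; rw [this, Complex.norm_exp_ofReal_mul_I]
  -- The longest chord makes every ratio (e j - 1)/(e h - 1) at most 1 in modulus, uniformly in σ.
  -- This matters because the two exponentials merge as σ tends to 0. If all of them coincide the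
  -- ratio is 0/0 = 0 and the formula still holds.
  obtain ⟨h, hh, hmax⟩ := Finset.exists_max_image (Finset.range w) (fun j => ‖e j - 1‖)
    ⟨0, by simpa using hw⟩
  rw [Finset.mem_range] at hh
  simp only [Finset.mem_range] at hmax
  refine ⟨h, hh, fun j => (e j - 1) / (e h - 1), fun j hj => ?_, fun α β p hp => ?_⟩
  · rw [norm_div]; exact div_le_one_of_le₀ (hmax j hj) (norm_nonneg _)
  have hp' : ∀ j < w, p j = α + β * e j := hp
  have hb : p h - p 0 = β * (e h - 1) := by rw [hp' h hh, hp' 0 hw, e0]; ring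
  have hfirst : ∀ j < w, p j = p 0 + (p h - p 0) * ((e j - 1) / (e h - 1)) := fun j hj => by
    rw [hb]
    by_cases hz : e h - 1 = 0
    · have h1 := hmax j hj
      rw [hz, norm_zero] at h1
      have h2 : e j - 1 = 0 := norm_le_zero_iff.1 h1
      rw [h2, zero_div, mul_zero, add_zero, hp' j hj, hp' 0 hw, e0, sub_eq_zero.1 h2]
    · rw [mul_assoc, mul_div_cancel₀ _ hz, hp' j hj, hp' 0 hw, e0]; ring
  refine ⟨hfirst, ?_⟩
  set Q := ∑ j ∈ Finset.range w, ‖p j‖ ^ 2 with hQ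
  have hQ0 : 0 ≤ Q := Finset.sum_nonneg fun j _ => sq_nonneg _
  -- Cutting h in two, one half keeps at least half of the chord. A gap of at most w/2 leaves at
  -- least w/2 pairs (j, j + h') inside the window, over which the difference is averaged.
  obtain ⟨h', hh', hD⟩ : ∃ h', 2 * h' ≤ w ∧ ‖e h - 1‖ ≤ 2 * ‖e h' - 1‖ := by
    have h1 : e h - 1 = e (h / 2) * (e (h - h / 2) - 1) + (e (h / 2) - 1) := by
      have : h = h / 2 + (h - h / 2) := by omega
      conv_lhs => rw [this, eadd]
      ring
    have h2 : ‖e h - 1‖ ≤ ‖e (h - h / 2) - 1‖ + ‖e (h / 2) - 1‖ := by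
      rw [h1]
      refine (norm_add_le _ _).trans ?_
      rw [norm_mul, en, one_mul]
    rcases le_total ‖e (h - h / 2) - 1‖ ‖e (h / 2) - 1‖ with h3 | h3
    · exact ⟨h / 2, by omega, by linarith⟩
    · exact ⟨h - h / 2, by omega, by linarith⟩
  have hsq : ∀ x y : ℂ, ‖x - y‖ ^ 2 ≤ 2 * ‖x‖ ^ 2 + 2 * ‖y‖ ^ 2 := fun x y => by
    have := norm_sub_le x y
    nlinarith [norm_nonneg (x - y), sq_nonneg (‖x‖ - ‖y‖), norm_nonneg x, norm_nonneg y]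
  have hdiff : ∀ j ∈ Finset.range (w - h'), ‖p h - p 0‖ ^ 2
      ≤ 8 * ‖p (j + h')‖ ^ 2 + 8 * ‖p j‖ ^ 2 := fun j hj => by
    rw [Finset.mem_range] at hj
    have h1 : p (j + h') - p j = β * e j * (e h' - 1) := by
      rw [hp' _ (by omega), hp' _ (by omega), eadd]; ring
    have h2 : ‖p h - p 0‖ ≤ 2 * ‖p (j + h') - p j‖ := by
      rw [hb, h1, norm_mul, norm_mul, norm_mul, en, mul_one]
      nlinarith [norm_nonneg β]
    have h3 : ‖p h - p 0‖ ^ 2 ≤ (2 * ‖p (j + h') - p j‖) ^ 2 :=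
      pow_le_pow_left₀ (norm_nonneg _) h2 2
    have h4 := hsq (p (j + h')) (p j)
    nlinarith
  have hs1 : ∑ j ∈ Finset.range (w - h'), ‖p j‖ ^ 2 ≤ Q :=
    Finset.sum_le_sum_of_subset_of_nonneg (Finset.range_mono (by omega)) fun _ _ _ => sq_nonneg _
  have hs2 : ∑ j ∈ Finset.range (w - h'), ‖p (j + h')‖ ^ 2 ≤ Q := by
    have := Finset.sum_image (s := Finset.range (w - h')) (g := fun j => j + h')
      (f := fun j => ‖p j‖ ^ 2) (fun a _ b _ hab => by simpa using hab)
    rw [← this]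
    refine Finset.sum_le_sum_of_subset_of_nonneg (fun j hj => ?_) fun _ _ _ => sq_nonneg _
    simp only [Finset.mem_image, Finset.mem_range] at hj ⊢
    omega
  have hB : w * ‖p h - p 0‖ ^ 2 ≤ 32 * Q := by
    have h1 := Finset.card_nsmul_le_sum _ _ _ hdiff
    rw [Finset.card_range, nsmul_eq_mul, Finset.sum_add_distrib, ← Finset.mul_sum,
      ← Finset.mul_sum] at h1
    have h2 : (w : ℝ) ≤ 2 * ((w - h' : ℕ) : ℝ) := by
      have : w ≤ 2 * (w - h') := by omega
      exact_mod_cast this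
    nlinarith [sq_nonneg ‖p h - p 0‖]
  have hA : w * ‖p 0‖ ^ 2 ≤ 2 * Q + 2 * (w * ‖p h - p 0‖ ^ 2) := by
    have h1 : ∀ j ∈ Finset.range w, ‖p 0‖ ^ 2 ≤ 2 * ‖p j‖ ^ 2 + 2 * ‖p h - p 0‖ ^ 2 := by
      intro j hj
      rw [Finset.mem_range] at hj
      have h2 : p 0 = p j - (p h - p 0) * ((e j - 1) / (e h - 1)) := by
        conv_rhs => rw [hfirst j hj]
        ring
      have h3 : ‖(e j - 1) / (e h - 1)‖ ≤ 1 := by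
        rw [norm_div]; exact div_le_one_of_le₀ (hmax j hj) (norm_nonneg _)
      have h4 := hsq (p j) ((p h - p 0) * ((e j - 1) / (e h - 1)))
      rw [← h2, norm_mul, mul_pow] at h4
      have h5 : ‖(e j - 1) / (e h - 1)‖ ^ 2 ≤ 1 := pow_le_one₀ (norm_nonneg _) h3
      nlinarith [sq_nonneg ‖p h - p 0‖]
    have h2 := Finset.card_nsmul_le_sum _ _ _ h1
    rw [Finset.card_range, nsmul_eq_mul, Finset.sum_add_distrib, ← Finset.mul_sum] at h2
    simp only [Finset.sum_const, Finset.card_range, nsmul_eq_mul] at h2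
    linarith
  linarith

/-- The exponential `e^{ikt}`. -/
def wave (k : ℕ) (t : ℝ) : ℂ := Complex.exp (Complex.I * k * t)

lemma norm_wave (k : ℕ) (t : ℝ) : ‖wave k t‖ = 1 := by
  have : Complex.I * k * t = ((k * t : ℝ) : ℂ) * Complex.I := by push_cast; ring
  rw [wave, this, Complex.norm_exp_ofReal_mul_I]

lemma wave_ne_zero (k : ℕ) (t : ℝ) : wave k t ≠ 0 := Complex.exp_ne_zero _

lemma wave_add (k : ℕ) (t u : ℝ) : wave k (t + u) = wave k t * wave k u := by
  simp only [wave]; rw [← Complex.exp_add]; congr 1; push_cast; ring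

@[fun_prop]
lemma measurable_wave (k : ℕ) : Measurable (wave k) := by unfold wave; fun_prop

/-- The complex form of a vector with real coordinates. -/
def coordC {s : Finset ℕ} (v : RealCoord s) (k : s) : ℂ := ⟨v (k, 0), -v (k, 1)⟩

lemma coordC_add {s : Finset ℕ} (v w : RealCoord s) (k : s) :
    coordC (v + w) k = coordC v k + coordC w k := by
  apply Complex.ext <;> simp [coordC]; ring

lemma coordC_smul {s : Finset ℕ} (c : ℝ) (v : RealCoord s) (k : s) :
    coordC (c • v) k = c * coordC v k := by
  apply Complex.ext <;> simp [coordC]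

lemma norm_sq_eq_sum_coordC {s : Finset ℕ} (v : RealCoord s) :
    ‖v‖ ^ 2 = ∑ k : s, ‖coordC v k‖ ^ 2 := by
  rw [EuclideanSpace.norm_sq_eq, Fintype.sum_prod_type]
  refine Finset.sum_congr rfl fun k _ => ?_
  rw [Fin.sum_univ_two, ← Complex.normSq_eq_norm_sq, Complex.normSq_apply]
  simp [coordC, sq]

lemma inner_eq_sum_coordC {s : Finset ℕ} (v u : RealCoord s) :
    ⟪v, u⟫ = √2 * ∑ k : s, (coordC v k * toC u k).re := by
  rw [PiLp.inner_apply, Fintype.sum_prod_type, Finset.mul_sum]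
  refine Finset.sum_congr rfl fun k _ => ?_
  rw [Fin.sum_univ_two]
  have : √2 ≠ 0 := by positivity
  simp only [coordC, toC, Complex.mul_re, inner]
  simp
  field_simp

lemma measurable_coordC {s : Finset ℕ} (k : s) : Measurable fun v : RealCoord s => coordC v k :=
  measurable_complex_mk.comp
    (by fun_prop : Measurable fun v : RealCoord s => (v (k, 0), -v (k, 1)))

lemma norm_coordC_le {s : Finset ℕ} (v : RealCoord s) (k : s) : ‖coordC v k‖ ≤ ‖v‖ := by
  refine le_of_sq_le_sq ?_ (norm_nonneg _)
  rw [norm_sq_eq_sum_coordC]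
  exact Finset.single_le_sum (f := fun k => ‖coordC v k‖ ^ 2) (fun _ _ => sq_nonneg _)
    (Finset.mem_univ k)

lemma coordC_integral {T : Type*} [MeasurableSpace T] {ν : Measure T} {s : Finset ℕ}
    {v : T → RealCoord s} (hv : Integrable v ν) (k : s) :
    coordC (∫ t, v t ∂ν) k = ∫ t, coordC (v t) k ∂ν := by
  let Λ : RealCoord s →L[ℝ] ℂ := LinearMap.toContinuousLinearMap
    { toFun := fun v => coordC v k
      map_add' := fun v w => coordC_add v w k
      map_smul' := fun c v => by rw [coordC_smul]; simp }
  exact (Λ.integral_comp_comm hv).symm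

/-- The vector whose complex form is `c / √2`. -/
def ofC {s : Finset ℕ} (c : s → ℂ) : RealCoord s :=
  WithLp.toLp 2 fun p => if p.2 = 0 then (c p.1).re else -(c p.1).im

lemma coordC_ofC {s : Finset ℕ} (c : s → ℂ) (k : s) : coordC (ofC c) k = c k := by
  apply Complex.ext <;> simp [coordC, ofC]

/-- The span of the gradients of the block sums at `t` and at `t + σ`. -/
def waveSpace (s : Finset ℕ) (σ t : ℝ) : Submodule ℝ (RealCoord s) where
  carrier := {v | ∃ α β : ℂ, ∀ k : s,
    coordC v k = (α * wave k t + β * wave k (t + σ)) / (√(2 * k) : ℝ)}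
  add_mem' := by
    rintro v w ⟨α, β, h⟩ ⟨α', β', h'⟩
    refine ⟨α + α', β + β', fun k => ?_⟩
    rw [coordC_add, h, h']; ring
  zero_mem' := ⟨0, 0, fun k => by simp [coordC]; rfl⟩
  smul_mem' := by
    rintro c v ⟨α, β, h⟩
    refine ⟨c * α, c * β, fun k => ?_⟩
    rw [coordC_smul, h]; ring

/-- The block sum `∑ x_k e^{ikt} / √k`. -/
def waveSum (s : Finset ℕ) (t : ℝ) (z : s → ℂ) : ℂ := ∑ k : s, z k / (√(k : ℕ) : ℝ) * wave k t

lemma waveSum_toC_add {s : Finset ℕ} (t : ℝ) (u v : RealCoord s) :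
    waveSum s t (toC (u + v)) = waveSum s t (toC u) + waveSum s t (toC v) := by
  rw [waveSum, waveSum, waveSum, ← Finset.sum_add_distrib]
  refine Finset.sum_congr rfl fun k _ => ?_
  have : toC (u + v) k = toC u k + toC v k := by
    apply Complex.ext <;> simp [toC] <;> ring
  rw [this]; ring

/-- The pairing with the wave of amplitude α is Re(α · waveSum), so α = 1 and α = -i recover the
real and the imaginary part. -/
lemma waveSum_eq_zero_of_forall {s : Finset ℕ} {t : ℝ} {h : RealCoord s}
    (H : ∀ α : ℂ, ⟪ofC (fun k : s => α * wave k t / (√(2 * k) : ℝ)), h⟫ = 0) :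
    waveSum s t (toC h) = 0 := by
  have key : ∀ α : ℂ, (α * waveSum s t (toC h)).re = 0 := fun α => by
    have h1 := H α
    rw [inner_eq_sum_coordC] at h1
    have e : √2 * ∑ k : s, (coordC (ofC (fun k : s => α * wave k t / (√(2 * k) : ℝ))) k
        * toC h k).re = (α * waveSum s t (toC h)).re := by
      rw [waveSum, Finset.mul_sum, Finset.mul_sum, Complex.re_sum]
      refine Finset.sum_congr rfl fun k _ => ?_
      rw [coordC_ofC, ← Complex.re_ofReal_mul, Real.sqrt_mul (by norm_num)]
      congr 1
      have h2 : ((√2 : ℝ) : ℂ) ≠ 0 := by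
        exact_mod_cast (by positivity : √(2 : ℝ) ≠ 0)
      push_cast
      by_cases h3 : ((√(k : ℝ) : ℝ) : ℂ) = 0
      · rw [h3]; simp
      · field_simp
    rw [← e, h1]
  apply Complex.ext
  · simpa using key 1
  · have := key (-Complex.I)
    simpa using this

lemma waveSum_eq_zero {s : Finset ℕ} {σ t : ℝ} {h : RealCoord s} (hh : h ∈ (waveSpace s σ t)ᗮ) :
    waveSum s t (toC h) = 0 ∧ waveSum s (t + σ) (toC h) = 0 := by
  constructor
  · refine waveSum_eq_zero_of_forall fun α => hh _ ⟨α, 0, fun k => ?_⟩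
    rw [coordC_ofC]; ring
  · refine waveSum_eq_zero_of_forall fun α => hh _ ⟨0, α, fun k => ?_⟩
    rw [coordC_ofC]; ring

lemma norm_add_mul_sq_le {x y c : ℂ} (hc : ‖c‖ ≤ 1) :
    ‖x + c * y‖ ^ 2 ≤ 2 * (‖x‖ ^ 2 + ‖y‖ ^ 2) := by
  have h1 := norm_add_le x (c * y)
  rw [norm_mul] at h1
  have h2 : ‖c‖ * ‖y‖ ≤ ‖y‖ := mul_le_of_le_one_left (norm_nonneg _) hc
  have h3 : ‖x + c * y‖ ≤ ‖x‖ + ‖y‖ := h1.trans (by linarith)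
  have h4 := pow_le_pow_left₀ (norm_nonneg _) h3 2
  nlinarith [sq_nonneg (‖x‖ - ‖y‖)]

/-- After removing √(2k) and the phase e^{ikt}, the coordinates of v t are α + β e^{ijσ}, hence
fixed combinations, with coefficients at most 1, of two functions a(t) and b(t). The coordinates of
∫ v are then Fourier coefficients of a and b, and Bessel's inequality applies to each. The gain of
1/(n₂ - n₁) is that |a|² + |b|² is controlled by the average, not the sum, of the squared normalised
coordinates. -/
lemma isBessel_waveSpace {n₁ n₂ : ℕ} (hn : n₁ < n₂) (σ : ℝ) {A B : ℝ} (hA : 0 < A)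
    (hAk : ∀ k ∈ Finset.Ioc n₁ n₂, A ≤ k) (hBk : ∀ k ∈ Finset.Ioc n₁ n₂, (k : ℝ) ≤ B) :
    IsBessel (volume.restrict (Set.Ioc 0 (2 * Real.pi))) (waveSpace (Finset.Ioc n₁ n₂) σ)
      (392 * Real.pi * B / (A * (n₂ - n₁ : ℕ))) := by
  obtain ⟨s, hs⟩ : ∃ s, s = Finset.Ioc n₁ n₂ := ⟨_, rfl⟩
  rw [← hs] at hAk hBk ⊢
  have hsub : ∀ {k}, k ∈ s → k ∈ Finset.Ioc n₁ n₂ := fun h => hs ▸ h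
  intro v hv ⟨C, hC⟩ hvU
  set ν := volume.restrict (Set.Ioc 0 (2 * Real.pi)) with hν
  have : IsFiniteMeasure ν := by rw [hν]; infer_instance
  set w := n₂ - n₁ with hw
  have hw0 : 0 < w := by omega
  have hpi := Real.pi_pos
  choose α β hαβ using hvU
  obtain ⟨h, hh, c, hc, hmain⟩ := exists_two_exponential_bound hw0 σ
  have hmem : ∀ j < w, n₁ + 1 + j ∈ s := fun j hj => by simp [hs]; omega
  have hB : 0 < B := hA.trans_le ((hAk _ (hmem 0 hw0)).trans (hBk _ (hmem 0 hw0)))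
  let K : ℕ → s := fun j => if hj : j < w then ⟨n₁ + 1 + j, hmem j hj⟩ else ⟨n₁ + 1 + 0, hmem 0 hw0⟩
  have hK : ∀ j < w, ((K j : s) : ℕ) = n₁ + 1 + j := fun j hj => by simp [K, hj]
  let p : ℝ → ℕ → ℂ := fun t j =>
    coordC (v t) (K j) * (√(2 * (K j : ℕ)) : ℝ) * (wave (K j) t)⁻¹
  have hKpos : ∀ k : s, 0 < ((k : ℕ) : ℝ) := fun k => hA.trans_le (hAk _ k.2)
  have hsq0 : ∀ k : s, ((√(2 * (k : ℕ)) : ℝ) : ℂ) ≠ 0 := fun k => by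
    have := hKpos k
    exact_mod_cast (by positivity : √(2 * ((k : ℕ) : ℝ)) ≠ 0)
  have hpform : ∀ t, ∀ j < w, p t j
      = α t + (β t * wave (n₁ + 1) σ) * Complex.exp (Complex.I * j * σ) := fun t j hj => by
    simp only [p]
    rw [hαβ, div_mul_cancel₀ _ (hsq0 _), wave_add]
    have h1 : wave (K j) σ = wave (n₁ + 1) σ * Complex.exp (Complex.I * j * σ) := by
      simp only [wave]; rw [hK j hj, ← Complex.exp_add]; congr 1; push_cast; ring
    rw [h1]
    have := wave_ne_zero (K j) t
    field_simp
  have hpm : ∀ j, Measurable fun t => p t j := fun j =>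
    (((measurable_coordC (K j)).comp hv).mul_const _).mul (measurable_wave (K j)).inv
  have hpn : ∀ t j, ‖p t j‖ ^ 2 = 2 * (K j : ℕ) * ‖coordC (v t) (K j)‖ ^ 2 := fun t j => by
    simp only [p]
    rw [norm_mul, norm_mul, norm_inv, norm_wave, inv_one, mul_one, mul_pow, Complex.norm_real,
      Real.norm_eq_abs, sq_abs, Real.sq_sqrt (by positivity)]
    ring
  have hpb : ∀ t j, ‖p t j‖ ≤ √(2 * B) * C := fun t j => by
    have hC0 : 0 ≤ C := (norm_nonneg _).trans (hC t)
    refine le_of_sq_le_sq ?_ (by positivity)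
    rw [hpn, mul_pow, Real.sq_sqrt (by positivity)]
    have h1 := hBk _ (K j).2
    have h2 : ‖coordC (v t) (K j)‖ ^ 2 ≤ C ^ 2 :=
      pow_le_pow_left₀ (norm_nonneg _) ((norm_coordC_le _ _).trans (hC t)) 2
    gcongr
  let a : ℝ → ℂ := fun t => p t 0
  let b : ℝ → ℂ := fun t => p t h - p t 0
  have ham : Measurable a := hpm 0
  have hbm : Measurable b := (hpm h).sub (hpm 0)
  have hab : ∀ t, ‖a t‖ ≤ √(2 * B) * C := fun t => hpb t 0
  have hbb : ∀ t, ‖b t‖ ≤ 2 * (√(2 * B) * C) := fun t => by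
    have := norm_sub_le (p t h) (p t 0)
    simp only [b]
    linarith [hpb t h, hpb t 0]
  let fa : ℕ → ℂ := fun k => ∫ t, a t * Complex.exp (Complex.I * k * t) ∂ν
  let fb : ℕ → ℂ := fun k => ∫ t, b t * Complex.exp (Complex.I * k * t) ∂ν
  have hvi : Integrable v ν := integrable_of_bound hv hC
  have hcoord : ∀ k : s, ‖coordC (∫ t, v t ∂ν) k‖ ^ 2 ≤ A⁻¹ * (‖fa k‖ ^ 2 + ‖fb k‖ ^ 2) := by
    intro k
    have hk : n₁ < (k : ℕ) ∧ (k : ℕ) ≤ n₂ := by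
      exact Finset.mem_Ioc.1 (hsub k.2)
    obtain ⟨j, hj, hkj⟩ : ∃ j, j < w ∧ (k : ℕ) = n₁ + 1 + j := ⟨k - (n₁ + 1), by omega, by omega⟩
    have hKk : K j = k := Subtype.ext (by rw [hK j hj, hkj])
    have h1 : ∀ t, coordC (v t) k = ((√(2 * (k : ℕ)) : ℝ) : ℂ)⁻¹
        * (a t * Complex.exp (Complex.I * (k : ℕ) * t)
          + c j * (b t * Complex.exp (Complex.I * (k : ℕ) * t))) := fun t => by
      have h2 := (hmain _ _ _ (hpform t)).1 j hj
      have h3 : coordC (v t) k = ((√(2 * (k : ℕ)) : ℝ) : ℂ)⁻¹ * (p t j * wave k t) := by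
        simp only [p]
        rw [hKk]
        have := wave_ne_zero k t
        have := hsq0 k
        field_simp
      rw [h3, h2]
      simp only [a, b, wave]
      ring
    have hia : Integrable (fun t => a t * Complex.exp (Complex.I * (k : ℕ) * t)) ν :=
      integrable_of_bound (C := √(2 * B) * C) (ham.mul (measurable_wave k)) fun t => by
        have := norm_wave k t
        rw [wave] at this
        rw [norm_mul, this, mul_one]; exact hab t
    have hib : Integrable (fun t => b t * Complex.exp (Complex.I * (k : ℕ) * t)) ν :=
      integrable_of_bound (C := 2 * (√(2 * B) * C)) (hbm.mul (measurable_wave k)) fun t => by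
        have := norm_wave k t
        rw [wave] at this
        rw [norm_mul, this, mul_one]; exact hbb t
    have h4 : coordC (∫ t, v t ∂ν) k = ((√(2 * (k : ℕ)) : ℝ) : ℂ)⁻¹ * (fa k + c j * fb k) := by
      rw [coordC_integral hvi]
      simp_rw [h1]
      rw [integral_const_mul, integral_add hia (hib.const_mul _), integral_const_mul]
    rw [h4, norm_mul, mul_pow, norm_inv, Complex.norm_real, Real.norm_eq_abs, inv_pow, sq_abs,
      Real.sq_sqrt (by positivity)]
    have h5 := norm_add_mul_sq_le (x := fa k) (y := fb k) (hc j hj)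
    have h6 : (2 * ((k : ℕ) : ℝ))⁻¹ * 2 ≤ A⁻¹ := by
      have := hKpos k
      rw [mul_inv, mul_comm, ← mul_assoc, mul_inv_cancel₀ (by norm_num), one_mul]
      exact inv_anti₀ hA (hAk _ k.2)
    calc (2 * ((k : ℕ) : ℝ))⁻¹ * ‖fa k + c j * fb k‖ ^ 2
        ≤ (2 * ((k : ℕ) : ℝ))⁻¹ * (2 * (‖fa k‖ ^ 2 + ‖fb k‖ ^ 2)) := by gcongr
      _ = (2 * ((k : ℕ) : ℝ))⁻¹ * 2 * (‖fa k‖ ^ 2 + ‖fb k‖ ^ 2) := by ring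
      _ ≤ _ := by gcongr
  have hpt : ∀ t, w * (‖a t‖ ^ 2 + ‖b t‖ ^ 2) ≤ 196 * B * ‖v t‖ ^ 2 := fun t => by
    refine ((hmain _ _ _ (hpform t)).2).trans ?_
    have h1 : ∑ j ∈ Finset.range w, ‖p t j‖ ^ 2
        ≤ ∑ j ∈ Finset.range w, 2 * B * ‖coordC (v t) (K j)‖ ^ 2 :=
      Finset.sum_le_sum fun j _ => by
        rw [hpn]; have := hBk _ (K j).2; gcongr
    have h2 : ∑ j ∈ Finset.range w, ‖coordC (v t) (K j)‖ ^ 2 ≤ ‖v t‖ ^ 2 := by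
      rw [norm_sq_eq_sum_coordC]
      have hinj : Set.InjOn K (Finset.range w) := fun i hi j hj hij => by
        have hi' : i < w := by simpa using hi
        have hj' : j < w := by simpa using hj
        have := congrArg (fun k : s => (k : ℕ)) hij
        simp only [hK i hi', hK j hj'] at this
        omega
      rw [← Finset.sum_image (f := fun k => ‖coordC (v t) k‖ ^ 2) hinj]
      exact Finset.sum_le_sum_of_subset_of_nonneg (Finset.subset_univ _) fun _ _ _ => sq_nonneg _
    rw [← Finset.mul_sum] at h1
    nlinarith
  have hia2 : Integrable (fun t => ‖a t‖ ^ 2) ν :=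
    integrable_of_bound (C := (√(2 * B) * C) ^ 2) (ham.norm.pow_const 2) fun t => by
      rw [norm_pow, norm_norm]; exact pow_le_pow_left₀ (norm_nonneg _) (hab t) 2
  have hib2 : Integrable (fun t => ‖b t‖ ^ 2) ν :=
    integrable_of_bound (C := (2 * (√(2 * B) * C)) ^ 2) (hbm.norm.pow_const 2) fun t => by
      rw [norm_pow, norm_norm]; exact pow_le_pow_left₀ (norm_nonneg _) (hbb t) 2
  have hiv2 : Integrable (fun t => ‖v t‖ ^ 2) ν :=
    integrable_of_bound (C := C ^ 2) (hv.norm.pow_const 2) fun t => by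
      rw [norm_pow, norm_norm]; exact pow_le_pow_left₀ (norm_nonneg _) (hC t) 2
  have hsum : ‖∫ t, v t ∂ν‖ ^ 2 ≤ A⁻¹ * (2 * Real.pi * ∫ t, (‖a t‖ ^ 2 + ‖b t‖ ^ 2) ∂ν) := by
    rw [norm_sq_eq_sum_coordC, integral_add hia2 hib2]
    refine (Finset.sum_le_sum fun k _ => hcoord k).trans ?_
    rw [← Finset.mul_sum, Finset.sum_add_distrib, mul_add]
    have h1 := sum_norm_fourier_sq_le s ham hab
    have h2 := sum_norm_fourier_sq_le s hbm hbb
    rw [← Finset.sum_coe_sort] at h1 h2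
    have h3 := mul_le_mul_of_nonneg_left (add_le_add h1 h2) (inv_nonneg.2 hA.le)
    rw [mul_add, ← mul_add (2 * Real.pi)] at h3
    exact h3
  have hint : w * ∫ t, (‖a t‖ ^ 2 + ‖b t‖ ^ 2) ∂ν ≤ 196 * B * ∫ t, ‖v t‖ ^ 2 ∂ν := by
    rw [← integral_const_mul, ← integral_const_mul]
    exact integral_mono ((hia2.add hib2).const_mul _) (hiv2.const_mul _) hpt
  have hw0' : (0 : ℝ) < w := by exact_mod_cast hw0
  refine hsum.trans ?_
  have h1 : ∫ t, (‖a t‖ ^ 2 + ‖b t‖ ^ 2) ∂ν ≤ 196 * B * (∫ t, ‖v t‖ ^ 2 ∂ν) / w := by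
    rw [le_div_iff₀ hw0']; linarith
  calc A⁻¹ * (2 * Real.pi * ∫ t, (‖a t‖ ^ 2 + ‖b t‖ ^ 2) ∂ν)
      ≤ A⁻¹ * (2 * Real.pi * (196 * B * (∫ t, ‖v t‖ ^ 2 ∂ν) / w)) := by gcongr
    _ = _ := by field_simp; ring

/-! ### Exponential blocks of frequencies, their sizes and variances. -/

open ModelChaos

/-- The largest index of the first `m` blocks. -/
def top (m : ℕ) : ℕ := if m = 0 then 0 else ⌊Real.exp m⌋₊

lemma block_eq (m : ℕ) : block (m + 1) = Finset.Ioc (top m) (top (m + 1)) := by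
  ext k
  simp only [block, top, Finset.mem_filter, Finset.mem_Icc, Finset.mem_Ioc, Nat.succ_ne_zero,
    if_false]
  rcases Nat.eq_zero_or_pos m with rfl | hm
  · simp only [if_true]
    have h1 : k = 1 ∨ 1 < k ↔ 0 < k := by omega
    constructor
    · rintro ⟨⟨h, h'⟩, _⟩; exact ⟨h, h'⟩
    · rintro ⟨h, h'⟩
      refine ⟨⟨h, h'⟩, ?_⟩
      rcases h1.2 h with h2 | h2
      · right; simp [h2]
      · left
        have : (1 : ℝ) < k := by exact_mod_cast h2
        simpa using this
  · rw [if_neg hm.ne', Nat.floor_lt (Real.exp_pos _).le]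
    have e : ((m + 1 : ℕ) : ℝ) - 1 = m := by push_cast; ring
    rw [e]
    have : 0 < Real.exp m := Real.exp_pos _
    constructor
    · rintro ⟨⟨h, h'⟩, h2 | h2⟩
      · exact ⟨h2, h'⟩
      · omega
    · rintro ⟨h, h'⟩
      refine ⟨⟨?_, h'⟩, Or.inl h⟩
      have : (0 : ℝ) < k := this.trans h
      exact_mod_cast this

lemma top_mono : Monotone top := by
  refine monotone_nat_of_le_succ fun m => ?_
  simp only [top, Nat.succ_ne_zero, if_false]
  split_ifs
  · exact Nat.zero_le _
  · exact Nat.floor_le_floor (Real.exp_le_exp.2 (by push_cast; linarith))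

lemma le_exp_of_mem_block {m k : ℕ} (hk : k ∈ block m) : (k : ℝ) ≤ Real.exp m :=
  (Nat.le_floor_iff (Real.exp_pos _).le).1 (Finset.mem_Icc.1 (Finset.mem_filter.1 hk).1).2

lemma exp_sub_one_le_of_mem_block {m k : ℕ} (hk : k ∈ block m) :
    Real.exp ((m : ℝ) - 1) ≤ k := by
  rcases (Finset.mem_filter.1 hk).2 with h | ⟨h, h'⟩
  · exact h.le
  · rw [h, h']; simp

lemma exp_div_five_le_card (m : ℕ) :
    Real.exp ((m + 1 : ℕ) : ℝ) / 5 ≤ ((top (m + 1) - top m : ℕ) : ℝ) := by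
  rw [Nat.cast_sub (top_mono (Nat.le_succ m))]
  have h1 : (top (m + 1) : ℝ) > Real.exp ((m + 1 : ℕ) : ℝ) - 1 := by
    simp only [top, Nat.succ_ne_zero, if_false]
    exact Nat.sub_one_lt_floor _
  have he := Real.exp_one_gt_d9
  have he' := Real.exp_one_lt_d9
  rcases Nat.eq_zero_or_pos m with rfl | hm
  · have h2 : top 0 = 0 := rfl
    rw [h2]
    norm_num at h1 ⊢
    linarith
  · have h2 : (top m : ℝ) ≤ Real.exp m := by
      simp only [top, hm.ne', if_false]
      exact Nat.floor_le (Real.exp_pos _).le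
    have h3 : Real.exp ((m + 1 : ℕ) : ℝ) = Real.exp m * Real.exp 1 := by
      rw [← Real.exp_add]; push_cast; rfl
    have h4 : Real.exp 1 ≤ Real.exp m := Real.exp_le_exp.2 (by exact_mod_cast hm)
    rw [h3] at h1 ⊢
    nlinarith

/-- Bessel constant of the block `m`. -/
def kap (m : ℕ) : ℝ := 20000 * Real.exp (-m)

lemma kap_pos (m : ℕ) : 0 < kap m := by unfold kap; positivity

lemma IsBessel.mono {T E : Type*} [MeasurableSpace T] [NormedAddCommGroup E]
    [InnerProductSpace ℝ E] [FiniteDimensional ℝ E] [MeasurableSpace E] [BorelSpace E]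
    {ν : Measure T} {U : T → Submodule ℝ E} {κ κ' : ℝ} (h : IsBessel ν U κ) (hκ : κ ≤ κ') :
    IsBessel ν U κ' := fun v h1 h2 h3 =>
  (h v h1 h2 h3).trans (mul_le_mul_of_nonneg_right hκ (integral_nonneg fun _ => sq_nonneg _))

/-- With M = m + 1, the frequencies lie between e^{M-1} and e^M and there are at least e^M/5 of
them. The constant is therefore at most 392π · 5e · e^{-M}, and 392π · 5e < 20000. -/
lemma isBessel_block (m : ℕ) (σ : ℝ) :
    IsBessel (volume.restrict (Set.Ioc 0 (2 * Real.pi))) (waveSpace (block (m + 1)) σ)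
      (kap (m + 1)) := by
  have hA : ∀ k ∈ block (m + 1), Real.exp (((m + 1 : ℕ) : ℝ) - 1) ≤ k :=
    fun k => exp_sub_one_le_of_mem_block
  have hB : ∀ k ∈ block (m + 1), (k : ℝ) ≤ Real.exp ((m + 1 : ℕ) : ℝ) :=
    fun k => le_exp_of_mem_block
  have hcard := exp_div_five_le_card m
  have hpos : (0 : ℝ) < ((top (m + 1) - top m : ℕ) : ℝ) := by
    refine lt_of_lt_of_le ?_ hcard
    positivity
  have hlt : top m < top (m + 1) := by
    have : 0 < top (m + 1) - top m := by exact_mod_cast hpos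
    omega
  rw [block_eq] at hA hB ⊢
  refine (isBessel_waveSpace hlt σ (Real.exp_pos _) hA hB).mono ?_
  rw [div_le_iff₀ (by positivity), kap]
  set M := ((m + 1 : ℕ) : ℝ)
  have e1 : Real.exp (-M) * Real.exp (M - 1) = Real.exp (-1) := by
    rw [← Real.exp_add]; congr 1; ring
  have e2 : Real.exp (-1) * Real.exp 1 = 1 := by rw [← Real.exp_add]; simp
  have he' := Real.exp_one_lt_d9
  have he := Real.exp_pos 1
  have h5 : (1 / 2.7182818286 : ℝ) ≤ Real.exp (-1) := by
    rw [div_le_iff₀ (by norm_num)]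
    nlinarith [Real.exp_pos (-1)]
  have hpi := Real.pi_lt_d2
  calc 392 * Real.pi * Real.exp M ≤ 20000 * (1 / 2.7182818286) * (Real.exp M / 5) := by
        nlinarith [Real.exp_pos M]
    _ ≤ 20000 * Real.exp (-1) * ((top (m + 1) - top m : ℕ) : ℝ) := by gcongr
    _ = _ := by rw [← e1]; ring

lemma disjoint_block {m n : ℕ} (h : m < n) : Disjoint (block (m + 1)) (block (n + 1)) := by
  rw [block_eq, block_eq, Finset.disjoint_left]
  intro k hk hk'
  have := top_mono (show m + 1 ≤ n by omega)
  simp only [Finset.mem_Ioc] at hk hk'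
  omega

lemma sum_Icc_block {M : Type*} [AddCommMonoid M] (f : ℕ → M) (m : ℕ) :
    ∑ j ∈ Finset.Icc 1 m, ∑ k ∈ block j, f k = ∑ k ∈ Finset.Ioc 0 (top m), f k := by
  induction m with
  | zero => simp [top]
  | succ m ih =>
    rw [Finset.sum_Icc_succ_top (by omega), ih, block_eq]
    exact Finset.sum_Ioc_consecutive f (Nat.zero_le _) (top_mono (Nat.le_succ m))

/-- Twice the variance of the first `m` block sums. -/
def V (m : ℕ) : ℝ := ∑ j ∈ Finset.Icc 1 m, 2 * sigmaSq j

lemma V_zero : V 0 = 0 := by simp [V]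

lemma V_succ (m : ℕ) : V (m + 1) = V m + 2 * sigmaSq (m + 1) := by
  rw [V, Finset.sum_Icc_succ_top (by omega)]; rfl

lemma two_mul_sigmaSq (m : ℕ) : 2 * sigmaSq m = ∑ k ∈ block m, 1 / (k : ℝ) := by
  rw [sigmaSq, Finset.mul_sum]
  refine Finset.sum_congr rfl fun k _ => ?_
  rw [mul_one_div, mul_comm, ← div_div, div_right_comm]
  by_cases h : (k : ℝ) = 0
  · simp [h]
  · field_simp

lemma V_nonneg (m : ℕ) : 0 ≤ V m := by
  refine Finset.sum_nonneg fun j _ => ?_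
  rw [two_mul_sigmaSq]
  positivity

/-- `V m` is the harmonic number of `top m`. Hence e^{V m} is at most e · e^m, which is what `kap m`
compensates. -/
lemma V_le (m : ℕ) : V m ≤ m + 1 := by
  have h : V m = ∑ k ∈ Finset.Ioc 0 (top m), 1 / (k : ℝ) := by
    rw [V, ← sum_Icc_block]
    exact Finset.sum_congr rfl fun j _ => two_mul_sigmaSq j
  rcases Nat.eq_zero_or_pos m with rfl | hm
  · rw [V_zero]; norm_num
  have h2 := harmonic_le_one_add_log (top m)
  have h3 : ((harmonic (top m) : ℚ) : ℝ) = V m := by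
    rw [h, harmonic_eq_sum_Icc]
    push_cast
    exact Finset.sum_congr rfl fun k _ => by rw [one_div]
  rw [h3] at h2
  have h4 : Real.log (top m) ≤ m := by
    have h5 : (top m : ℝ) ≤ Real.exp m := by
      simp only [top, hm.ne', if_false]
      exact Nat.floor_le (Real.exp_pos _).le
    rcases Nat.eq_zero_or_pos (top m) with h6 | h6
    · rw [h6]; simp
    · have := Real.log_le_log (by exact_mod_cast h6) h5
      rwa [Real.log_exp] at this
  linarith

/-! ### Block sums and averaging over one block. -/

/-- The `m`-th block of the random Fourier series. -/
def P (m : ℕ) (t : ℝ) (x : ℕ → ℂ) : ℂ := ∑ k ∈ block m, x k / (√k : ℝ) * wave k t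

lemma P_congr {m : ℕ} (t : ℝ) {x y : ℕ → ℂ} (h : ∀ k ∈ block m, x k = y k) : P m t x = P m t y :=
  Finset.sum_congr rfl fun k hk => by rw [h k hk]

lemma P_updateFinset_self (m : ℕ) (t : ℝ) (x : ℕ → ℂ) (z : block m → ℂ) :
    P m t (Function.updateFinset x (block m) z) = waveSum (block m) t z := by
  rw [P, waveSum, ← Finset.sum_coe_sort]
  refine Finset.sum_congr rfl fun k _ => ?_
  simp [Function.updateFinset]

lemma P_updateFinset_of_lt {j m : ℕ} (hj : 1 ≤ j) (h : j < m) (t : ℝ) (x : ℕ → ℂ)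
    (z : block m → ℂ) : P j t (Function.updateFinset x (block m) z) = P j t x := by
  obtain ⟨j, rfl⟩ := Nat.exists_eq_add_of_le' hj
  obtain ⟨m, rfl⟩ := Nat.exists_eq_add_of_le' (show 1 ≤ m by omega)
  refine P_congr t fun k hk => ?_
  have := Finset.disjoint_left.1 (disjoint_block (show j < m by omega)) hk
  simp [Function.updateFinset, this]

@[fun_prop]
lemma measurable_P (m : ℕ) : Measurable fun p : ℝ × (ℕ → ℂ) => P m p.1 p.2 := by
  unfold P wave; fun_prop

/-- Averaging over the coordinates of the block `m`. -/
def avg {G : Type*} [NormedAddCommGroup G] [NormedSpace ℝ G] (m : ℕ) (f : (ℕ → ℂ) → G)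
    (x : ℕ → ℂ) : G :=
  ∫ u, f (Function.updateFinset x (block m) (toC u)) ∂(stdGaussian (RealCoord (block m)))

lemma measurable_update (m : ℕ) : Measurable fun p : (ℕ → ℂ) × RealCoord (block m) =>
    Function.updateFinset p.1 (block m) (toC p.2) := by
  refine measurable_pi_iff.2 fun k => ?_
  simp only [Function.updateFinset]
  split_ifs with h
  · exact (measurable_pi_apply (⟨k, h⟩ : block m)).comp (measurable_toC.comp measurable_snd)
  · exact (measurable_pi_apply k).comp measurable_fst

lemma measurable_avg {T G : Type*} [MeasurableSpace T] [NormedAddCommGroup G] [NormedSpace ℝ G]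
    [MeasurableSpace G] [BorelSpace G] [SecondCountableTopology G] (m : ℕ) {f : T → (ℕ → ℂ) → G}
    (hf : Measurable fun p : T × (ℕ → ℂ) => f p.1 p.2) :
    Measurable fun p : T × (ℕ → ℂ) => avg m (f p.1) p.2 := by
  have h : Measurable fun q : (T × (ℕ → ℂ)) × RealCoord (block m) =>
      f q.1.1 (Function.updateFinset q.1.2 (block m) (toC q.2)) :=
    hf.comp ((measurable_fst.comp measurable_fst).prodMk
      ((measurable_update m).comp ((measurable_snd.comp measurable_fst).prodMk measurable_snd)))
  exact (h.stronglyMeasurable.integral_prod_right').measurable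

lemma integral_exp_inner {E : Type*} [NormedAddCommGroup E] [InnerProductSpace ℝ E]
    [FiniteDimensional ℝ E] [MeasurableSpace E] [BorelSpace E] (h : E) :
    ∫ η, Real.exp ⟪h, η⟫ ∂(stdGaussian E) = Real.exp (‖h‖ ^ 2 / 2) := by
  have h1 := integral_comp_add_stdGaussian (measurable_const (a := (1 : ℝ))) h
  simp only [one_mul, Real.exp_sub, integral_const, probReal_univ, smul_eq_mul] at h1
  rw [integral_div, eq_div_iff (Real.exp_pos _).ne', one_mul] at h1
  exact h1.symm

lemma two_mul_re_waveSum (m : ℕ) (t : ℝ) (u : RealCoord (block m)) :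
    2 * (waveSum (block m) t (toC u)).re
      = ⟪ofC (fun k : block m => ((√2 / √(k : ℕ) : ℝ) : ℂ) * wave k t), u⟫ := by
  rw [inner_eq_sum_coordC, waveSum, Complex.re_sum, Finset.mul_sum, Finset.mul_sum]
  refine Finset.sum_congr rfl fun k _ => ?_
  have h2 : √(2 : ℝ) * √2 = 2 := Real.mul_self_sqrt (by norm_num)
  rw [coordC_ofC]
  have e : ((√2 / √(k : ℕ) : ℝ) : ℂ) * wave k t * toC u k
      = ((√2 : ℝ) : ℂ) * (toC u k / (√(k : ℕ) : ℝ) * wave k t) := by push_cast; ring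
  rw [e, Complex.re_ofReal_mul, ← mul_assoc, h2]

lemma integrable_exp_two_re_waveSum (m : ℕ) (t : ℝ) :
    Integrable (fun u => Real.exp (2 * (waveSum (block m) t (toC u)).re))
      (stdGaussian (RealCoord (block m))) := by
  simp_rw [two_mul_re_waveSum]
  exact integrable_exp_inner _

/-- The real part has variance σ_m², so its moment generating function at 2 is exp(2σ_m²). This is
the normalisation that turns the squared products into martingales. -/
lemma integral_exp_two_re_waveSum (m : ℕ) (t : ℝ) :
    ∫ u, Real.exp (2 * (waveSum (block m) t (toC u)).re) ∂(stdGaussian (RealCoord (block m)))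
      = Real.exp (2 * sigmaSq m) := by
  simp_rw [two_mul_re_waveSum]
  rw [integral_exp_inner, norm_sq_eq_sum_coordC, two_mul_sigmaSq, Finset.sum_div,
    ← Finset.sum_coe_sort (block m) fun k => 1 / (k : ℝ)]
  congr 1
  refine Finset.sum_congr rfl fun k _ => ?_
  rw [coordC_ofC, norm_mul, norm_wave, mul_one, Complex.norm_real, Real.norm_eq_abs, sq_abs,
    div_pow, Real.sq_sqrt (by norm_num), Real.sq_sqrt (Nat.cast_nonneg _)]
  ring

/-! ### The barrier walk, the squared product and the conditional correlations. -/

section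

/-- The walk `∑_{j ≤ m} (Re P_j - 2 σ_j²)`. -/
def walk (m : ℕ) (t : ℝ) (x : ℕ → ℂ) : ℝ :=
  ∑ j ∈ Finset.Icc 1 m, ((P j t x).re - 2 * sigmaSq j)

/-- The walk stays below the barrier `u` up to time `m`. -/
def barrier (u : ℕ → ℝ) (m : ℕ) (t : ℝ) : Set (ℕ → ℂ) := {x | ∀ j ∈ Finset.Icc 1 m, walk j t x ≤ u j}

/-- The normalised partial product restricted to the barrier event. -/
def gpart (u : ℕ → ℝ) (m : ℕ) (t : ℝ) (x : ℕ → ℂ) : ℂ :=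
  (barrier u m t).indicator
    (fun x => Complex.exp (∑ j ∈ Finset.Icc 1 m, P j t x - ((V m / 2 : ℝ) : ℂ))) x

/-- The squared modulus of `gpart`. -/
def theta (u : ℕ → ℝ) (m : ℕ) (t : ℝ) (x : ℕ → ℂ) : ℝ := ‖gpart u m t x‖ ^ 2

variable {u : ℕ → ℝ}

lemma walk_congr {m : ℕ} {t t' : ℝ} {x y : ℕ → ℂ} (h : ∀ j ∈ Finset.Icc 1 m, P j t x = P j t' y)
    {j : ℕ} (hj : j ≤ m) : walk j t x = walk j t' y :=
  Finset.sum_congr rfl fun i hi => by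
    rw [h i (Finset.Icc_subset_Icc_right hj hi)]

lemma gpart_congr {m : ℕ} {t t' : ℝ} {x y : ℕ → ℂ}
    (h : ∀ j ∈ Finset.Icc 1 m, P j t x = P j t' y) : gpart u m t x = gpart u m t' y := by
  have hb : x ∈ barrier u m t ↔ y ∈ barrier u m t' := by
    simp only [barrier, Set.mem_ofPred_eq]
    refine forall₂_congr fun j hj => ?_
    rw [walk_congr h (Finset.mem_Icc.1 hj).2]
  rw [gpart, gpart]
  by_cases hx : x ∈ barrier u m t
  · rw [Set.indicator_of_mem hx, Set.indicator_of_mem (hb.1 hx), Finset.sum_congr rfl h]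
  · rw [Set.indicator_of_notMem hx, Set.indicator_of_notMem fun hy => hx (hb.2 hy)]

lemma theta_congr {m : ℕ} {t t' : ℝ} {x y : ℕ → ℂ}
    (h : ∀ j ∈ Finset.Icc 1 m, P j t x = P j t' y) : theta u m t x = theta u m t' y := by
  rw [theta, theta, gpart_congr h]

lemma theta_nonneg (m : ℕ) (t : ℝ) (x : ℕ → ℂ) : 0 ≤ theta u m t x := sq_nonneg _

lemma measurable_walk (m : ℕ) : Measurable fun p : ℝ × (ℕ → ℂ) => walk m p.1 p.2 := by
  unfold walk
  exact Finset.measurable_fun_sum _ fun j _ =>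
    (Complex.measurable_re.comp (measurable_P j)).sub_const _

lemma measurable_gpart (m : ℕ) : Measurable fun p : ℝ × (ℕ → ℂ) => gpart u m p.1 p.2 := by
  have hs : MeasurableSet {p : ℝ × (ℕ → ℂ) | p.2 ∈ barrier u m p.1} := by
    have : {p : ℝ × (ℕ → ℂ) | p.2 ∈ barrier u m p.1}
        = ⋂ j ∈ Finset.Icc 1 m, {p : ℝ × (ℕ → ℂ) | walk j p.1 p.2 ≤ u j} := by
      ext p; simp [barrier]
    rw [this]
    exact Finset.measurableSet_biInter _ fun j _ =>
      measurableSet_le (measurable_walk j) measurable_const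
  have hf : Measurable fun p : ℝ × (ℕ → ℂ) =>
      Complex.exp (∑ j ∈ Finset.Icc 1 m, P j p.1 p.2 - ((V m / 2 : ℝ) : ℂ)) :=
    Complex.measurable_exp.comp
      ((Finset.measurable_fun_sum _ fun j _ => measurable_P j).sub_const _)
  exact hf.indicator hs

lemma measurable_theta (m : ℕ) : Measurable fun p : ℝ × (ℕ → ℂ) => theta u m p.1 p.2 :=
  (measurable_gpart m).norm.pow_const 2

lemma theta_of_mem {m : ℕ} {t : ℝ} {x : ℕ → ℂ} (h : x ∈ barrier u m t) :
    theta u m t x = Real.exp (2 * walk m t x + V m) := by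
  rw [theta, gpart, Set.indicator_of_mem h, Complex.norm_exp, ← Real.exp_nat_mul]
  congr 1
  simp only [Complex.sub_re, Complex.re_sum, Complex.ofReal_re, walk, V,
    Finset.sum_sub_distrib]
  push_cast
  ring

lemma theta_of_notMem {m : ℕ} {t : ℝ} {x : ℕ → ℂ} (h : x ∉ barrier u m t) :
    theta u m t x = 0 := by
  rw [theta, gpart, Set.indicator_of_notMem h]; simp

/-- The maximal size of `theta`. -/
def thetaMax (u : ℕ → ℝ) (m : ℕ) : ℝ := Real.exp (V m + 2 * u m)

/-- The index is shifted because the barrier imposes nothing at level 0. -/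
lemma theta_le {m : ℕ} (t : ℝ) (x : ℕ → ℂ) : theta u (m + 1) t x ≤ thetaMax u (m + 1) := by
  by_cases h : x ∈ barrier u (m + 1) t
  · rw [theta_of_mem h]
    have := h (m + 1) (by simp)
    exact Real.exp_le_exp.2 (by linarith)
  · rw [theta_of_notMem h]; exact (Real.exp_pos _).le

lemma theta_zero (t : ℝ) (x : ℕ → ℂ) : theta u 0 t x = 1 := by
  rw [theta_of_mem (by simp [barrier])]
  simp [walk, V_zero]

lemma exists_theta_le (u : ℕ → ℝ) (m : ℕ) : ∃ C, ∀ t x, theta u m t x ≤ C := by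
  cases m with
  | zero => exact ⟨1, fun t x => (theta_zero t x).le⟩
  | succ m => exact ⟨_, theta_le⟩

lemma P_periodic (m : ℕ) (t : ℝ) (x : ℕ → ℂ) : P m (t + 2 * Real.pi) x = P m t x := by
  refine Finset.sum_congr rfl fun k _ => ?_
  have : wave k (t + 2 * Real.pi) = wave k t := by
    rw [wave_add]
    have h : wave k (2 * Real.pi) = 1 := by
      have e : Complex.I * k * ((2 * Real.pi : ℝ) : ℂ) = (k : ℤ) * (2 * Real.pi * Complex.I) := by
        push_cast; ring
      rw [wave, e, Complex.exp_int_mul_two_pi_mul_I]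
    rw [h, mul_one]
  rw [this]

lemma walk_update_succ (m : ℕ) (t : ℝ) (x : ℕ → ℂ) (z : block (m + 1) → ℂ) :
    walk (m + 1) t (Function.updateFinset x (block (m + 1)) z)
      = walk m t x + ((waveSum (block (m + 1)) t z).re - 2 * sigmaSq (m + 1)) := by
  rw [walk, Finset.sum_Icc_succ_top (by omega), P_updateFinset_self, walk]
  congr 1
  refine Finset.sum_congr rfl fun j hj => ?_
  rw [Finset.mem_Icc] at hj
  rw [P_updateFinset_of_lt hj.1 (by omega)]

lemma P_update_eq {m j : ℕ} (hj : j ∈ Finset.Icc 1 m) (t : ℝ) (x : ℕ → ℂ)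
    (z : block (m + 1) → ℂ) : P j t (Function.updateFinset x (block (m + 1)) z) = P j t x := by
  rw [Finset.mem_Icc] at hj
  exact P_updateFinset_of_lt hj.1 (by omega) t x z

/-- Dropping the last barrier constraint only increases `theta`, and what the new block contributes
is a factor of mean one. So `theta` is a supermartingale in the number of blocks. -/
lemma theta_update_le (m : ℕ) (t : ℝ) (x : ℕ → ℂ) (z : block (m + 1) → ℂ) :
    theta u (m + 1) t (Function.updateFinset x (block (m + 1)) z) ≤ theta u m t x *
      (Real.exp (2 * (waveSum (block (m + 1)) t z).re) * Real.exp (-(2 * sigmaSq (m + 1)))) := by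
  by_cases h : Function.updateFinset x (block (m + 1)) z ∈ barrier u (m + 1) t
  · have h' : x ∈ barrier u m t := fun j hj => by
      have h1 := h j (Finset.Icc_subset_Icc_right (Nat.le_succ m) hj)
      rwa [walk_congr (m := m) (fun i hi => P_update_eq hi t x z) (Finset.mem_Icc.1 hj).2] at h1
    rw [theta_of_mem h, theta_of_mem h', walk_update_succ, V_succ, ← Real.exp_add, ← Real.exp_add]
    refine (Real.exp_le_exp.2 (le_of_eq ?_))
    ring
  · rw [theta_of_notMem h]
    exact mul_nonneg (theta_nonneg _ _ _) (by positivity)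

lemma measurable_comp_update {T G : Type*} [MeasurableSpace T] [MeasurableSpace G] (m : ℕ)
    {f : T → (ℕ → ℂ) → G} (hf : Measurable fun p : T × (ℕ → ℂ) => f p.1 p.2) (x : ℕ → ℂ) :
    Measurable fun p : T × RealCoord (block m) =>
      f p.1 (Function.updateFinset x (block m) (toC p.2)) :=
  hf.comp (measurable_fst.prodMk
    ((measurable_update m).comp (measurable_const.prodMk measurable_snd)))

lemma integrable_theta_update (m n : ℕ) (t : ℝ) (x : ℕ → ℂ) :
    Integrable (fun v => theta u m t (Function.updateFinset x (block n) (toC v)))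
      (stdGaussian (RealCoord (block n))) := by
  obtain ⟨C, hC⟩ := exists_theta_le u m
  have hm : Measurable fun v : RealCoord (block n) =>
      theta u m t (Function.updateFinset x (block n) (toC v)) :=
    Measurable.comp (g := fun p : ℝ × RealCoord (block n) =>
      theta u m p.1 (Function.updateFinset x (block n) (toC p.2))) (f := fun v => (t, v))
      (measurable_comp_update n (measurable_theta m) x) (measurable_const.prodMk measurable_id)
  refine integrable_of_bound (C := C) hm fun v => ?_
  rw [Real.norm_of_nonneg (theta_nonneg _ _ _)]
  exact hC _ _

lemma avg_theta_le (m : ℕ) (t : ℝ) (x : ℕ → ℂ) :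
    avg (m + 1) (theta u (m + 1) t) x ≤ theta u m t x := by
  have h := integral_mono (integrable_theta_update (u := u) (m + 1) (m + 1) t x)
    (((integrable_exp_two_re_waveSum (m + 1) t).mul_const
      (Real.exp (-(2 * sigmaSq (m + 1))))).const_mul (theta u m t x))
    (fun v => theta_update_le m t x (toC v))
  rw [integral_const_mul, integral_mul_const, integral_exp_two_re_waveSum, ← Real.exp_add,
    add_neg_cancel, Real.exp_zero, mul_one] at h
  exact h

/-- The function `g_L(t) conj (g_L(t + σ))` averaged over the last `n` blocks. -/
def corrAux (u : ℕ → ℝ) (σ : ℝ) (L : ℕ) : ℕ → ℝ → (ℕ → ℂ) → ℂ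
  | 0, t, x => gpart u L t x * (starRingEnd ℂ) (gpart u L (t + σ) x)
  | n + 1, t, x => avg (L - n) (corrAux u σ L n t) x

/-- The function `g_L(t) conj (g_L(t + σ))` averaged over the blocks after the `m`-th. -/
def corr (u : ℕ → ℝ) (σ : ℝ) (L m : ℕ) : ℝ → (ℕ → ℂ) → ℂ := corrAux u σ L (L - m)

variable {σ : ℝ} {L : ℕ}

lemma corr_self (t : ℝ) (x : ℕ → ℂ) :
    corr u σ L L t x = gpart u L t x * (starRingEnd ℂ) (gpart u L (t + σ) x) := by
  rw [corr, Nat.sub_self]; rfl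

lemma corr_of_lt {m : ℕ} (hm : m < L) (t : ℝ) (x : ℕ → ℂ) :
    corr u σ L m t x = avg (m + 1) (corr u σ L (m + 1) t) x := by
  rw [corr, corr, show L - m = (L - (m + 1)) + 1 by omega, corrAux,
    show L - (L - (m + 1)) = m + 1 by omega]

lemma measurable_corr {m : ℕ} (hm : m ≤ L) :
    Measurable fun p : ℝ × (ℕ → ℂ) => corr u σ L m p.1 p.2 := by
  induction hm using Nat.decreasingInduction with
  | self =>
    have h1 : Measurable fun p : ℝ × (ℕ → ℂ) => gpart u L (p.1 + σ) p.2 :=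
      Measurable.comp (g := fun p : ℝ × (ℕ → ℂ) => gpart u L p.1 p.2)
        (f := fun p : ℝ × (ℕ → ℂ) => (p.1 + σ, p.2)) (measurable_gpart L)
        ((measurable_fst.add_const σ).prodMk measurable_snd)
    have h2 : Measurable fun p : ℝ × (ℕ → ℂ) => (starRingEnd ℂ) (gpart u L (p.1 + σ) p.2) :=
      Complex.continuous_conj.measurable.comp h1
    have h3 := (measurable_gpart (u := u) L).mul h2
    have e : (fun p : ℝ × (ℕ → ℂ) => corr u σ L L p.1 p.2)
        = (fun p => gpart u L p.1 p.2) * fun p => (starRingEnd ℂ) (gpart u L (p.1 + σ) p.2) :=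
      funext fun p => corr_self p.1 p.2
    rw [e]
    exact h3
  | of_succ m hm ih =>
    have e : (fun p : ℝ × (ℕ → ℂ) => corr u σ L m p.1 p.2)
        = fun p => avg (m + 1) (corr u σ L (m + 1) p.1) p.2 :=
      funext fun p => corr_of_lt hm p.1 p.2
    rw [e]
    exact measurable_avg (m + 1) ih

/-- The correlation sees the configuration only through the block sums at the two points t and t +
σ. This is why the spaces spanned by two waves are the right ones. -/
lemma corr_congr {m : ℕ} (hm : m ≤ L) {t : ℝ} {x y : ℕ → ℂ}
    (h : ∀ j ∈ Finset.Icc 1 m, P j t x = P j t y)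
    (h' : ∀ j ∈ Finset.Icc 1 m, P j (t + σ) x = P j (t + σ) y) :
    corr u σ L m t x = corr u σ L m t y := by
  induction hm using Nat.decreasingInduction generalizing x y with
  | self => rw [corr_self, corr_self, gpart_congr h, gpart_congr h']
  | of_succ m hm ih =>
    rw [corr_of_lt hm, corr_of_lt hm]
    have key : ∀ {τ : ℝ} (z : block (m + 1) → ℂ), (∀ j ∈ Finset.Icc 1 m, P j τ x = P j τ y) →
        ∀ j ∈ Finset.Icc 1 (m + 1), P j τ (Function.updateFinset x (block (m + 1)) z)
          = P j τ (Function.updateFinset y (block (m + 1)) z) := fun {τ} z hτ j hj => by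
      by_cases hjm : j = m + 1
      · subst hjm; rw [P_updateFinset_self, P_updateFinset_self]
      · have hj' : j ∈ Finset.Icc 1 m := by
          rw [Finset.mem_Icc] at hj ⊢; omega
        rw [P_update_eq hj', P_update_eq hj', hτ j hj']
    exact integral_congr_ae (Filter.Eventually.of_forall fun v =>
      ih (key (toC v) h) (key (toC v) h'))

/-- At level L this is 2|ab| ≤ |a|² + |b|². Averaging over a block preserves it because `theta` is a
supermartingale. -/
lemma norm_corr_le {m : ℕ} (hm : m ≤ L) (t : ℝ) (x : ℕ → ℂ) :
    ‖corr u σ L m t x‖ ≤ (theta u m t x + theta u m (t + σ) x) / 2 := by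
  induction hm using Nat.decreasingInduction generalizing x with
  | self =>
    rw [corr_self, norm_mul, RCLike.norm_conj, theta, theta]
    nlinarith [sq_nonneg (‖gpart u L t x‖ - ‖gpart u L (t + σ) x‖)]
  | of_succ m hm ih =>
    rw [corr_of_lt hm]
    refine (norm_integral_le_integral_norm _).trans ?_
    have h1 := integrable_theta_update (u := u) (m + 1) (m + 1) t x
    have h2 := integrable_theta_update (u := u) (m + 1) (m + 1) (t + σ) x
    have h3 := avg_theta_le (u := u) m t x
    have h4 := avg_theta_le (u := u) m (t + σ) x
    have h5 := integral_mono_of_nonneg (Filter.Eventually.of_forall fun v => norm_nonneg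
      (corr u σ L (m + 1) t (Function.updateFinset x (block (m + 1)) (toC v))))
      ((integrable_fun_add h1 h2).div_const 2) (Filter.Eventually.of_forall fun v => ih _)
    refine h5.trans ?_
    rw [integral_div, integral_add h1 h2]
    rw [avg] at h3 h4
    linarith

end

/-! ### One step of the exponential moment recursion. -/

section

variable {u : ℕ → ℝ} {σ : ℝ} {L : ℕ}

/-- Lebesgue measure on one period. -/
abbrev period : Measure ℝ := volume.restrict (Set.Ioc 0 (2 * Real.pi))

lemma period_real_univ : (period).real Set.univ = 2 * Real.pi := by
  simp [period, Measure.real, Real.pi_pos.le]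

lemma integral_period_add {f : ℝ → ℝ} (hf : Function.Periodic f (2 * Real.pi)) (σ : ℝ) :
    ∫ t, f (t + σ) ∂period = ∫ t, f t ∂period := by
  rw [period, ← intervalIntegral.integral_of_le (by positivity),
    ← intervalIntegral.integral_of_le (by positivity), intervalIntegral.integral_comp_add_right]
  have := hf.intervalIntegral_add_eq σ 0
  rw [zero_add] at this ⊢
  rw [add_comm, this]

/-- The exponent of the recursion. -/
def expo (u : ℕ → ℝ) (σ : ℝ) (L : ℕ) (ψ : ℝ → ℂ) (lam mu : ℝ) (m : ℕ) (t : ℝ) (x : ℕ → ℂ) : ℝ :=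
  lam * (ψ t * corr u σ L m t x).re + mu * theta u m t x

variable {ψ : ℝ → ℂ} {lam mu mu' : ℝ}

lemma measurable_expo (hψ : Measurable ψ) {m : ℕ} (hm : m ≤ L) :
    Measurable fun p : ℝ × (ℕ → ℂ) => expo u σ L ψ lam mu m p.1 p.2 := by
  have h1 : Measurable fun p : ℝ × (ℕ → ℂ) => ψ p.1 * corr u σ L m p.1 p.2 :=
    (hψ.comp measurable_fst).mul (measurable_corr hm)
  exact ((Complex.measurable_re.comp h1).const_mul lam).add ((measurable_theta m).const_mul mu)

lemma abs_re_corr_le (hψ1 : ∀ t, ‖ψ t‖ ≤ 1) {m : ℕ} (hm : m ≤ L) (t : ℝ) (x : ℕ → ℂ) :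
    |(ψ t * corr u σ L m t x).re| ≤ (theta u m t x + theta u m (t + σ) x) / 2 := by
  refine (Complex.abs_re_le_norm _).trans ?_
  rw [norm_mul]
  exact (mul_le_of_le_one_left (norm_nonneg _) (hψ1 t)).trans (norm_corr_le hm t x)

lemma exists_abs_expo_le (hψ1 : ∀ t, ‖ψ t‖ ≤ 1) {m : ℕ} (hm : m ≤ L) :
    ∃ C, ∀ t x, |expo u σ L ψ lam mu m t x| ≤ C := by
  obtain ⟨C, hC⟩ := exists_theta_le u m
  refine ⟨|lam| * C + |mu| * C, fun t x => ?_⟩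
  refine (abs_add_le _ _).trans ?_
  rw [abs_mul, abs_mul, abs_of_nonneg (theta_nonneg m t x)]
  have := abs_re_corr_le (u := u) (σ := σ) (L := L) hψ1 hm t x
  have h1 := hC t x
  have h2 := hC (t + σ) x
  gcongr
  linarith

/-- The mean reproduces the correlation one level down and can only lower `theta`. In the second
moment one factor is bounded by `thetaMax`, so the variance cost is again linear in `theta` at t and
at t + σ and can be absorbed in the weight mu. -/
lemma exp_step_aux (hψ1 : ∀ t, ‖ψ t‖ ≤ 1) (hmu : 0 ≤ mu)
    {m : ℕ} (hm : m < L) (t : ℝ) (x : ℕ → ℂ) :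
    ∫ v, expo u σ L ψ lam mu (m + 1) t (Function.updateFinset x (block (m + 1)) (toC v))
        ∂(stdGaussian (RealCoord (block (m + 1))))
      + kap (m + 1) * ∫ v, expo u σ L ψ lam mu (m + 1) t
          (Function.updateFinset x (block (m + 1)) (toC v)) ^ 2
        ∂(stdGaussian (RealCoord (block (m + 1))))
      ≤ lam * (ψ t * corr u σ L m t x).re + (mu + kap (m + 1) * thetaMax u (m + 1)
        * (lam ^ 2 + 2 * mu ^ 2)) * theta u m t x
        + kap (m + 1) * thetaMax u (m + 1) * lam ^ 2 * theta u m (t + σ) x := by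
  set γ := stdGaussian (RealCoord (block (m + 1)))
  set U : RealCoord (block (m + 1)) → ℕ → ℂ :=
    fun v => Function.updateFinset x (block (m + 1)) (toC v) with hU
  have hU' : ∀ v, Function.updateFinset x (block (m + 1)) (toC v) = U v := fun _ => rfl
  simp_rw [hU']
  set b := thetaMax u (m + 1)
  have hb : 0 ≤ b := (Real.exp_pos _).le
  have hκ := kap_pos (m + 1)
  have hth : ∀ τ, Integrable (fun v => theta u (m + 1) τ (U v)) γ := fun τ =>
    integrable_theta_update (m + 1) (m + 1) τ x
  have hcm : Measurable fun v => corr u σ L (m + 1) t (U v) :=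
    Measurable.comp (g := fun p : ℝ × RealCoord (block (m + 1)) => corr u σ L (m + 1) p.1 (U p.2))
      (f := fun v => (t, v)) (measurable_comp_update (m + 1) (measurable_corr hm) x)
      (measurable_const.prodMk measurable_id)
  have hci : Integrable (fun v => corr u σ L (m + 1) t (U v)) γ := by
    refine integrable_of_bound (C := b) hcm fun v => ?_
    have := norm_corr_le (u := u) (σ := σ) (show m + 1 ≤ L from hm) t (U v)
    linarith [theta_le (u := u) t (U v) (m := m), theta_le (u := u) (t + σ) (U v) (m := m)]
  have hcr : Integrable (fun v => (ψ t * corr u σ L (m + 1) t (U v)).re) γ := (hci.const_mul _).re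
  have hc1 : ∫ v, (ψ t * corr u σ L (m + 1) t (U v)).re ∂γ = (ψ t * corr u σ L m t x).re := by
    have h1 := integral_re (hci.const_mul (ψ t))
    simp only [RCLike.re_to_complex] at h1
    rw [h1, integral_const_mul, corr_of_lt hm]
    rfl
  have h1 : ∫ v, expo u σ L ψ lam mu (m + 1) t (U v) ∂γ
      ≤ lam * (ψ t * corr u σ L m t x).re + mu * theta u m t x := by
    simp only [expo]
    rw [integral_add (hcr.const_mul _) ((hth t).const_mul _), integral_const_mul,
      integral_const_mul, hc1]
    have := avg_theta_le (u := u) m t x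
    rw [avg] at this
    gcongr
  have hsq : ∀ v, expo u σ L ψ lam mu (m + 1) t (U v) ^ 2
      ≤ b * (lam ^ 2 + 2 * mu ^ 2) * theta u (m + 1) t (U v)
        + b * lam ^ 2 * theta u (m + 1) (t + σ) (U v) := fun v => by
    have ha := abs_re_corr_le (u := u) (σ := σ) (L := L) hψ1 hm t (U v)
    have h2 := theta_le (u := u) t (U v) (m := m)
    have h3 := theta_le (u := u) (t + σ) (U v) (m := m)
    have h4 := theta_nonneg (u := u) (m + 1) t (U v)
    have h5 := theta_nonneg (u := u) (m + 1) (t + σ) (U v)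
    simp only [expo]
    set q := (ψ t * corr u σ L (m + 1) t (U v)).re
    set A := theta u (m + 1) t (U v)
    set B := theta u (m + 1) (t + σ) (U v)
    have hq : q ^ 2 ≤ ((A + B) / 2) ^ 2 := sq_le_sq' (by linarith [neg_abs_le q])
      ((le_abs_self q).trans ha)
    have hA : A ^ 2 ≤ b * A := by rw [sq]; gcongr
    have hB : B ^ 2 ≤ b * B := by rw [sq]; gcongr
    have hq2 : 2 * q ^ 2 ≤ b * A + b * B := by nlinarith [sq_nonneg (A - B)]
    calc (lam * q + mu * A) ^ 2 ≤ lam ^ 2 * (2 * q ^ 2) + 2 * mu ^ 2 * A ^ 2 := by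
          nlinarith [sq_nonneg (lam * q - mu * A)]
      _ ≤ lam ^ 2 * (b * A + b * B) + 2 * mu ^ 2 * (b * A) := by gcongr
      _ = _ := by ring
  have h2 : ∫ v, expo u σ L ψ lam mu (m + 1) t (U v) ^ 2 ∂γ
      ≤ b * (lam ^ 2 + 2 * mu ^ 2) * theta u m t x + b * lam ^ 2 * theta u m (t + σ) x := by
    have h3 := integral_mono_of_nonneg (μ := γ)
      (Filter.Eventually.of_forall fun v => sq_nonneg (expo u σ L ψ lam mu (m + 1) t (U v)))
      (integrable_fun_add ((hth t).const_mul (b * (lam ^ 2 + 2 * mu ^ 2)))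
        ((hth (t + σ)).const_mul (b * lam ^ 2))) (Filter.Eventually.of_forall hsq)
    refine h3.trans ?_
    rw [integral_add ((hth t).const_mul _) ((hth (t + σ)).const_mul _), integral_const_mul,
      integral_const_mul]
    have h4 := avg_theta_le (u := u) m t x
    have h5 := avg_theta_le (u := u) m (t + σ) x
    rw [avg] at h4 h5
    gcongr
  have h3 := mul_le_mul_of_nonneg_left h2 hκ.le
  linarith

lemma theta_periodic (m : ℕ) (x : ℕ → ℂ) :
    Function.Periodic (fun t => theta u m t x) (2 * Real.pi) := fun t =>
  theta_congr fun j _ => P_periodic j t x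

lemma integrable_theta (m : ℕ) (τ : ℝ) (x : ℕ → ℂ) :
    Integrable (fun t => theta u m (t + τ) x) period := by
  obtain ⟨C, hC⟩ := exists_theta_le u m
  have hm : Measurable fun t : ℝ => theta u m (t + τ) x :=
    Measurable.comp (g := fun p : ℝ × (ℕ → ℂ) => theta u m p.1 p.2) (f := fun t : ℝ => (t + τ, x))
      (measurable_theta m) ((measurable_id.add_const τ).prodMk measurable_const)
  refine integrable_of_bound (C := C) hm fun t => ?_
  rw [Real.norm_of_nonneg (theta_nonneg _ _ _)]
  exact hC _ _

lemma measurable_corr_left {m : ℕ} (hm : m ≤ L) (x : ℕ → ℂ) :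
    Measurable fun t => corr u σ L m t x :=
  Measurable.comp (g := fun p : ℝ × (ℕ → ℂ) => corr u σ L m p.1 p.2) (f := fun t : ℝ => (t, x))
    (measurable_corr hm) (measurable_id.prodMk measurable_const)

lemma integrable_re_corr (hψ : Measurable ψ) (hψ1 : ∀ t, ‖ψ t‖ ≤ 1) {m : ℕ} (hm : m ≤ L)
    (x : ℕ → ℂ) : Integrable (fun t => (ψ t * corr u σ L m t x).re) period := by
  obtain ⟨C, hC⟩ := exists_theta_le u m
  have h : Measurable fun t => (ψ t * corr u σ L m t x).re :=
    Complex.measurable_re.comp (hψ.mul (measurable_corr_left hm x))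
  refine integrable_of_bound (C := C) h fun t => ?_
  have := abs_re_corr_le (u := u) (σ := σ) (L := L) hψ1 hm t x
  rw [Real.norm_eq_abs]
  linarith [hC t x, hC (t + σ) x]

lemma integral_expo (hψ : Measurable ψ) (hψ1 : ∀ t, ‖ψ t‖ ≤ 1) {m : ℕ} (hm : m ≤ L)
    (x : ℕ → ℂ) : ∫ t, expo u σ L ψ lam mu m t x ∂period
      = lam * ∫ t, (ψ t * corr u σ L m t x).re ∂period + mu * ∫ t, theta u m t x ∂period := by
  have h1 := integrable_theta (u := u) m 0 x
  simp only [add_zero] at h1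
  simp only [expo]
  rw [integral_add ((integrable_re_corr hψ hψ1 hm x).const_mul _) (h1.const_mul _),
    integral_const_mul, integral_const_mul]

/-- One step of the recursion for the exponential moments. -/
lemma avg_exp_le (hψ : Measurable ψ) (hψ1 : ∀ t, ‖ψ t‖ ≤ 1) (hlam : 0 ≤ lam) (hmu : 0 ≤ mu)
    {m : ℕ} (hm : m < L) (h1 : kap (m + 1) * ((lam + mu) * thetaMax u (m + 1)) ≤ 1)
    (h2 : mu + 2 * (kap (m + 1) * thetaMax u (m + 1)) * (lam ^ 2 + mu ^ 2) ≤ mu') (x : ℕ → ℂ) :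
    avg (m + 1) (fun y => Real.exp (∫ t, expo u σ L ψ lam mu (m + 1) t y ∂period)) x
      ≤ Real.exp (∫ t, expo u σ L ψ lam mu' m t x ∂period) := by
  have hκ := kap_pos (m + 1)
  have hb : 0 < thetaMax u (m + 1) := Real.exp_pos _
  have hm' : m ≤ L := hm.le
  set U : RealCoord (block (m + 1)) → ℕ → ℂ :=
    fun v => Function.updateFinset x (block (m + 1)) (toC v)
  set φ : ℝ → RealCoord (block (m + 1)) → ℝ := fun t v => expo u σ L ψ lam mu (m + 1) t (U v)
  have hφm : Measurable (Function.uncurry φ) :=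
    measurable_comp_update (m + 1) (measurable_expo hψ hm) x
  have hφb : ∀ t v, kap (m + 1) * |φ t v| ≤ 1 := fun t v => by
    refine le_trans (mul_le_mul_of_nonneg_left ?_ hκ.le) h1
    refine (abs_add_le _ _).trans ?_
    rw [abs_mul, abs_mul, abs_of_nonneg (theta_nonneg _ t (U v)), abs_of_nonneg hlam,
      abs_of_nonneg hmu, add_mul]
    have h3 := abs_re_corr_le (u := u) (σ := σ) (L := L) hψ1 hm t (U v)
    have h4 := theta_le (u := u) t (U v) (m := m)
    have h5 := theta_le (u := u) (t + σ) (U v) (m := m)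
    have h6 : |(ψ t * corr u σ L (m + 1) t (U v)).re| ≤ thetaMax u (m + 1) := by linarith
    gcongr
  -- A displacement orthogonal to both waves changes neither the block sum at t nor the one at t +
  -- σ.
  have hinv : ∀ t v, ∀ h ∈ (waveSpace (block (m + 1)) σ t)ᗮ, φ t (v + h) = φ t v := by
    intro t v h hh
    obtain ⟨w1, w2⟩ := waveSum_eq_zero hh
    have key : ∀ τ, waveSum (block (m + 1)) τ (toC h) = 0 →
        ∀ j ∈ Finset.Icc 1 (m + 1), P j τ (U (v + h)) = P j τ (U v) := fun τ hτ j hj => by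
      by_cases hjm : j = m + 1
      · subst hjm
        rw [P_updateFinset_self, P_updateFinset_self, waveSum_toC_add, hτ, add_zero]
      · have hj' : j ∈ Finset.Icc 1 m := by
          rw [Finset.mem_Icc] at hj ⊢; omega
        rw [P_update_eq hj', P_update_eq hj']
    simp only [φ, expo]
    rw [corr_congr hm (key t w1) (key (t + σ) w2), theta_congr (key t w1)]
  have main := integral_exp_integral_le hκ (isBessel_block m σ) hφm hφb hinv
  refine main.trans (Real.exp_le_exp.2 ?_)
  have hth := integrable_theta (u := u) m 0 x
  simp only [add_zero] at hth
  have hth' := integrable_theta (u := u) m σ x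
  have hr := integrable_re_corr (u := u) (σ := σ) hψ hψ1 hm' x
  have hpt := fun t => exp_step_aux (u := u) (σ := σ) (lam := lam) hψ1 hmu hm t x
  have hI1 : Integrable (fun t => ∫ v, φ t v ∂(stdGaussian (RealCoord (block (m + 1))))
      + kap (m + 1) * ∫ v, φ t v ^ 2 ∂(stdGaussian (RealCoord (block (m + 1))))) period := by
    have hφC : ∀ t v, |φ t v| ≤ (kap (m + 1))⁻¹ := fun t v => by
      rw [← one_div, le_div_iff₀ hκ, mul_comm]; exact hφb t v
    refine integrable_fun_add ?_ (Integrable.const_mul ?_ _)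
    · refine integrable_of_bound (C := 1 * (kap (m + 1))⁻¹)
        (hφm.stronglyMeasurable.integral_prod_right').measurable fun t => ?_
      have := abs_integral_le_of_abs_le (ν := stdGaussian (RealCoord (block (m + 1)))) (hφC t)
      simpa using this
    · refine integrable_of_bound (C := 1 * ((kap (m + 1))⁻¹) ^ 2)
        ((hφm.pow_const 2).stronglyMeasurable.integral_prod_right').measurable fun t => ?_
      have := abs_integral_le_of_abs_le (ν := stdGaussian (RealCoord (block (m + 1))))
        (f := fun v => φ t v ^ 2) (C := ((kap (m + 1))⁻¹) ^ 2) (fun v => by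
          rw [abs_pow]; exact pow_le_pow_left₀ (abs_nonneg _) (hφC t v) 2)
      simpa using this
  refine (integral_mono hI1 (integrable_fun_add (integrable_fun_add (hr.const_mul lam)
    (hth.const_mul _)) (hth'.const_mul _)) hpt).trans ?_
  -- Over a full period the terms at t + σ and at t have the same integral, so the costs add up to
  -- 2(lam² + mu²).
  rw [integral_add (integrable_fun_add (hr.const_mul lam) (hth.const_mul _)) (hth'.const_mul _),
    integral_add (hr.const_mul lam) (hth.const_mul _), integral_const_mul, integral_const_mul,
    integral_const_mul, integral_period_add (theta_periodic m x) σ, integral_expo hψ hψ1 hm']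
  have h0 : 0 ≤ ∫ t, theta u m t x ∂period := integral_nonneg fun t => theta_nonneg m t x
  have h3 := mul_le_mul_of_nonneg_right h2 h0
  nlinarith

end

/-! ### Iterating the recursion over the blocks. -/

section

variable {u : ℕ → ℝ} {σ : ℝ} {L : ℕ}
variable {ψ : ℝ → ℂ} {lam mu mu' : ℝ}

/-- The product of standard complex Gaussian laws over a finite set of coordinates. -/
abbrev gmarg (s : Finset ℕ) (f : (ℕ → ℂ) → ENNReal) : (ℕ → ℂ) → ENNReal :=
  lmarginal (fun _ : ℕ => stdComplex) s f

lemma gmarg_block_ofReal (m : ℕ) {f : (ℕ → ℂ) → ℝ} (hf : Measurable f) {C : ℝ}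
    (h0 : ∀ x, 0 ≤ f x) (hC : ∀ x, f x ≤ C) (x : ℕ → ℂ) :
    gmarg (block m) (fun y => ENNReal.ofReal (f y)) x = ENNReal.ofReal (avg m f x) := by
  have hm : Measurable fun z : block m → ℂ =>
      ENNReal.ofReal (f (Function.updateFinset x (block m) z)) :=
    (hf.comp measurable_updateFinset).ennreal_ofReal
  have hm' : Measurable fun v : RealCoord (block m) =>
      f (Function.updateFinset x (block m) (toC v)) :=
    hf.comp (measurable_updateFinset.comp measurable_toC)
  rw [gmarg, lmarginal, ← map_toC, lintegral_map hm measurable_toC, avg,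
    ofReal_integral_eq_lintegral_ofReal _ (Filter.Eventually.of_forall fun v => h0 _)]
  exact integrable_of_bound (C := C) hm' fun v => by
    rw [Real.norm_of_nonneg (h0 _)]; exact hC _

lemma measurable_exp_integral_expo (hψ : Measurable ψ) {m : ℕ} (hm : m ≤ L) :
    Measurable fun x => Real.exp (∫ t, expo u σ L ψ lam mu m t x ∂period) := by
  have h : Measurable fun p : (ℕ → ℂ) × ℝ => expo u σ L ψ lam mu m p.2 p.1 :=
    (measurable_expo hψ hm).comp measurable_swap
  exact Real.measurable_exp.comp h.stronglyMeasurable.integral_prod_right'.measurable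

lemma exists_exp_integral_expo_le (hψ1 : ∀ t, ‖ψ t‖ ≤ 1) {m : ℕ} (hm : m ≤ L) :
    ∃ C, ∀ x, Real.exp (∫ t, expo u σ L ψ lam mu m t x ∂period) ≤ C := by
  obtain ⟨C, hC⟩ := exists_abs_expo_le (u := u) (σ := σ) (L := L) (lam := lam) (mu := mu) hψ1 hm
  refine ⟨Real.exp ((period).real Set.univ * C), fun x => Real.exp_le_exp.2 ?_⟩
  exact (le_abs_self _).trans (abs_integral_le_of_abs_le fun t => hC t x)

/-- The conditions on the weights that make one step of the recursion work. -/
def StepOK (u : ℕ → ℝ) (lam : ℝ) (mu : ℕ → ℝ) (m : ℕ) : Prop :=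
  kap (m + 1) * ((lam + mu (m + 1)) * thetaMax u (m + 1)) ≤ 1 ∧
    mu (m + 1) + 2 * (kap (m + 1) * thetaMax u (m + 1)) * (lam ^ 2 + mu (m + 1) ^ 2) ≤ mu m

/-- The last block is integrated out first, so that its step applies with all earlier coordinates
frozen. Each step replaces the weight mu (m + 1) by the larger mu m. -/
lemma gmarg_exp_le {mu : ℕ → ℝ} (hψ : Measurable ψ) (hψ1 : ∀ t, ‖ψ t‖ ≤ 1) (hlam : 0 ≤ lam)
    (hmu : ∀ m, 0 ≤ mu m) {a b : ℕ} (hab : a ≤ b) (hb : b ≤ L)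
    (h : ∀ m, a ≤ m → m < b → StepOK u lam mu m) (x : ℕ → ℂ) :
    gmarg (Finset.Ioc (top a) (top b))
        (fun y => ENNReal.ofReal (Real.exp (∫ t, expo u σ L ψ lam (mu b) b t y ∂period))) x
      ≤ ENNReal.ofReal (Real.exp (∫ t, expo u σ L ψ lam (mu a) a t x ∂period)) := by
  induction b, hab using Nat.le_induction generalizing x with
  | base => simp [gmarg]
  | succ b hab ih =>
    have hbL : b ≤ L := by omega
    have hun : Finset.Ioc (top a) (top (b + 1)) = Finset.Ioc (top a) (top b) ∪ block (b + 1) := by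
      rw [block_eq, Finset.Ioc_union_Ioc_eq_Ioc (top_mono hab) (top_mono (Nat.le_succ b))]
    have hdis : Disjoint (Finset.Ioc (top a) (top b)) (block (b + 1)) := by
      rw [block_eq]
      exact Finset.disjoint_left.2 fun k hk hk' => by
        simp only [Finset.mem_Ioc] at hk hk'; omega
    rw [gmarg, hun, lmarginal_union _ _ (measurable_exp_integral_expo hψ hb).ennreal_ofReal hdis]
    refine le_trans (lmarginal_mono (g := fun y => ENNReal.ofReal
      (Real.exp (∫ t, expo u σ L ψ lam (mu b) b t y ∂period))) (fun y => ?_) x)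
      (ih hbL (fun m h1 h2 => h m h1 (by omega)) x)
    obtain ⟨C, hC⟩ := exists_exp_integral_expo_le (u := u) (σ := σ) (L := L) (lam := lam)
      (mu := mu (b + 1)) hψ1 hb
    have h1 := gmarg_block_ofReal (b + 1) (measurable_exp_integral_expo (u := u) (σ := σ)
      (lam := lam) (mu := mu (b + 1)) hψ hb) (fun x => (Real.exp_pos _).le) hC y
    rw [gmarg] at h1
    rw [h1]
    have h2 := h b hab (Nat.lt_succ_self b)
    exact ENNReal.ofReal_le_ofReal (avg_exp_le hψ hψ1 hlam (hmu _) hb h2.1 h2.2 y)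

/-- Exponential moments of the twisted correlation integral on an event where its average over
the high blocks is small. -/
lemma gmarg_indicator_exp_le {mu : ℕ → ℝ} (hψ : Measurable ψ) (hψ1 : ∀ t, ‖ψ t‖ ≤ 1)
    (hlam : 0 ≤ lam) (hmu : ∀ m, 0 ≤ mu m) {n : ℕ} (hn : n ≤ L)
    (hhigh : ∀ m, n ≤ m → m < L → StepOK u lam mu m) (hlow : ∀ m < n, StepOK u 0 mu m)
    {E : Set (ℕ → ℂ)} (hE : MeasurableSet E)
    (hdep : ∀ x y : ℕ → ℂ, (∀ k ∈ Finset.Ioc 0 (top n), x k = y k) → (x ∈ E ↔ y ∈ E))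
    (hsmall : ∀ x ∈ E, lam * ∫ t, (ψ t * corr u σ L n t x).re ∂period ≤ 1) (x : ℕ → ℂ) :
    gmarg (Finset.Ioc 0 (top L)) (E.indicator fun y => ENNReal.ofReal
        (Real.exp (lam * ∫ t, (ψ t * corr u σ L L t y).re ∂period))) x
      ≤ ENNReal.ofReal (Real.exp (1 + 2 * Real.pi * mu 0)) := by
  set Ψ : (ℕ → ℂ) → ENNReal := fun y => ENNReal.ofReal
    (Real.exp (∫ t, expo u σ L ψ lam (mu L) L t y ∂period)) with hΨ
  have hΨm : Measurable Ψ := (measurable_exp_integral_expo hψ le_rfl).ennreal_ofReal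
  have h1 : (E.indicator fun y => ENNReal.ofReal
      (Real.exp (lam * ∫ t, (ψ t * corr u σ L L t y).re ∂period))) ≤ E.indicator Ψ := by
    refine Set.indicator_mono fun y => ENNReal.ofReal_le_ofReal (Real.exp_le_exp.2 ?_)
    rw [integral_expo hψ hψ1 le_rfl]
    have : 0 ≤ ∫ t, theta u L t y ∂period := integral_nonneg fun t => theta_nonneg L t y
    have := mul_nonneg (hmu L) this
    linarith
  have hun : Finset.Ioc 0 (top L) = Finset.Ioc 0 (top n) ∪ Finset.Ioc (top n) (top L) := by
    rw [Finset.Ioc_union_Ioc_eq_Ioc (Nat.zero_le _) (top_mono hn)]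
  have hdis : Disjoint (Finset.Ioc 0 (top n)) (Finset.Ioc (top n) (top L)) :=
    Finset.disjoint_left.2 fun k hk hk' => by
      simp only [Finset.mem_Ioc] at hk hk'; omega
  refine (lmarginal_mono h1 x).trans ?_
  rw [hun, lmarginal_union _ _ (hΨm.indicator hE) hdis]
  -- The event E involves only the low coordinates, so it is constant while the high ones are
  -- integrated. On E the surviving twisted term is at most 1. It is paid by a factor e, and lam can
  -- be set to 0 for the remaining blocks.
  have h2 : gmarg (Finset.Ioc (top n) (top L)) (E.indicator Ψ) ≤ fun y => ENNReal.ofReal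
      (Real.exp 1) * ENNReal.ofReal (Real.exp (∫ t, expo u σ L ψ 0 (mu n) n t y ∂period)) := by
    intro y
    have hmem : ∀ z, Function.updateFinset y (Finset.Ioc (top n) (top L)) z ∈ E ↔ y ∈ E :=
      fun z => hdep _ _ fun k hk => by
        have := Finset.disjoint_left.1 hdis hk
        simp [Function.updateFinset, this]
    by_cases hy : y ∈ E
    · have h3 : gmarg (Finset.Ioc (top n) (top L)) (E.indicator Ψ) y
          = gmarg (Finset.Ioc (top n) (top L)) Ψ y := by
        simp only [gmarg, lmarginal]
        refine lintegral_congr fun z => ?_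
        rw [Set.indicator_of_mem ((hmem z).2 hy)]
      rw [h3]
      refine (gmarg_exp_le hψ hψ1 hlam hmu hn le_rfl hhigh y).trans ?_
      beta_reduce
      rw [← ENNReal.ofReal_mul (Real.exp_pos _).le, ← Real.exp_add]
      refine ENNReal.ofReal_le_ofReal (Real.exp_le_exp.2 ?_)
      rw [integral_expo hψ hψ1 hn, integral_expo hψ hψ1 hn]
      have := hsmall y hy
      linarith
    · have h3 : gmarg (Finset.Ioc (top n) (top L)) (E.indicator Ψ) y = 0 := by
        simp only [gmarg, lmarginal]
        rw [lintegral_congr fun z => Set.indicator_of_notMem (fun h => hy ((hmem z).1 h)) _]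
        simp
      rw [h3]
      exact zero_le
  refine (lmarginal_mono h2 x).trans ?_
  have h4 := gmarg_exp_le (lam := 0) (σ := σ) hψ hψ1 le_rfl hmu (Nat.zero_le n) hn
    (fun m _ hm => hlow m hm) x
  have htop : top 0 = 0 := rfl
  rw [htop, gmarg] at h4
  have h5 : lmarginal (fun _ : ℕ => stdComplex) (Finset.Ioc 0 (top n)) (fun y => ENNReal.ofReal
      (Real.exp 1) * ENNReal.ofReal (Real.exp (∫ t, expo u σ L ψ 0 (mu n) n t y ∂period))) x
      = ENNReal.ofReal (Real.exp 1) * lmarginal (fun _ : ℕ => stdComplex) (Finset.Ioc 0 (top n))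
        (fun y => ENNReal.ofReal (Real.exp (∫ t, expo u σ L ψ 0 (mu n) n t y ∂period))) x := by
    simp only [lmarginal]
    rw [lintegral_const_mul]
    exact (measurable_exp_integral_expo hψ hn).ennreal_ofReal.comp measurable_updateFinset
  rw [h5]
  refine (mul_le_mul_right h4 _).trans ?_
  rw [← ENNReal.ofReal_mul (Real.exp_pos _).le, ← Real.exp_add]
  refine ENNReal.ofReal_le_ofReal (Real.exp_le_exp.2 ?_)
  rw [integral_expo hψ hψ1 (Nat.zero_le L)]
  -- At level 0 `theta` is identically 1, so only the length 2π of the period and mu 0 remain.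
  simp only [theta_zero, zero_mul, zero_add, integral_const, smul_eq_mul, mul_one]
  rw [period_real_univ]
  linarith

end

/-! ### Rotation invariance, oscillatory integrals and level sets of trigonometric polynomials. -/

section

lemma stdComplex_eq_map : stdComplex = (stdGaussian ℂ).map (fun z : ℂ => z / ((√2 : ℝ) : ℂ)) := by
  rw [stdGaussian_eq_map_pi_orthonormalBasis Complex.orthonormalBasisOneI,
    Measure.map_map (by fun_prop) (by fun_prop), ← map_pi_fin_two]
  congr 1
  funext w
  apply Complex.ext <;> simp [Fin.sum_univ_two, Complex.div_ofReal_re, Complex.div_ofReal_im]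

lemma stdComplex_map_mul {a : ℂ} (ha : ‖a‖ = 1) : stdComplex.map (· * a) = stdComplex := by
  have h := stdGaussian_map (rotation ⟨a, by simp [Submonoid.unitSphere, ha]⟩)
  conv_rhs => rw [stdComplex_eq_map, ← h]
  rw [stdComplex_eq_map, Measure.map_map (by fun_prop) (by fun_prop),
    Measure.map_map (by fun_prop) (by fun_prop)]
  congr 1
  funext z
  change z / ((√2 : ℝ) : ℂ) * a = a * z / ((√2 : ℝ) : ℂ)
  ring

/-- Rotation of the coordinates corresponding to a translation by `τ`. -/
def rot (τ : ℝ) (x : ℕ → ℂ) (k : ℕ) : ℂ := x k * wave k τ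

lemma P_rot (m : ℕ) (t τ : ℝ) (x : ℕ → ℂ) : P m t (rot τ x) = P m (t + τ) x :=
  Finset.sum_congr rfl fun k _ => by rw [rot, wave_add]; ring

lemma avg_eq_integral_pi (m : ℕ) {f : (ℕ → ℂ) → ℂ} (hf : Measurable f) (x : ℕ → ℂ) :
    avg m f x = ∫ z, f (Function.updateFinset x (block m) z)
      ∂(Measure.pi fun _ : block m => stdComplex) := by
  have hm : Measurable fun z : block m → ℂ => f (Function.updateFinset x (block m) z) :=
    hf.comp measurable_updateFinset
  rw [← map_toC, integral_map measurable_toC.aemeasurable hm.aestronglyMeasurable, avg]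

lemma avg_rot (m : ℕ) (τ : ℝ) {f : (ℕ → ℂ) → ℂ} (hf : Measurable f) (x : ℕ → ℂ) :
    avg m f (rot τ x) = avg m (fun y => f (rot τ y)) x := by
  have hrot : Measurable (rot τ) := measurable_pi_iff.2 fun k =>
    (measurable_pi_apply k).mul_const _
  rw [avg_eq_integral_pi m hf, avg_eq_integral_pi m (f := fun y => f (rot τ y)) (hf.comp hrot)]
  have hz : Measurable fun (z : block m → ℂ) (k : block m) => z k * wave k τ :=
    measurable_pi_iff.2 fun k => (measurable_pi_apply k).mul_const _
  have hpi : (Measure.pi fun _ : block m => stdComplex).map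
      (fun (z : block m → ℂ) (k : block m) => z k * wave k τ)
      = Measure.pi fun _ : block m => stdComplex := by
    rw [Measure.pi_map_pi (f := fun (k : block m) (z : ℂ) => z * wave k τ)
      (fun k => (by fun_prop : Measurable fun z : ℂ => z * wave k τ).aemeasurable)]
    congr 1
    funext k
    exact stdComplex_map_mul (norm_wave k τ)
  have hm : Measurable fun z : block m → ℂ => f (Function.updateFinset (rot τ x) (block m) z) :=
    hf.comp measurable_updateFinset
  conv_lhs => rw [← hpi]
  rw [integral_map hz.aemeasurable hm.aestronglyMeasurable]
  refine integral_congr_ae (Filter.Eventually.of_forall fun z => ?_)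
  beta_reduce
  congr 1
  funext k
  by_cases hk : k ∈ block m <;> simp [Function.updateFinset, rot, hk]

variable {u : ℕ → ℝ} {σ : ℝ} {L : ℕ}

lemma measurable_corr_right {m : ℕ} (hm : m ≤ L) (t : ℝ) :
    Measurable fun x => corr u σ L m t x :=
  Measurable.comp (g := fun p : ℝ × (ℕ → ℂ) => corr u σ L m p.1 p.2)
    (f := fun x : ℕ → ℂ => (t, x)) (measurable_corr hm) (measurable_const.prodMk measurable_id)

/-- Translating the point multiplies each coordinate by a unimodular number, which leaves the law of
the averaged blocks unchanged. All dependence on the point can thus be moved into the low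
coordinates. -/
lemma corr_rot {m : ℕ} (hm : m ≤ L) (t τ : ℝ) (x : ℕ → ℂ) :
    corr u σ L m (t + τ) x = corr u σ L m t (rot τ x) := by
  induction hm using Nat.decreasingInduction generalizing x with
  | self =>
    have h1 : gpart u L (t + τ) x = gpart u L t (rot τ x) :=
      gpart_congr fun j _ => (P_rot j t τ x).symm
    have h2 : gpart u L (t + τ + σ) x = gpart u L (t + σ) (rot τ x) :=
      gpart_congr fun j _ => by rw [P_rot, add_right_comm]
    rw [corr_self, corr_self, h1, h2]
  | of_succ m hm ih =>
    rw [corr_of_lt hm, corr_of_lt hm, avg_rot _ _ (measurable_corr_right hm t)]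
    exact integral_congr_ae (Filter.Eventually.of_forall fun v => ih _)

lemma integral_period_add_complex {f : ℝ → ℂ} (hf : Function.Periodic f (2 * Real.pi)) (σ : ℝ) :
    ∫ t, f (t + σ) ∂period = ∫ t, f t ∂period := by
  rw [period, ← intervalIntegral.integral_of_le (by positivity),
    ← intervalIntegral.integral_of_le (by positivity), intervalIntegral.integral_comp_add_right]
  have := hf.intervalIntegral_add_eq σ 0
  rw [zero_add] at this ⊢
  rw [add_comm, this]

lemma norm_exp_int_mul (r : ℤ) (t : ℝ) : ‖Complex.exp (Complex.I * r * t)‖ = 1 := by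
  have : Complex.I * r * t = ((r * t : ℝ) : ℂ) * Complex.I := by push_cast; ring
  rw [this, Complex.norm_exp_ofReal_mul_I]

/-- An oscillatory integral is controlled by the modulus of continuity at half a period. -/
lemma norm_integral_osc_le {Φ : ℝ → ℂ} (hΦ : Measurable Φ) {C : ℝ} (hC : ∀ t, ‖Φ t‖ ≤ C)
    (hper : Function.Periodic Φ (2 * Real.pi)) {r : ℤ} (hr : r ≠ 0) :
    ‖∫ t, Complex.exp (Complex.I * r * t) * Φ t ∂period‖
      ≤ 1 / 2 * ∫ t, ‖Φ t - Φ (t + Real.pi / |(r : ℝ)|)‖ ∂period := by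
  set h := Real.pi / |(r : ℝ)| with hh
  have hr' : (r : ℝ) ≠ 0 := by exact_mod_cast hr
  -- The shift is half a period of the oscillation. Averaging the integral with its translate leaves
  -- only the increment of Φ.
  have hexp : Complex.exp (Complex.I * r * h) = -1 := by
    rcases lt_or_gt_of_ne hr' with h1 | h1
    · have : Complex.I * r * h = -(Real.pi * Complex.I) := by
        rw [hh, abs_of_neg h1]; push_cast
        have : (r : ℂ) ≠ 0 := by exact_mod_cast hr
        field_simp
      rw [this, Complex.exp_neg, Complex.exp_pi_mul_I]; norm_num
    · have : Complex.I * r * h = Real.pi * Complex.I := by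
        rw [hh, abs_of_pos h1]; push_cast
        have : (r : ℂ) ≠ 0 := by exact_mod_cast hr
        field_simp
      rw [this, Complex.exp_pi_mul_I]
  have hem : Measurable fun t : ℝ => Complex.exp (Complex.I * r * t) := by fun_prop
  have hΦh : Measurable fun t => Φ (t + h) := hΦ.comp (measurable_id.add_const h)
  have hi1 : Integrable (fun t : ℝ => Complex.exp (Complex.I * r * t) * Φ t) period :=
    integrable_of_bound (C := C) (hem.mul hΦ) fun t => by
      rw [norm_mul, norm_exp_int_mul, one_mul]; exact hC t
  have hi2 : Integrable (fun t : ℝ => Complex.exp (Complex.I * r * t) * Φ (t + h)) period :=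
    integrable_of_bound (C := C) (hem.mul hΦh) fun t => by
      rw [norm_mul, norm_exp_int_mul, one_mul]; exact hC _
  have hp : Function.Periodic (fun t : ℝ => Complex.exp (Complex.I * r * t) * Φ t)
      (2 * Real.pi) := fun t => by
    have e : Complex.I * r * ((t + 2 * Real.pi : ℝ) : ℂ)
        = Complex.I * r * t + r * (2 * Real.pi * Complex.I) := by push_cast; ring
    beta_reduce
    rw [hper t, e, Complex.exp_add, Complex.exp_int_mul_two_pi_mul_I, mul_one]
  have h1 := integral_period_add_complex hp h
  have h2 : ∀ t : ℝ, Complex.exp (Complex.I * r * ((t + h : ℝ) : ℂ)) * Φ (t + h)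
      = -(Complex.exp (Complex.I * r * t) * Φ (t + h)) := fun t => by
    have e : Complex.I * r * ((t + h : ℝ) : ℂ) = Complex.I * r * t + Complex.I * r * h := by
      push_cast; ring
    rw [e, Complex.exp_add, hexp]; ring
  simp_rw [h2] at h1
  rw [integral_neg] at h1
  have h3 : (2 : ℂ) * ∫ t, Complex.exp (Complex.I * r * t) * Φ t ∂period
      = ∫ t, Complex.exp (Complex.I * r * t) * (Φ t - Φ (t + h)) ∂period := by
    simp_rw [mul_sub]
    rw [integral_sub hi1 hi2, two_mul, sub_eq_add_neg, h1]
  have h4 : ‖(2 : ℂ) * ∫ t, Complex.exp (Complex.I * r * t) * Φ t ∂period‖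
      ≤ ∫ t, ‖Φ t - Φ (t + h)‖ ∂period := by
    rw [h3]
    refine (norm_integral_le_integral_norm _).trans (le_of_eq ?_)
    simp_rw [norm_mul, norm_exp_int_mul, one_mul]
  rw [norm_mul, Complex.norm_ofNat] at h4
  linarith

/-- A real trigonometric polynomial. -/
def trigPoly (d : ℕ) (a : ℕ → ℂ) (t : ℝ) : ℝ := (∑ k ∈ Finset.Ioc 0 d, a k * wave k t).re

lemma continuous_wave (k : ℕ) : Continuous (wave k) := by unfold wave; fun_prop

lemma continuous_trigPoly (d : ℕ) (a : ℕ → ℂ) : Continuous (trigPoly d a) :=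
  Complex.continuous_re.comp (continuous_finsetSum _ fun k _ =>
    continuous_const.mul (continuous_wave k))

lemma wave_eq_pow (k : ℕ) (t : ℝ) : wave k t = wave 1 t ^ k := by
  simp only [wave]; rw [← Complex.exp_nat_mul]; congr 1; push_cast; ring

/-- The level sets of a trigonometric polynomial are the zeros on the circle of a polynomial. -/
lemma exists_polynomial_trigPoly (d : ℕ) (a : ℕ → ℂ) (c : ℝ) : ∃ p : Polynomial ℂ,
    p.natDegree ≤ 2 * d ∧ ∀ t, trigPoly d a t = c ↔ p.eval (wave 1 t) = 0 := by
  -- On the unit circle conj z = 1/z, so z^d times twice the equation is a polynomial of degree at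
  -- most 2d.
  refine ⟨∑ k ∈ Finset.Ioc 0 d, (Polynomial.C (a k) * Polynomial.X ^ (d + k)
    + Polynomial.C ((starRingEnd ℂ) (a k)) * Polynomial.X ^ (d - k))
    - Polynomial.C ((2 * c : ℝ) : ℂ) * Polynomial.X ^ d, ?_, fun t => ?_⟩
  · refine (Polynomial.natDegree_sub_le _ _).trans (max_le ?_ ?_)
    · refine Polynomial.natDegree_sum_le_of_forall_le _ _ fun k hk => ?_
      rw [Finset.mem_Ioc] at hk
      refine (Polynomial.natDegree_add_le _ _).trans (max_le ?_ ?_)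
      · exact (Polynomial.natDegree_C_mul_X_pow_le _ _).trans (by omega)
      · exact (Polynomial.natDegree_C_mul_X_pow_le _ _).trans (by omega)
    · exact (Polynomial.natDegree_C_mul_X_pow_le _ _).trans (by omega)
  · have hz : wave 1 t ≠ 0 := wave_ne_zero 1 t
    have hzc : (starRingEnd ℂ) (wave 1 t) = (wave 1 t)⁻¹ := by
      rw [Complex.inv_def, Complex.normSq_eq_norm_sq, norm_wave]; simp
    have key : Polynomial.eval (wave 1 t) (∑ k ∈ Finset.Ioc 0 d, (Polynomial.C (a k)
        * Polynomial.X ^ (d + k) + Polynomial.C ((starRingEnd ℂ) (a k)) * Polynomial.X ^ (d - k))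
        - Polynomial.C ((2 * c : ℝ) : ℂ) * Polynomial.X ^ d)
        = wave 1 t ^ d * ((2 * (trigPoly d a t - c) : ℝ) : ℂ) := by
      have h1 : ((2 * trigPoly d a t : ℝ) : ℂ)
          = ∑ k ∈ Finset.Ioc 0 d, (a k * wave 1 t ^ k + (starRingEnd ℂ) (a k * wave 1 t ^ k)) := by
        have h0 : ∀ z : ℂ, ((2 * z.re : ℝ) : ℂ) = z + (starRingEnd ℂ) z := fun z =>
          (Complex.add_conj z).symm
        rw [Finset.sum_add_distrib, ← map_sum, trigPoly, h0]
        exact congrArg₂ (· + ·) (Finset.sum_congr rfl fun k _ => by rw [wave_eq_pow k])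
          (congrArg _ (Finset.sum_congr rfl fun k _ => by rw [wave_eq_pow k]))
      rw [Polynomial.eval_sub, Polynomial.eval_finsetSum, mul_sub, Complex.ofReal_sub, h1,
        mul_sub, Finset.mul_sum]
      congr 1
      · refine Finset.sum_congr rfl fun k hk => ?_
        rw [Finset.mem_Ioc] at hk
        simp only [Polynomial.eval_add, Polynomial.eval_mul, Polynomial.eval_C,
          Polynomial.eval_pow, Polynomial.eval_X, map_mul, map_pow, hzc]
        rw [pow_add, pow_sub₀ _ hz hk.2, inv_pow]
        ring
      · simp; ring
    rw [key, mul_eq_zero]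
    constructor
    · intro h; right; rw [h]; simp
    · rintro (h | h)
      · exact absurd h (pow_ne_zero _ hz)
      · have : 2 * (trigPoly d a t - c) = 0 := by exact_mod_cast h
        linarith

/-- The points where the constraint `trigPoly d a ≤ c` changes its truth value under a
translation by `h`. -/
def flips (d : ℕ) (a : ℕ → ℂ) (c h : ℝ) : Set ℝ :=
  {t | ¬ (trigPoly d a t ≤ c ↔ trigPoly d a (t + h) ≤ c)}

lemma measurableSet_flips (d : ℕ) (a : ℕ → ℂ) (c h : ℝ) : MeasurableSet (flips d a c h) := by
  have h1 : MeasurableSet {t | trigPoly d a t ≤ c} :=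
    (isClosed_le (continuous_trigPoly d a) continuous_const).measurableSet
  have h2 : MeasurableSet {t | trigPoly d a (t + h) ≤ c} :=
    (isClosed_le ((continuous_trigPoly d a).comp (continuous_add_const h))
      continuous_const).measurableSet
  exact (MeasurableSet.iff h1 h2).compl

/-- A change of truth value forces a solution of the level equation within distance h to the right.
There are at most 2d solutions on the circle, each with at most 3 relevant lifts to the line, hence
2d · 3 intervals of length h. -/
lemma volume_flips_le (d : ℕ) (a : ℕ → ℂ) (c : ℝ) {h : ℝ} (h0 : 0 ≤ h) (h1 : h ≤ 2 * Real.pi) :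
    period (flips d a c h) ≤ ENNReal.ofReal (6 * d * h) := by
  obtain ⟨p, hpd, hp⟩ := exists_polynomial_trigPoly d a c
  have hivt : ∀ t ∈ flips d a c h, ∃ ρ ∈ Set.Icc t (t + h), trigPoly d a ρ = c := by
    intro t ht
    have hc := (continuous_trigPoly d a).continuousOn (s := Set.Icc t (t + h))
    have hle : t ≤ t + h := by linarith
    by_cases h2 : trigPoly d a t ≤ c
    · have h3 : c < trigPoly d a (t + h) := by
        by_contra hcon
        exact ht ⟨fun _ => not_lt.1 hcon, fun _ => h2⟩
      obtain ⟨ρ, hρ, hρ'⟩ := intermediate_value_Icc hle hc ⟨h2, h3.le⟩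
      exact ⟨ρ, hρ, hρ'⟩
    · have h3 : trigPoly d a (t + h) ≤ c := by
        by_contra hcon
        exact ht ⟨fun h => absurd h h2, fun h => absurd h hcon⟩
      obtain ⟨ρ, hρ, hρ'⟩ := intermediate_value_Icc' hle hc ⟨h3, (not_le.1 h2).le⟩
      exact ⟨ρ, hρ, hρ'⟩
  -- The zero polynomial has no finite root set, but then the trigonometric polynomial is constantly
  -- c and nothing flips.
  by_cases hp0 : p = 0
  · have : flips d a c h = ∅ := by
      refine Set.eq_empty_iff_forall_notMem.2 fun t ht => ht ?_
      have h2 : ∀ t, trigPoly d a t = c := fun t => (hp t).2 (by rw [hp0]; simp)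
      rw [h2, h2]
    rw [this]; simp
  let Z := p.roots.toFinset
  have hcard : (Z.card : ℝ) ≤ 2 * d := by
    have : Z.card ≤ 2 * d :=
      (Multiset.toFinset_card_le _).trans ((Polynomial.card_roots' p).trans hpd)
    exact_mod_cast this
  -- The zero lies in (0, 4π] and the argument in (-π, π], so the number l of turns is 0, 1 or 2.
  let I : ℂ → ℕ → Set ℝ := fun z l =>
    Set.Icc (z.arg + 2 * Real.pi * l - h) (z.arg + 2 * Real.pi * l)
  have hpi := Real.pi_pos
  have hsub : flips d a c h ∩ Set.Ioc 0 (2 * Real.pi) ⊆ ⋃ z ∈ Z, ⋃ l ∈ Finset.range 3, I z l := by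
    rintro t ⟨ht, ht0, ht1⟩
    obtain ⟨ρ, ⟨hρ0, hρ1⟩, hρ⟩ := hivt t ht
    have hroot := (hp ρ).1 hρ
    have hzZ : wave 1 ρ ∈ Z := by
      rw [Multiset.mem_toFinset, Polynomial.mem_roots hp0]; exact hroot
    have harg : wave 1 ρ = wave 1 (wave 1 ρ).arg := by
      have h2 := Complex.norm_mul_exp_arg_mul_I (wave 1 ρ)
      rw [norm_wave, Complex.ofReal_one, one_mul] at h2
      conv_lhs => rw [← h2]
      rw [wave]; congr 1; push_cast; ring
    set z := wave 1 ρ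
    have h2 : Complex.exp (Complex.I * (1 : ℕ) * ρ) = Complex.exp (Complex.I * (1 : ℕ) * z.arg) :=
      harg
    obtain ⟨l, hl⟩ := Complex.exp_eq_exp_iff_exists_int.1 h2
    have hl' : ρ = z.arg + 2 * Real.pi * l := by
      have := congrArg Complex.im hl
      simpa [mul_comm, mul_assoc, mul_left_comm] using this
    have ha1 := Complex.neg_pi_lt_arg z
    have ha2 := Complex.arg_le_pi z
    have hl0 : (-1 : ℝ) < l := by
      by_contra hcon
      have : (l : ℝ) ≤ -1 := not_lt.1 hcon
      nlinarith
    have hl3 : (l : ℝ) < 3 := by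
      by_contra hcon
      have : (3 : ℝ) ≤ l := not_lt.1 hcon
      nlinarith
    have hl0' : 0 ≤ l := by
      have : (-1 : ℤ) < l := by exact_mod_cast hl0
      omega
    obtain ⟨n, rfl⟩ := Int.eq_ofNat_of_zero_le hl0'
    have hn : n < 3 := by exact_mod_cast hl3
    simp only [Set.mem_iUnion, I]
    refine ⟨z, hzZ, n, Finset.mem_range.2 hn, ?_, ?_⟩
    · push_cast at hl'; linarith
    · push_cast at hl'; linarith
  rw [period, Measure.restrict_apply (measurableSet_flips d a c h)]
  refine (measure_mono hsub).trans ((measure_biUnion_finset_le _ _).trans ?_)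
  have hI : ∀ z ∈ Z, volume (⋃ l ∈ Finset.range 3, I z l) ≤ ENNReal.ofReal (3 * h) := by
    intro z _
    refine (measure_biUnion_finset_le _ _).trans ?_
    have : ∀ l, volume (I z l) = ENNReal.ofReal h := fun l => by
      simp only [I, Real.volume_Icc]; congr 1; ring
    simp_rw [this]
    rw [Finset.sum_const, Finset.card_range, nsmul_eq_mul, ENNReal.ofReal_mul (by norm_num)]
    simp
  refine (Finset.sum_le_sum hI).trans ?_
  rw [Finset.sum_const, nsmul_eq_mul, ← ENNReal.ofReal_natCast, ← ENNReal.ofReal_mul (by positivity)]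
  refine ENNReal.ofReal_le_ofReal ?_
  nlinarith

end

/-! ### Freezing the high blocks while the low ones are rotated. -/

section

/-- The coordinates of the first `n` blocks are those of `x` rotated by `t`, the others those
of `z`. -/
def mix (n : ℕ) (t : ℝ) (x z : ℕ → ℂ) (k : ℕ) : ℂ := if k ≤ top n then rot t x k else z k

lemma wave_periodic (k : ℕ) (t : ℝ) : wave k (t + 2 * Real.pi) = wave k t := by
  have e : Complex.I * k * ((2 * Real.pi : ℝ) : ℂ) = (k : ℤ) * (2 * Real.pi * Complex.I) := by
    push_cast; ring
  have h : wave k (2 * Real.pi) = 1 := by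
    rw [wave, e, Complex.exp_int_mul_two_pi_mul_I]
  rw [wave_add, h, mul_one]

lemma mix_periodic (n : ℕ) (t : ℝ) (x z : ℕ → ℂ) : mix n (t + 2 * Real.pi) x z = mix n t x z := by
  funext k
  simp only [mix, rot, wave_periodic]

lemma measurable_mix (n : ℕ) (x : ℕ → ℂ) :
    Measurable fun p : ℝ × (ℕ → ℂ) => mix n p.1 x p.2 := by
  refine measurable_pi_iff.2 fun k => ?_
  simp only [mix, rot]
  split_ifs
  · exact ((measurable_wave k).comp measurable_fst).const_mul _
  · exact (measurable_pi_apply k).comp measurable_snd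

lemma mem_block_le_top {m k : ℕ} (h : k ∈ block (m + 1)) : top m < k ∧ k ≤ top (m + 1) := by
  rwa [block_eq, Finset.mem_Ioc] at h

lemma P_mix_of_le {n j : ℕ} (h1 : 1 ≤ j) (hj : j ≤ n) (t τ : ℝ) (x z : ℕ → ℂ) :
    P j τ (mix n t x z) = P j (τ + t) x := by
  rw [← P_rot]
  refine P_congr τ fun k hk => ?_
  obtain ⟨j, rfl⟩ := Nat.exists_eq_add_of_le' h1
  rw [mix, if_pos ((mem_block_le_top hk).2.trans (top_mono hj))]

lemma P_mix_of_lt {n j : ℕ} (hj : n < j) (t τ : ℝ) (x z : ℕ → ℂ) :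
    P j τ (mix n t x z) = P j τ z := by
  refine P_congr τ fun k hk => ?_
  obtain ⟨j, rfl⟩ := Nat.exists_eq_add_of_le' (show 1 ≤ j by omega)
  have := (mem_block_le_top hk).1
  rw [mix, if_neg (by have := top_mono (show n ≤ j by omega); omega)]

lemma update_mix {n m : ℕ} (hm : n ≤ m) (t : ℝ) (x z : ℕ → ℂ) (w : block (m + 1) → ℂ) :
    Function.updateFinset (mix n t x z) (block (m + 1)) w
      = mix n t x (Function.updateFinset z (block (m + 1)) w) := by
  funext k
  by_cases hk : k ∈ block (m + 1)
  · have := (mem_block_le_top hk).1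
    have h2 := top_mono hm
    have h3 : ¬ k ≤ top n := by omega
    simp [Function.updateFinset, mix, hk, h3]
  · simp [Function.updateFinset, mix, hk]

/-- The normalised squared modulus of the product over the blocks `n < j ≤ m`. -/
def highSq (n m : ℕ) (τ : ℝ) (z : ℕ → ℂ) : ℝ :=
  Real.exp (∑ j ∈ Finset.Ioc n m, (2 * (P j τ z).re - 2 * sigmaSq j))

lemma highSq_update {n m : ℕ} (hm : n ≤ m) (τ : ℝ) (z : ℕ → ℂ) (w : block (m + 1) → ℂ) :
    highSq n (m + 1) τ (Function.updateFinset z (block (m + 1)) w) = highSq n m τ z *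
      (Real.exp (2 * (waveSum (block (m + 1)) τ w).re) * Real.exp (-(2 * sigmaSq (m + 1)))) := by
  have h : ∑ j ∈ Finset.Ioc n m, (2 * (P j τ (Function.updateFinset z (block (m + 1)) w)).re
      - 2 * sigmaSq j) = ∑ j ∈ Finset.Ioc n m, (2 * (P j τ z).re - 2 * sigmaSq j) :=
    Finset.sum_congr rfl fun j hj => by
      rw [Finset.mem_Ioc] at hj
      rw [P_updateFinset_of_lt (by omega) (by omega)]
  rw [highSq, ← Finset.insert_Ioc_right_eq_Ioc_add_one hm, Finset.sum_insert (by simp), h,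
    P_updateFinset_self, highSq, ← Real.exp_add, ← Real.exp_add]
  congr 1; ring

lemma integrable_highSq_update {n m : ℕ} (hm : n ≤ m) (τ : ℝ) (z : ℕ → ℂ) :
    Integrable (fun v => highSq n (m + 1) τ (Function.updateFinset z (block (m + 1)) (toC v)))
      (stdGaussian (RealCoord (block (m + 1)))) := by
  simp_rw [highSq_update hm]
  exact ((integrable_exp_two_re_waveSum (m + 1) τ).mul_const _).const_mul _

lemma avg_highSq {n m : ℕ} (hm : n ≤ m) (τ : ℝ) (z : ℕ → ℂ) :
    ∫ v, highSq n (m + 1) τ (Function.updateFinset z (block (m + 1)) (toC v))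
      ∂(stdGaussian (RealCoord (block (m + 1)))) = highSq n m τ z := by
  simp_rw [highSq_update hm]
  rw [integral_const_mul, integral_mul_const, integral_exp_two_re_waveSum, ← Real.exp_add,
    add_neg_cancel, Real.exp_zero, mul_one]

variable {u : ℕ → ℝ} {σ : ℝ} {L : ℕ}

lemma exists_norm_corr_le {m : ℕ} (hm : m ≤ L) : ∃ C, ∀ t x, ‖corr u σ L m t x‖ ≤ C := by
  obtain ⟨C, hC⟩ := exists_theta_le u m
  refine ⟨C, fun t x => (norm_corr_le hm t x).trans ?_⟩
  linarith [hC t x, hC (t + σ) x]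

/-- A bound for the twisted integral after freezing the high blocks descends under averaging. -/
lemma norm_integral_corr_mix_le {n : ℕ} {x : ℕ → ℂ} {r : ℤ} {ε : ℝ}
    (hbase : ∀ z, ‖∫ t, Complex.exp (Complex.I * r * t) * corr u σ L L 0 (mix n t x z) ∂period‖
      ≤ ε * ((highSq n L 0 z + highSq n L σ z) / 2)) {m : ℕ} (hm : m ≤ L) (hn : n ≤ m)
    (z : ℕ → ℂ) :
    ‖∫ t, Complex.exp (Complex.I * r * t) * corr u σ L m 0 (mix n t x z) ∂period‖
      ≤ ε * ((highSq n m 0 z + highSq n m σ z) / 2) := by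
  induction hm using Nat.decreasingInduction generalizing z with
  | self => exact hbase z
  | of_succ m hm ih =>
    set γ := stdGaussian (RealCoord (block (m + 1)))
    obtain ⟨C, hC⟩ := exists_norm_corr_le (u := u) (σ := σ) (show m + 1 ≤ L from hm)
    let Uz : RealCoord (block (m + 1)) → ℕ → ℂ :=
      fun v => Function.updateFinset z (block (m + 1)) (toC v)
    let f : ℝ → RealCoord (block (m + 1)) → ℂ := fun t v =>
      Complex.exp (Complex.I * r * t) * corr u σ L (m + 1) 0 (mix n t x (Uz v))
    have hUz : Measurable Uz := measurable_updateFinset.comp measurable_toC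
    have hfm : Measurable (Function.uncurry f) := by
      have h1 : Measurable fun p : ℝ × RealCoord (block (m + 1)) => mix n p.1 x (Uz p.2) :=
        (measurable_mix n x).comp (measurable_fst.prodMk (hUz.comp measurable_snd))
      have h2 : Measurable fun p : ℝ × RealCoord (block (m + 1)) =>
          corr u σ L (m + 1) 0 (mix n p.1 x (Uz p.2)) :=
        (measurable_corr_right (show m + 1 ≤ L from hm) 0).comp h1
      have h3 : Measurable fun p : ℝ × RealCoord (block (m + 1)) =>
          Complex.exp (Complex.I * r * p.1) := by fun_prop
      exact h3.mul h2
    have hfb : ∀ t v, ‖f t v‖ ≤ C := fun t v => by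
      simp only [f]
      rw [norm_mul, norm_exp_int_mul, one_mul]; exact hC _ _
    have h1 : ∀ t : ℝ, Complex.exp (Complex.I * r * t) * corr u σ L m 0 (mix n t x z)
        = ∫ v, f t v ∂γ := fun t => by
      rw [corr_of_lt hm, avg, ← integral_const_mul]
      simp only [update_mix hn, f, Uz, γ]
    simp_rw [h1]
    have hint : Integrable (Function.uncurry f) (period.prod γ) :=
      integrable_of_bound (C := C) hfm fun p => hfb p.1 p.2
    -- The frozen coordinates do not depend on t, so the average over the block can be taken outside
    -- the integral over t and hence outside the modulus.
    rw [integral_integral_swap hint]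
    refine (norm_integral_le_integral_norm _).trans ?_
    have hih := fun v => ih (by omega) (Uz v)
    have hi1 := integrable_highSq_update hn 0 z
    have hi2 := integrable_highSq_update hn σ z
    refine (integral_mono_of_nonneg (Filter.Eventually.of_forall fun v => norm_nonneg _)
      (((integrable_fun_add hi1 hi2).div_const 2).const_mul ε)
      (Filter.Eventually.of_forall hih)).trans ?_
    rw [integral_const_mul, integral_div, integral_add hi1 hi2, avg_highSq hn, avg_highSq hn]

/-- Partial sums over the first `n` blocks. -/
def psum (n : ℕ) (t : ℝ) (x : ℕ → ℂ) : ℂ := ∑ j ∈ Finset.Icc 1 n, P j t x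

lemma psum_eq (n : ℕ) (t : ℝ) (x : ℕ → ℂ) :
    psum n t x = ∑ k ∈ Finset.Ioc 0 (top n), x k / (√k : ℝ) * wave k t := by
  rw [psum]; simp only [P]; rw [sum_Icc_block]

lemma re_psum_eq_trigPoly (n : ℕ) (t τ : ℝ) (x : ℕ → ℂ) :
    (psum n (τ + t) x).re = trigPoly (top n) (fun k => x k / (√k : ℝ) * wave k τ) t := by
  rw [psum_eq, trigPoly]
  congr 1
  exact Finset.sum_congr rfl fun k _ => by rw [wave_add]; ring

lemma walk_eq (m : ℕ) (t : ℝ) (x : ℕ → ℂ) : walk m t x = (psum m t x).re - V m := by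
  rw [walk, psum, V, Complex.re_sum, Finset.sum_sub_distrib]

lemma psum_mix_of_le {n j : ℕ} (hj : j ≤ n) (t τ : ℝ) (x z : ℕ → ℂ) :
    psum j τ (mix n t x z) = psum j (τ + t) x :=
  Finset.sum_congr rfl fun i hi => by
    rw [Finset.mem_Icc] at hi
    exact P_mix_of_le hi.1 (hi.2.trans hj) t τ x z

lemma psum_add_Ioc {n j : ℕ} (hj : n ≤ j) (τ : ℝ) (x : ℕ → ℂ) :
    psum j τ x = psum n τ x + ∑ i ∈ Finset.Ioc n j, P i τ x := by
  have h : ∀ m, Finset.Icc 1 m = Finset.Ioc 0 m := fun m => by ext; simp; omega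
  rw [psum, psum, h, h, Finset.sum_Ioc_consecutive _ (Nat.zero_le _) hj]

lemma psum_mix_of_ge {n j : ℕ} (hj : n ≤ j) (t τ : ℝ) (x z : ℕ → ℂ) :
    psum j τ (mix n t x z) = psum n (τ + t) x + ∑ i ∈ Finset.Ioc n j, P i τ z := by
  rw [psum_add_Ioc hj, psum_mix_of_le le_rfl]
  congr 1
  exact Finset.sum_congr rfl fun i hi => P_mix_of_lt (Finset.mem_Ioc.1 hi).1 t τ x z

/-- The blocks beyond n are frozen and contribute a constant, so the degree never exceeds `top n`,
even for the barrier constraints at late times j. -/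
lemma exists_trigPoly_walk_mix (n j : ℕ) (τ : ℝ) (x z : ℕ → ℂ) : ∃ d ≤ top n, ∃ a : ℕ → ℂ,
    ∃ c : ℝ, ∀ t, walk j τ (mix n t x z) = trigPoly d a t + c := by
  rcases le_total j n with h | h
  · exact ⟨top j, top_mono h, _, -V j, fun t => by
      rw [walk_eq, psum_mix_of_le h, re_psum_eq_trigPoly]; ring⟩
  · exact ⟨top n, le_rfl, _, (∑ i ∈ Finset.Ioc n j, P i τ z).re - V j, fun t => by
      rw [walk_eq, psum_mix_of_ge h, Complex.add_re, re_psum_eq_trigPoly]; ring⟩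

lemma V_add_Ioc {n j : ℕ} (hj : n ≤ j) : V j = V n + ∑ i ∈ Finset.Ioc n j, 2 * sigmaSq i := by
  have h : ∀ m, Finset.Icc 1 m = Finset.Ioc 0 m := fun m => by ext; simp; omega
  rw [V, V, h, h, Finset.sum_Ioc_consecutive _ (Nat.zero_le _) hj]

/-- The Lipschitz constant of the partial sum. -/
def lipC (n : ℕ) (x : ℕ → ℂ) : ℝ := ∑ k ∈ Finset.Ioc 0 (top n), ‖x k‖ * √k

lemma norm_wave_sub_le (k : ℕ) (t h : ℝ) : ‖wave k (t + h) - wave k t‖ ≤ k * |h| := by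
  have e : wave k (t + h) - wave k t = wave k t * (wave k h - 1) := by rw [wave_add]; ring
  rw [e, norm_mul, norm_wave, one_mul, wave]
  have e2 : Complex.I * k * h = Complex.I * ((k * h : ℝ) : ℂ) := by push_cast; ring
  rw [e2]
  refine (Real.norm_exp_I_mul_ofReal_sub_one_le).trans ?_
  rw [Real.norm_eq_abs, abs_mul, Nat.abs_cast]

lemma norm_psum_sub_le (n : ℕ) (t h : ℝ) (x : ℕ → ℂ) :
    ‖psum n (t + h) x - psum n t x‖ ≤ lipC n x * |h| := by
  rw [psum_eq, psum_eq, ← Finset.sum_sub_distrib, lipC, Finset.sum_mul]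
  refine (norm_sum_le _ _).trans (Finset.sum_le_sum fun k hk => ?_)
  rw [← mul_sub, norm_mul, norm_div, Complex.norm_real, Real.norm_of_nonneg (Real.sqrt_nonneg _)]
  have hk0 : (0 : ℝ) < k := by exact_mod_cast (Finset.mem_Ioc.1 hk).1
  have h1 := norm_wave_sub_le k t h
  have h2 : (k : ℝ) = √k * √k := (Real.mul_self_sqrt hk0.le).symm
  have h3 : 0 < √(k : ℝ) := Real.sqrt_pos.2 hk0
  calc ‖x k‖ / √k * ‖wave k (t + h) - wave k t‖ ≤ ‖x k‖ / √k * (k * |h|) := by gcongr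
    _ = ‖x k‖ / √k * (√k * √k * |h|) := by rw [← h2]
    _ = ‖x k‖ * √k * |h| := by field_simp

end

/-! ### Smallness of the twisted integral after averaging the high blocks. -/

section

variable {u : ℕ → ℝ} {σ : ℝ} {L : ℕ}

/-- The part of the product coming from the frozen high blocks. -/
def frozen (n L : ℕ) (τ : ℝ) (z : ℕ → ℂ) : ℂ :=
  Complex.exp (∑ i ∈ Finset.Ioc n L, P i τ z - ((V L / 2 : ℝ) : ℂ))

lemma gpart_mix {n : ℕ} (hn : n ≤ L) (t τ : ℝ) (x z : ℕ → ℂ)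
    (h : mix n t x z ∈ barrier u L τ) :
    gpart u L τ (mix n t x z) = Complex.exp (psum n (τ + t) x) * frozen n L τ z := by
  have := psum_mix_of_ge hn t τ x z
  rw [psum] at this
  rw [gpart, Set.indicator_of_mem h, this, frozen, ← Complex.exp_add]
  congr 1; ring

/-- The two sides differ by the factor e^{-V n} ≤ 1. The right side is the one with mean one. -/
lemma norm_frozen_sq_le {n : ℕ} (hn : n ≤ L) (τ : ℝ) (z : ℕ → ℂ) :
    ‖frozen n L τ z‖ ^ 2 ≤ highSq n L τ z := by
  rw [frozen, Complex.norm_exp, ← Real.exp_nat_mul, highSq]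
  refine Real.exp_le_exp.2 ?_
  have h1 := V_add_Ioc hn
  have h2 := V_nonneg n
  simp only [Complex.sub_re, Complex.re_sum, Complex.ofReal_re, Finset.sum_sub_distrib,
    ← Finset.mul_sum] at h1 ⊢
  push_cast
  linarith

/-- The barrier constraint at time n itself bounds the low product, which is why n must be at least
1. -/
lemma norm_exp_psum_le {n : ℕ} (hn1 : 1 ≤ n) (hn : n ≤ L) (t τ : ℝ) (x z : ℕ → ℂ)
    (h : mix n t x z ∈ barrier u L τ) :
    ‖Complex.exp (psum n (τ + t) x)‖ ≤ Real.exp (V n + u n) := by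
  rw [Complex.norm_exp]
  refine Real.exp_le_exp.2 ?_
  have h1 := h n (Finset.mem_Icc.2 ⟨hn1, hn⟩)
  rw [walk_eq, psum_mix_of_le le_rfl] at h1
  linarith

lemma norm_exp_sub_exp_le {z w : ℂ} {b : ℝ} (hz : ‖Complex.exp z‖ ≤ b) (hd : ‖w - z‖ ≤ 1) :
    ‖Complex.exp z - Complex.exp w‖ ≤ b * (2 * ‖w - z‖) := by
  have e : Complex.exp z - Complex.exp w = -(Complex.exp z * (Complex.exp (w - z) - 1)) := by
    rw [mul_sub, ← Complex.exp_add]; ring_nf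
  rw [e, norm_neg, norm_mul]
  exact mul_le_mul hz (Complex.norm_exp_sub_one_le hd) (norm_nonneg _) ((norm_nonneg _).trans hz)

/-- Points where the barrier event of the mixed configuration changes under translation. -/
def barrierFlips (u : ℕ → ℝ) (L n : ℕ) (τ h : ℝ) (x z : ℕ → ℂ) : Set ℝ :=
  ⋃ j ∈ Finset.Icc 1 L, {t | ¬ (walk j τ (mix n t x z) ≤ u j ↔ walk j τ (mix n (t + h) x z) ≤ u j)}

lemma mem_barrier_iff_of_notMem {n : ℕ} {τ h t : ℝ} {x z : ℕ → ℂ}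
    (ht : t ∉ barrierFlips u L n τ h x z) :
    mix n t x z ∈ barrier u L τ ↔ mix n (t + h) x z ∈ barrier u L τ := by
  refine forall₂_congr fun j hj => ?_
  by_contra hcon
  exact ht (Set.mem_biUnion hj hcon)

lemma barrierFlips_spec (u : ℕ → ℝ) (L n : ℕ) (τ : ℝ) {h : ℝ} (h0 : 0 ≤ h)
    (h1 : h ≤ 2 * Real.pi) (x z : ℕ → ℂ) :
    MeasurableSet (barrierFlips u L n τ h x z) ∧
      period (barrierFlips u L n τ h x z) ≤ ENNReal.ofReal (L * (6 * top n * h)) := by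
  have key : ∀ j, ∃ d ≤ top n, ∃ a c, {t | ¬ (walk j τ (mix n t x z) ≤ u j ↔
      walk j τ (mix n (t + h) x z) ≤ u j)} = flips d a c h := fun j => by
    obtain ⟨d, hd, a, c, hc⟩ := exists_trigPoly_walk_mix n j τ x z
    refine ⟨d, hd, a, u j - c, ?_⟩
    simp only [flips, hc, le_sub_iff_add_le]
  choose d hd a c hdac using key
  have e : barrierFlips u L n τ h x z = ⋃ j ∈ Finset.Icc 1 L, flips (d j) (a j) (c j) h := by
    simp only [barrierFlips, hdac]
  rw [e]
  refine ⟨Finset.measurableSet_biUnion _ fun j _ => measurableSet_flips _ _ _ _, ?_⟩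
  refine (measure_biUnion_finset_le _ _).trans ?_
  have hj : ∀ j ∈ Finset.Icc 1 L, period (flips (d j) (a j) (c j) h)
      ≤ ENNReal.ofReal (6 * top n * h) := fun j _ => by
    refine (volume_flips_le _ _ _ h0 h1).trans (ENNReal.ofReal_le_ofReal ?_)
    have : (d j : ℝ) ≤ top n := by exact_mod_cast hd j
    gcongr
  refine (Finset.sum_le_sum hj).trans ?_
  rw [Finset.sum_const, Nat.card_Icc, nsmul_eq_mul, ← ENNReal.ofReal_natCast,
    ← ENNReal.ofReal_mul (by positivity)]
  simp

/-- With the high blocks frozen, the integrand is a constant times e^{q(t)}, cut off by the barrier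
at two points. A shift by half a period changes it by twice its maximum on the small set where a
constraint flips. Elsewhere the change is of Lipschitz size, with `lipC n x` bounding the derivative
of each partial sum. -/
lemma norm_integral_corr_base_le {n : ℕ} (hn1 : 1 ≤ n) (hn : n ≤ L) {x : ℕ → ℂ} {r : ℤ}
    (hr : r ≠ 0) (hD : 2 * lipC n x * (Real.pi / |(r : ℝ)|) ≤ 1) (z : ℕ → ℂ) :
    ‖∫ t, Complex.exp (Complex.I * r * t) * corr u σ L L 0 (mix n t x z) ∂period‖
      ≤ Real.exp (2 * (V n + u n)) * (Real.pi / |(r : ℝ)|)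
        * (12 * L * top n + 4 * Real.pi * lipC n x)
        * ((highSq n L 0 z + highSq n L σ z) / 2) := by
  set h := Real.pi / |(r : ℝ)| with hh
  have hr1 : 1 ≤ |(r : ℝ)| := by exact_mod_cast Int.one_le_abs hr
  have hpi := Real.pi_pos
  have h0 : 0 ≤ h := by positivity
  have h1 : h ≤ 2 * Real.pi := by
    rw [hh, div_le_iff₀ (by linarith)]; nlinarith
  set D := lipC n x
  have hD0 : 0 ≤ D := Finset.sum_nonneg fun k _ => by positivity
  set Φ : ℝ → ℂ := fun t => corr u σ L L 0 (mix n t x z) with hΦ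
  set c := frozen n L 0 z * (starRingEnd ℂ) (frozen n L σ z)
  set b := Real.exp (2 * (V n + u n))
  set q : ℝ → ℂ := fun t => psum n (0 + t) x + (starRingEnd ℂ) (psum n (σ + t) x)
  have hb0 : 0 < b := Real.exp_pos _
  have hin : ∀ t, mix n t x z ∈ barrier u L 0 → mix n t x z ∈ barrier u L σ →
      Φ t = Complex.exp (q t) * c ∧ ‖Complex.exp (q t)‖ ≤ b := fun t ha hb => by
    constructor
    · simp only [hΦ, corr_self, zero_add]
      rw [gpart_mix hn t 0 x z ha, gpart_mix hn t σ x z hb, map_mul, ← Complex.exp_conj]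
      simp only [q, c, Complex.exp_add]; ring
    · simp only [q]
      rw [Complex.exp_add, norm_mul, Complex.exp_conj, RCLike.norm_conj]
      have := mul_le_mul (norm_exp_psum_le hn1 hn t 0 x z ha) (norm_exp_psum_le hn1 hn t σ x z hb)
        (norm_nonneg _) (Real.exp_pos _).le
      refine this.trans (le_of_eq ?_)
      rw [← Real.exp_add]; congr 1; ring
  have hout : ∀ t, ¬ (mix n t x z ∈ barrier u L 0 ∧ mix n t x z ∈ barrier u L σ) → Φ t = 0 :=
    fun t ht => by
    simp only [hΦ, corr_self, zero_add]
    by_cases ha : mix n t x z ∈ barrier u L 0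
    · have hb : mix n t x z ∉ barrier u L σ := fun hb => ht ⟨ha, hb⟩
      rw [gpart, gpart, Set.indicator_of_notMem hb]; simp
    · rw [gpart, Set.indicator_of_notMem ha]; simp
  have hbd : ∀ t, ‖Φ t‖ ≤ b * ‖c‖ := fun t => by
    by_cases ht : mix n t x z ∈ barrier u L 0 ∧ mix n t x z ∈ barrier u L σ
    · obtain ⟨e1, e2⟩ := hin t ht.1 ht.2
      rw [e1, norm_mul]; gcongr
    · rw [hout t ht, norm_zero]; positivity
  set S := barrierFlips u L n 0 h x z ∪ barrierFlips u L n σ h x z with hS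
  obtain ⟨hm1, hv1⟩ := barrierFlips_spec u L n 0 h0 h1 x z
  obtain ⟨hm2, hv2⟩ := barrierFlips_spec u L n σ h0 h1 x z
  have hSm : MeasurableSet S := hm1.union hm2
  have hSv : (period).real S ≤ 2 * (L * (6 * top n * h)) := by
    have h2 : period S ≤ ENNReal.ofReal (2 * (L * (6 * top n * h))) := by
      refine (measure_union_le _ _).trans ((add_le_add hv1 hv2).trans ?_)
      rw [← ENNReal.ofReal_add (by positivity) (by positivity)]
      exact ENNReal.ofReal_le_ofReal (by linarith)
    exact ENNReal.toReal_le_of_le_ofReal (by positivity) h2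
  have hqd : ∀ t, ‖q (t + h) - q t‖ ≤ 2 * D * h := fun t => by
    have e : q (t + h) - q t = (psum n (0 + t + h) x - psum n (0 + t) x)
        + (starRingEnd ℂ) (psum n (σ + t + h) x - psum n (σ + t) x) := by
      simp only [q, map_sub, ← add_assoc]; ring
    rw [e]
    refine (norm_add_le _ _).trans ?_
    rw [RCLike.norm_conj]
    have h3 := norm_psum_sub_le n (0 + t) h x
    have h4 := norm_psum_sub_le n (σ + t) h x
    rw [abs_of_nonneg h0] at h3 h4
    linarith
  have hpt : ∀ t, ‖Φ t - Φ (t + h)‖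
      ≤ S.indicator (fun _ => 2 * (b * ‖c‖)) t + b * (2 * (2 * D * h)) * ‖c‖ := fun t => by
    by_cases ht : t ∈ S
    · rw [Set.indicator_of_mem ht]
      have h3 := norm_sub_le (Φ t) (Φ (t + h))
      have h4 : 0 ≤ b * (2 * (2 * D * h)) * ‖c‖ := by positivity
      linarith [hbd t, hbd (t + h)]
    · rw [Set.indicator_of_notMem ht, zero_add]
      have i1 := mem_barrier_iff_of_notMem (u := u) (L := L) fun h' => ht (Or.inl h')
      have i2 := mem_barrier_iff_of_notMem (u := u) (L := L) fun h' => ht (Or.inr h')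
      by_cases hA : mix n t x z ∈ barrier u L 0 ∧ mix n t x z ∈ barrier u L σ
      · obtain ⟨e1, e2⟩ := hin t hA.1 hA.2
        obtain ⟨e3, -⟩ := hin (t + h) (i1.1 hA.1) (i2.1 hA.2)
        rw [e1, e3, ← sub_mul, norm_mul]
        have h5 := norm_exp_sub_exp_le e2 ((hqd t).trans hD)
        have h6 := hqd t
        refine mul_le_mul_of_nonneg_right (h5.trans ?_) (norm_nonneg _)
        gcongr
      · rw [hout t hA, hout (t + h) fun h' => hA ⟨i1.2 h'.1, i2.2 h'.2⟩]
        simp only [sub_zero, norm_zero]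
        positivity
  have hΦm : Measurable Φ := by
    have h3 : Measurable fun t => mix n t x z :=
      (measurable_mix n x).comp (measurable_id.prodMk measurable_const)
    exact (measurable_corr_right le_rfl 0).comp h3
  have hper : Function.Periodic Φ (2 * Real.pi) := fun t => by
    simp only [hΦ, mix_periodic]
  have hosc := norm_integral_osc_le hΦm hbd hper hr
  rw [← hh] at hosc
  refine hosc.trans ?_
  have hi1 : Integrable (S.indicator fun _ => 2 * (b * ‖c‖)) period :=
    (integrable_const _).indicator hSm
  have hint := integral_mono_of_nonneg (μ := period)
    (Filter.Eventually.of_forall fun t => norm_nonneg (Φ t - Φ (t + h)))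
    (integrable_fun_add hi1 (integrable_const _)) (Filter.Eventually.of_forall hpt)
  rw [integral_add hi1 (integrable_const _), integral_indicator_const _ hSm, integral_const,
    period_real_univ, smul_eq_mul, smul_eq_mul] at hint
  have hc : ‖c‖ ≤ (highSq n L 0 z + highSq n L σ z) / 2 := by
    have h3 := norm_frozen_sq_le hn 0 z
    have h4 := norm_frozen_sq_le hn σ z
    simp only [c]
    rw [norm_mul, RCLike.norm_conj]
    nlinarith [sq_nonneg (‖frozen n L 0 z‖ - ‖frozen n L σ z‖)]
  have h5 : (period).real S * (2 * (b * ‖c‖)) ≤ 2 * (L * (6 * top n * h)) * (2 * (b * ‖c‖)) := by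
    gcongr
  calc 1 / 2 * ∫ t, ‖Φ t - Φ (t + h)‖ ∂period
      ≤ b * h * (12 * L * top n + 4 * Real.pi * D) * ‖c‖ := by nlinarith
    _ ≤ _ := by gcongr

/-- The average over the high blocks of the twisted integral is small when the low coordinates
are bounded. -/
lemma norm_integral_corr_low_le {n : ℕ} (hn1 : 1 ≤ n) (hn : n ≤ L) {x : ℕ → ℂ} {r : ℤ}
    (hr : r ≠ 0) (hD : 2 * lipC n x * (Real.pi / |(r : ℝ)|) ≤ 1) :
    ‖∫ t, Complex.exp (Complex.I * r * t) * corr u σ L n t x ∂period‖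
      ≤ Real.exp (2 * (V n + u n)) * (Real.pi / |(r : ℝ)|)
        * (12 * L * top n + 4 * Real.pi * lipC n x) := by
  have h := norm_integral_corr_mix_le (u := u) (σ := σ)
    (fun z => norm_integral_corr_base_le hn1 hn hr hD z) hn le_rfl x
  have h1 : ∀ τ, highSq n n τ x = 1 := fun τ => by simp [highSq]
  rw [h1, h1] at h
  -- At level n the correlation ignores the coordinates beyond the low blocks, so any frozen
  -- configuration, here x itself, may be inserted.
  have h2 : ∀ t : ℝ, corr u σ L n 0 (mix n t x x) = corr u σ L n t x := fun t => by
    have h3 := corr_rot (u := u) (σ := σ) hn 0 t x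
    rw [zero_add] at h3
    rw [h3]
    refine corr_congr hn (fun j hj => ?_) fun j hj => ?_
    all_goals
      rw [Finset.mem_Icc] at hj
      rw [P_mix_of_le hj.1 hj.2, P_rot]
  simp_rw [h2] at h
  linarith

end

/-! ### From the random sequence to the product measure. -/

section

variable {Ω : Type*} [MeasurableSpace Ω] {μ : Measure Ω} [IsProbabilityMeasure μ]
  {X : ℕ → Ω → ℂ}

lemma map_eq_stdComplex (hX : IsStdComplexGaussianSeq μ X) {k : ℕ} (hk : 1 ≤ k) :
    μ.map (X k) = stdComplex := by
  have hm := hX.measurable k hk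
  have hre : Measurable fun ω => (X k ω).re := Complex.measurable_re.comp hm
  have him : Measurable fun ω => (X k ω).im := Complex.measurable_im.comp hm
  have h := (indepFun_iff_map_prod_eq_prod_map_map hre.aemeasurable him.aemeasurable).1
    (hX.indep_re_im k hk)
  rw [hX.law_re k hk, hX.law_im k hk] at h
  rw [stdComplex, ← h, Measure.map_map measurable_complex_mk (hre.prodMk him)]
  rfl

/-- The coordinates of the first `L` blocks, completed by zeros. -/
def coords (X : ℕ → Ω → ℂ) (L : ℕ) (ω : Ω) : ℕ → ℂ :=
  Function.updateFinset 0 (Finset.Ioc 0 (top L)) (fun k => X k ω)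

lemma coords_apply {L k : ℕ} (hk : k ∈ Finset.Ioc 0 (top L)) (ω : Ω) :
    coords X L ω k = X k ω := by
  rw [coords, Function.updateFinset, dif_pos hk]

lemma measurable_restrict_coords (hX : IsStdComplexGaussianSeq μ X) (L : ℕ) :
    Measurable fun ω => fun k : Finset.Ioc 0 (top L) => X k ω :=
  measurable_pi_iff.2 fun k => hX.measurable k (Finset.mem_Ioc.1 k.2).1

lemma measurable_coords (hX : IsStdComplexGaussianSeq μ X) (L : ℕ) : Measurable (coords X L) :=
  measurable_updateFinset.comp (measurable_restrict_coords hX L)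

lemma map_restrict_coords (hX : IsStdComplexGaussianSeq μ X) (L : ℕ) :
    μ.map (fun ω => fun k : Finset.Ioc 0 (top L) => X k ω)
      = Measure.pi fun _ : Finset.Ioc 0 (top L) => stdComplex := by
  have hpos : ∀ k : Finset.Ioc 0 (top L), 0 < (k : ℕ) := fun k => (Finset.mem_Ioc.1 k.2).1
  have hinj : Function.Injective fun k : Finset.Ioc 0 (top L) => (⟨k, hpos k⟩ : ℕ+) :=
    fun a b h => Subtype.ext (congrArg PNat.val h)
  have hi := hX.indep.precomp hinj
  have h := (iIndepFun_iff_map_fun_eq_pi_map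
    (fun k => (hX.measurable _ (hpos k)).aemeasurable)).1 hi
  refine h.trans ?_
  congr 1
  funext k
  exact map_eq_stdComplex hX (hpos k)

lemma lintegral_coords (hX : IsStdComplexGaussianSeq μ X) (L : ℕ) {f : (ℕ → ℂ) → ENNReal}
    (hf : Measurable f) :
    ∫⁻ ω, f (coords X L ω) ∂μ = gmarg (Finset.Ioc 0 (top L)) f 0 := by
  have hm : Measurable fun y : Finset.Ioc 0 (top L) → ℂ =>
      f (Function.updateFinset 0 (Finset.Ioc 0 (top L)) y) := hf.comp measurable_updateFinset
  rw [gmarg, lmarginal, ← map_restrict_coords hX L,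
    lintegral_map hm (measurable_restrict_coords hX L)]
  rfl

lemma P_coords {L j : ℕ} (h1 : 1 ≤ j) (hj : j ≤ L) (t : ℝ) (ω : Ω) :
    P j t (coords X L ω) = P j t (fun k => X k ω) := by
  obtain ⟨j, rfl⟩ := Nat.exists_eq_add_of_le' h1
  refine P_congr t fun k hk => coords_apply ?_ ω
  have h2 := mem_block_le_top hk
  have h3 := top_mono hj
  exact Finset.mem_Ioc.2 ⟨by omega, by omega⟩

lemma walk_coords {L j : ℕ} (hj : j ≤ L) (t : ℝ) (ω : Ω) :
    walk j t (coords X L ω) = ∑ m ∈ Finset.Icc 1 j, (Z X t m ω - 2 * sigmaSq m) := by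
  refine Finset.sum_congr rfl fun m hm => ?_
  rw [Finset.mem_Icc] at hm
  rw [P_coords hm.1 (hm.2.trans hj)]
  congr 1
  rw [P, Z, Complex.re_sum]
  refine Finset.sum_congr rfl fun k _ => ?_
  rw [wave, ← Complex.div_ofReal_re]
  congr 1; ring

/-- The barrier of the model. -/
def barr (q : ℝ) (L j : ℕ) : ℝ := if (1 / 100 : ℝ) * L ≤ j then -2000 * q else 12 * q

/-- Since log log N ≥ 0, the lower barrier implies the upper one, so the two conditions merge into a
single piecewise barrier. Positivity of L rules out j = 0 in the range of the lower barrier. -/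
lemma mem_eventA_iff {N K : ℝ} {L : ℕ} (hL : Real.log K = L) (hL0 : 0 < L)
    (hq : 0 ≤ Real.log (Real.log N)) (t : ℝ) (ω : Ω) :
    ω ∈ eventA X N K t ↔ coords X L ω ∈ barrier (barr (Real.log (Real.log N)) L) L t := by
  set q := Real.log (Real.log N)
  have hL0' : (0 : ℝ) < L := by exact_mod_cast hL0
  simp only [eventA, eventD, barrier, Set.mem_inter_iff, Set.mem_ofPred_eq, hL]
  constructor
  · rintro ⟨h1, h2⟩ j hj
    rw [Finset.mem_Icc] at hj
    have hjL : (j : ℝ) ≤ L := by exact_mod_cast hj.2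
    rw [walk_coords hj.2, barr]
    split_ifs with hc
    · exact h1 j hc hjL
    · exact h2 j hj.1 hjL
  · intro h
    constructor
    · intro j hc hjL
      have hjL' : j ≤ L := by exact_mod_cast hjL
      have hj0 : 1 ≤ j := by
        by_contra hcon
        have : j = 0 := by omega
        rw [this] at hc
        push_cast at hc
        linarith
      have := h j (Finset.mem_Icc.2 ⟨hj0, hjL'⟩)
      rwa [walk_coords hjL', barr, if_pos hc] at this
    · intro j hj0 hjL
      have hjL' : j ≤ L := by exact_mod_cast hjL
      have := h j (Finset.mem_Icc.2 ⟨hj0, hjL'⟩)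
      rw [walk_coords hjL', barr] at this
      refine this.trans ?_
      split_ifs <;> linarith

lemma F_eq {K : ℝ} {L : ℕ} (hK : 0 < K) (hL : Real.log K = L) (hL0 : 0 < L) (t : ℝ) (ω : Ω) :
    F X K (Complex.exp (Complex.I * t)) ω = Complex.exp (psum L t (coords X L ω)) := by
  have hKL : K = Real.exp L := by rw [← hL, Real.exp_log hK]
  have htop : top L = ⌊K⌋₊ := by rw [top, if_neg hL0.ne', hKL]
  rw [F, psum_eq, htop]
  congr 1
  have : Finset.Icc 1 ⌊K⌋₊ = Finset.Ioc 0 ⌊K⌋₊ := by ext; simp; omega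
  rw [this]
  refine Finset.sum_congr rfl fun k hk => ?_
  rw [coords_apply (htop ▸ hk), wave, ← Complex.exp_nat_mul]
  congr 2; ring

lemma restrictedF_eq {N K : ℝ} {L : ℕ} (hK : 0 < K) (hL : Real.log K = L) (hL0 : 0 < L)
    (hq : 0 ≤ Real.log (Real.log N)) (t : ℝ) (ω : Ω) :
    restrictedF X N K t ω = (Real.exp (V L / 2) : ℝ)
      * gpart (barr (Real.log (Real.log N)) L) L t (coords X L ω) := by
  rw [restrictedF, gpart]
  by_cases h : ω ∈ eventA X N K t
  · rw [Set.indicator_of_mem h, Set.indicator_of_mem ((mem_eventA_iff hL hL0 hq t ω).1 h),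
      F_eq hK hL hL0, Complex.ofReal_exp, ← Complex.exp_add, psum]
    congr 1; push_cast; ring
  · rw [Set.indicator_of_notMem h,
      Set.indicator_of_notMem fun h' => h ((mem_eventA_iff hL hL0 hq t ω).2 h'), mul_zero]

lemma norm_restrictedF_le (X : ℕ → Ω → ℂ) (N K t : ℝ) (ω : Ω) :
    ‖restrictedF X N K t ω‖ ≤ ‖F X K (Complex.exp (Complex.I * t)) ω‖ := by
  rw [restrictedF]
  exact norm_indicator_le_norm_self (fun ω => F X K (Complex.exp (Complex.I * t)) ω) ω

end

/-! ### Geometry of the near-diagonal strip and bounds for the kernel. -/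

lemma norm_addCircle_eq {s : ℝ} (h : |s| ≤ Real.pi) : ‖(s : AddCircle (2 * Real.pi))‖ = |s| := by
  have hp : (2 * Real.pi) ≠ 0 := by positivity
  have hpi := Real.pi_pos
  rw [AddCircle.norm_coe_eq_abs_iff _ hp, abs_of_pos (show 0 < 2 * Real.pi by linarith)]
  linarith

lemma integral_period_eq_symm {f : ℝ → ℂ} (hf : Function.Periodic f (2 * Real.pi)) :
    ∫ t, f t ∂period = ∫ t in Set.Ioc (-Real.pi) Real.pi, f t := by
  have hpi := Real.pi_pos
  rw [period, ← intervalIntegral.integral_of_le (by positivity),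
    ← intervalIntegral.integral_of_le (by linarith)]
  have := hf.intervalIntegral_add_eq 0 (-Real.pi)
  rw [zero_add] at this
  rw [this]
  congr 1; ring

/-- The width of the near-diagonal region. -/
def width (N : ℝ) : ℝ := Real.log N ^ 100 / N

/-- For fixed t the second variable is translated to a period centred at t. As the width is below π,
the circular neighbourhood becomes a single interval of shifts, including the pairs that wrap around
the ends of the square. -/
lemma integral_nearDiagonal {N : ℝ} (h1 : width N < Real.pi)
    {f : ℝ → ℝ → ℂ} (hf : Measurable (Function.uncurry f)) {C : ℝ} (hC : ∀ t s, ‖f t s‖ ≤ C)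
    (hper : ∀ t s, f t (s + 2 * Real.pi) = f t s) :
    ∫ p in nearDiagonal N, f p.1 p.2
      = ∫ t, (∫ s in Set.Icc (-width N) (width N), f t (t + s)) ∂period := by
  have hpi := Real.pi_pos
  let D : Set (ℝ × ℝ) := {p | ‖((p.2 - p.1 : ℝ) : AddCircle (2 * Real.pi))‖ ≤ width N}
  have hD : MeasurableSet D := by
    have : Continuous fun p : ℝ × ℝ => ‖((p.2 - p.1 : ℝ) : AddCircle (2 * Real.pi))‖ :=
      ((AddCircle.continuous_mk' (2 * Real.pi)).comp (continuous_snd.sub continuous_fst)).norm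
    exact (isClosed_le this continuous_const).measurableSet
  have e1 : nearDiagonal N = (Set.Icc 0 (2 * Real.pi) ×ˢ Set.Icc 0 (2 * Real.pi)) ∩ D := by
    ext p; simp only [nearDiagonal, D, width, Set.mem_inter_iff, Set.mem_prod, Set.mem_ofPred_eq,
      and_assoc]
  have hg : Measurable (D.indicator fun p : ℝ × ℝ => f p.1 p.2) := Measurable.indicator hf hD
  rw [e1, ← setIntegral_indicator hD, Measure.volume_eq_prod, ← Measure.prod_restrict,
    ← restrict_Ioc_eq_restrict_Icc, integral_prod]
  · refine integral_congr_ae (Filter.Eventually.of_forall fun t => ?_)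
    beta_reduce
    let g : ℝ → ℂ := fun s => D.indicator (fun p : ℝ × ℝ => f p.1 p.2) (t, s)
    have hgper : Function.Periodic g (2 * Real.pi) := fun s => by
      have : (t, s + 2 * Real.pi) ∈ D ↔ (t, s) ∈ D := by
        simp only [D, Set.mem_ofPred_eq]
        rw [show s + 2 * Real.pi - t = (s - t) + 2 * Real.pi by ring, AddCircle.coe_add_period]
      simp only [g, Set.indicator, this, hper]
    change ∫ s, g s ∂period = _
    rw [← integral_period_add_complex hgper t, integral_period_eq_symm
      (f := fun s => g (s + t)) fun s => by
        beta_reduce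
        rw [show s + 2 * Real.pi + t = (s + t) + 2 * Real.pi by ring, hgper]]
    have e2 : ∀ s ∈ Set.Ioc (-Real.pi) Real.pi, g (s + t)
        = (Set.Icc (-width N) (width N)).indicator (fun s => f t (t + s)) s := fun s hs => by
      have h2 : (t, s + t) ∈ D ↔ s ∈ Set.Icc (-width N) (width N) := by
        simp only [D, Set.mem_ofPred_eq, add_sub_cancel_right]
        rw [norm_addCircle_eq (abs_le.2 ⟨hs.1.le, hs.2⟩), abs_le, Set.mem_Icc]
      simp only [g]
      by_cases h3 : s ∈ Set.Icc (-width N) (width N)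
      · rw [Set.indicator_of_mem h3, Set.indicator_of_mem (h2.2 h3), add_comm]
      · rw [Set.indicator_of_notMem h3, Set.indicator_of_notMem fun h => h3 (h2.1 h)]
    rw [setIntegral_congr_fun measurableSet_Ioc e2, setIntegral_indicator measurableSet_Icc]
    congr 2
    refine Set.inter_eq_right.2 fun s hs => ⟨by linarith [hs.1], by linarith [hs.2]⟩
  · refine integrable_of_bound (C := C) hg fun p => ?_
    exact (norm_indicator_le_norm_self _ _).trans (hC _ _)

lemma kernel_periodic (N s : ℝ) : kernel N (s + 2 * Real.pi) = kernel N s := by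
  refine Finset.sum_congr rfl fun k _ => ?_
  have h := wave_periodic k s
  simp only [wave] at h
  rw [mul_right_comm, h, mul_right_comm]

lemma measurable_kernel (N : ℝ) : Measurable (kernel N) := by unfold kernel; fun_prop

lemma kernel_norm_le_sum (N s : ℝ) :
    ‖kernel N s‖ ≤ ∑ k ∈ Finset.Ioc ⌊N⌋₊ ⌊4 * N / 3⌋₊, (1 : ℝ) / k := by
  refine (norm_sum_le _ _).trans (Finset.sum_le_sum fun k _ => ?_)
  have h := norm_wave k s
  rw [wave] at h
  rw [norm_div, mul_right_comm, h, Complex.norm_natCast]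

/-- The near-diagonal integral as an average over shifts of twisted correlations. -/
lemma integral_nearDiagonal_eq {N : ℝ} (h1 : width N < Real.pi) {G : ℝ → ℂ} (hG : Measurable G)
    {C : ℝ} (hC : ∀ t, ‖G t‖ ≤ C) (hper : Function.Periodic G (2 * Real.pi)) (m n : ℕ) :
    ∫ p in nearDiagonal N, G p.1 * (starRingEnd ℂ) (G p.2)
      * Complex.exp (Complex.I * p.1 * (m + 1) - Complex.I * p.2 * (n + 1)) * kernel N (p.2 - p.1)
      = ∫ s in Set.Icc (-width N) (width N), kernel N s * Complex.exp (-(Complex.I * s * (n + 1)))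
        * ∫ t, Complex.exp (Complex.I * ((m : ℤ) - n : ℤ) * t)
          * (G t * (starRingEnd ℂ) (G (t + s))) ∂period := by
  set Sk := ∑ k ∈ Finset.Ioc ⌊N⌋₊ ⌊4 * N / 3⌋₊, (1 : ℝ) / k
  have hSk : 0 ≤ Sk := Finset.sum_nonneg fun k _ => by positivity
  have hC0 : 0 ≤ C := (norm_nonneg _).trans (hC 0)
  have hGc : Measurable fun t => (starRingEnd ℂ) (G t) := Complex.continuous_conj.measurable.comp hG
  let f : ℝ → ℝ → ℂ := fun t₁ t₂ => G t₁ * (starRingEnd ℂ) (G t₂)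
    * Complex.exp (Complex.I * t₁ * (m + 1) - Complex.I * t₂ * (n + 1)) * kernel N (t₂ - t₁)
  have hf : Measurable (Function.uncurry f) := by
    have h2 : Measurable fun p : ℝ × ℝ =>
        Complex.exp (Complex.I * p.1 * (m + 1) - Complex.I * p.2 * (n + 1)) := by fun_prop
    exact (((hG.comp measurable_fst).mul (hGc.comp measurable_snd)).mul h2).mul
      ((measurable_kernel N).comp (measurable_snd.sub measurable_fst))
  have hexp : ∀ t₁ t₂ : ℝ,
      ‖Complex.exp (Complex.I * t₁ * (m + 1) - Complex.I * t₂ * (n + 1))‖ = 1 := fun t₁ t₂ => by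
    have : Complex.I * t₁ * (m + 1) - Complex.I * t₂ * (n + 1)
        = ((t₁ * (m + 1) - t₂ * (n + 1) : ℝ) : ℂ) * Complex.I := by push_cast; ring
    rw [this, Complex.norm_exp_ofReal_mul_I]
  have hfb : ∀ t₁ t₂, ‖f t₁ t₂‖ ≤ C * C * Sk := fun t₁ t₂ => by
    simp only [f]
    rw [norm_mul, norm_mul, norm_mul, hexp, mul_one, RCLike.norm_conj]
    exact mul_le_mul (mul_le_mul (hC _) (hC _) (norm_nonneg _) hC0) (kernel_norm_le_sum N _)
      (norm_nonneg _) (by positivity)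
  have hfper : ∀ t s, f t (s + 2 * Real.pi) = f t s := fun t s => by
    simp only [f]
    rw [hper, show s + 2 * Real.pi - t = s - t + 2 * Real.pi by ring, kernel_periodic]
    have e : Complex.I * t * (m + 1) - Complex.I * ((s + 2 * Real.pi : ℝ) : ℂ) * (n + 1)
        = (Complex.I * t * (m + 1) - Complex.I * s * (n + 1))
          + (-(n + 1 : ℤ) : ℤ) * (2 * Real.pi * Complex.I) := by push_cast; ring
    rw [e, Complex.exp_add, Complex.exp_int_mul_two_pi_mul_I, mul_one]
  have h2 := integral_nearDiagonal h1 hf hfb hfper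
  have h3 : ∀ t s, f t (t + s) = kernel N s * Complex.exp (-(Complex.I * s * (n + 1)))
      * (Complex.exp (Complex.I * ((m : ℤ) - n : ℤ) * t)
          * (G t * (starRingEnd ℂ) (G (t + s)))) := fun t s => by
    simp only [f]
    have e : Complex.I * t * (m + 1) - Complex.I * ((t + s : ℝ) : ℂ) * (n + 1)
        = -(Complex.I * s * (n + 1)) + Complex.I * ((m : ℤ) - n : ℤ) * t := by push_cast; ring
    rw [e, Complex.exp_add, add_sub_cancel_left]; ring
  rw [show (∫ p in nearDiagonal N, G p.1 * (starRingEnd ℂ) (G p.2)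
      * Complex.exp (Complex.I * p.1 * (m + 1) - Complex.I * p.2 * (n + 1)) * kernel N (p.2 - p.1))
      = ∫ p in nearDiagonal N, f p.1 p.2 from rfl, h2, integral_integral_swap]
  · refine integral_congr_ae (Filter.Eventually.of_forall fun s => ?_)
    beta_reduce
    simp_rw [h3]
    rw [integral_const_mul]
  · have hm : Measurable (Function.uncurry fun t s => f t (t + s)) :=
      Measurable.comp (g := Function.uncurry f) (f := fun p : ℝ × ℝ => (p.1, p.1 + p.2)) hf
        (measurable_fst.prodMk (measurable_fst.add measurable_snd))
    exact integrable_of_bound (C := C * C * Sk) hm fun p => hfb _ _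

/-- Summation by parts for `∑ z^k / k`. -/
lemma norm_one_sub_mul_sum_le {z : ℂ} (hz : ‖z‖ = 1) {a b : ℕ} (ha : 1 ≤ a) (hab : a ≤ b) :
    ‖(1 - z) * ∑ k ∈ Finset.Ioc a b, z ^ k / k‖ ≤ 2 / a := by
  have ha0 : (0 : ℝ) < a := by exact_mod_cast ha
  -- Adding the boundary term makes the induction telescope: each new term contributes exactly 1/b -
  -- 1/(b+1).
  have key : ‖(1 - z) * ∑ k ∈ Finset.Ioc a b, z ^ k / k + z ^ (b + 1) / b‖ ≤ 2 / a - 1 / b := by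
    induction b, hab using Nat.le_induction with
    | base =>
      rw [Finset.Ioc_self, Finset.sum_empty, mul_zero, zero_add, norm_div, norm_pow, hz, one_pow,
        Complex.norm_natCast]
      refine le_of_eq ?_
      field_simp; norm_num
    | succ b hab ih =>
      have hb0 : (0 : ℝ) < b := ha0.trans_le (by exact_mod_cast hab)
      have hbc : (b : ℂ) ≠ 0 := by exact_mod_cast hb0.ne'
      have hbc' : ((b + 1 : ℕ) : ℂ) ≠ 0 := by exact_mod_cast Nat.succ_ne_zero b
      have e : (1 - z) * ∑ k ∈ Finset.Ioc a (b + 1), z ^ k / k + z ^ (b + 1 + 1) / (b + 1 : ℕ)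
          = ((1 - z) * ∑ k ∈ Finset.Ioc a b, z ^ k / k + z ^ (b + 1) / b)
            + z ^ (b + 1) * (1 / (b + 1 : ℕ) - 1 / b) := by
        rw [← Finset.insert_Ioc_right_eq_Ioc_add_one hab, Finset.sum_insert (by simp)]
        field_simp
        ring
      have e2 : ‖z ^ (b + 1) * (1 / ((b + 1 : ℕ) : ℂ) - 1 / b)‖ = 1 / b - 1 / (b + 1 : ℕ) := by
        rw [norm_mul, norm_pow, hz, one_pow, one_mul]
        have : (1 / ((b + 1 : ℕ) : ℂ) - 1 / b) = ((-(1 / b - 1 / ((b + 1 : ℕ) : ℝ)) : ℝ) : ℂ) := by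
          push_cast; ring
        rw [this, Complex.norm_real, Real.norm_eq_abs, abs_neg, abs_of_nonneg]
        rw [sub_nonneg]
        exact one_div_le_one_div_of_le hb0 (by push_cast; linarith)
      rw [e]
      refine (norm_add_le _ _).trans ?_
      rw [e2]
      linarith
  have h2 : ‖z ^ (b + 1) / (b : ℂ)‖ = 1 / b := by
    rw [norm_div, norm_pow, hz, one_pow, Complex.norm_natCast]
  have h3 := norm_sub_le ((1 - z) * ∑ k ∈ Finset.Ioc a b, z ^ k / k + z ^ (b + 1) / b)
    (z ^ (b + 1) / b)
  rw [add_sub_cancel_right] at h3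
  linarith

lemma norm_kernel_le_one {N : ℝ} (hN : 6 ≤ N) (s : ℝ) : ‖kernel N s‖ ≤ 1 := by
  refine (kernel_norm_le_sum N s).trans ?_
  have h1 : ∀ k ∈ Finset.Ioc ⌊N⌋₊ ⌊4 * N / 3⌋₊, (1 : ℝ) / k ≤ 1 / N := fun k hk => by
    have := (Nat.floor_lt (by linarith)).1 (Finset.mem_Ioc.1 hk).1
    exact one_div_le_one_div_of_le (by linarith) this.le
  refine (Finset.sum_le_sum h1).trans ?_
  rw [Finset.sum_const, Nat.card_Ioc, nsmul_eq_mul, mul_one_div, div_le_one (by linarith)]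
  have h2 : (⌊4 * N / 3⌋₊ : ℝ) ≤ 4 * N / 3 := Nat.floor_le (by linarith)
  have h3 : N < ⌊N⌋₊ + 1 := Nat.lt_floor_add_one N
  have h4 : ⌊N⌋₊ ≤ ⌊4 * N / 3⌋₊ := Nat.floor_le_floor (by linarith)
  rw [Nat.cast_sub h4]
  linarith

/-- Summation by parts bounds |1 - e^{is}| times the kernel by 4/N, and Jordan's inequality gives |1
- e^{is}| ≥ 2|s|/π. -/
lemma norm_kernel_le {N : ℝ} (hN : 6 ≤ N) {s : ℝ} (h0 : s ≠ 0) (hs : |s| ≤ Real.pi) :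
    ‖kernel N s‖ ≤ 2 * Real.pi / N * (1 / |s|) := by
  set z := Complex.exp (Complex.I * s)
  have hz : ‖z‖ = 1 := by
    simp only [z]; rw [mul_comm, Complex.norm_exp_ofReal_mul_I]
  have hpi := Real.pi_pos
  have hs0 : 0 < |s| := abs_pos.2 h0
  have hker : kernel N s = ∑ k ∈ Finset.Ioc ⌊N⌋₊ ⌊4 * N / 3⌋₊, z ^ k / k := by
    refine Finset.sum_congr rfl fun k _ => ?_
    simp only [z]
    rw [← Complex.exp_nat_mul]
    congr 2; ring
  have ha : 1 ≤ ⌊N⌋₊ := Nat.le_floor (by push_cast; linarith)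
  have h1 := norm_one_sub_mul_sum_le hz ha (Nat.floor_le_floor (show N ≤ 4 * N / 3 by linarith))
  rw [← hker, norm_mul] at h1
  have h2 : 2 / Real.pi * |s| ≤ ‖1 - z‖ := by
    rw [norm_sub_rev]
    simp only [z]
    rw [Complex.norm_exp_I_mul_ofReal_sub_one, Real.norm_eq_abs, abs_mul, abs_two]
    have h3 : |Real.sin (s / 2)| = Real.sin (|s| / 2) := by
      rw [← abs_two, ← abs_div, abs_two]
      rcases abs_cases (s / 2) with ⟨h, h'⟩ | ⟨h, h'⟩
      · rw [h, abs_of_nonneg]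
        exact Real.sin_nonneg_of_nonneg_of_le_pi h' (by
          have := le_abs_self s; linarith)
      · rw [h, Real.sin_neg, abs_of_nonpos]
        exact Real.sin_nonpos_of_nonpos_of_neg_pi_le h'.le (by
          have := neg_abs_le s; linarith)
    have h4 := Real.mul_le_sin (x := |s| / 2) (by positivity) (by linarith)
    rw [h3]
    linarith
  have h3 : (N / 2 : ℝ) ≤ ⌊N⌋₊ := by
    have := Nat.lt_floor_add_one N
    linarith
  have h4 : (2 : ℝ) / ⌊N⌋₊ ≤ 4 / N := by
    rw [div_le_div_iff₀ (by linarith) (by linarith)]; linarith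
  have h5 : 2 / Real.pi * |s| * ‖kernel N s‖ ≤ 4 / N :=
    (mul_le_mul_of_nonneg_right h2 (norm_nonneg _)).trans (h1.trans h4)
  have h6 : 2 * Real.pi / N * (1 / |s|) = (4 / N) / (2 / Real.pi * |s|) := by
    field_simp; ring
  rw [h6, le_div_iff₀ (by positivity)]
  linarith

/-! ### The trivial bound and the twisted correlations. -/

section

lemma continuous_kernel (N : ℝ) : Continuous (kernel N) := by
  unfold kernel; fun_prop

/-- The kernel is at most 1 for |s| ≤ 1/N and decays like 1/(N|s|) beyond, so widening the strip to
l^100/N costs only a logarithm of N · width N, that is 100 log log N. -/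
lemma integral_norm_kernel_le {N : ℝ} (hN : 6 ≤ N) (h1 : width N ≤ Real.pi)
    (h2 : 1 / N ≤ width N) :
    ∫ s in Set.Icc (-width N) (width N), ‖kernel N s‖
      ≤ (2 + 4 * Real.pi * Real.log (N * width N)) / N := by
  set w := width N
  have hN0 : 0 < N := by linarith
  have hi0 : 0 < 1 / N := by positivity
  have hc : Continuous fun s => ‖kernel N s‖ := (continuous_kernel N).norm
  have hc' : Continuous fun s => ‖kernel N (-s)‖ := hc.comp continuous_neg
  have hii : ∀ a b, IntervalIntegrable (fun s => ‖kernel N s‖) volume a b :=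
    fun a b => hc.intervalIntegrable a b
  have hrhs : IntervalIntegrable (fun s => 2 * Real.pi / N * (1 / s)) volume (1 / N) w := by
    refine ContinuousOn.intervalIntegrable ?_
    rw [Set.uIcc_of_le h2]
    exact continuousOn_const.mul (continuousOn_const.div continuousOn_id
      fun s hs => (hi0.trans_le hs.1).ne')
  have hval : ∫ s in (1 / N)..w, 2 * Real.pi / N * (1 / s)
      = 2 * Real.pi / N * Real.log (N * w) := by
    rw [intervalIntegral.integral_const_mul, integral_one_div_of_pos hi0 (hi0.trans_le h2)]
    congr 2; field_simp
  have hR : ∫ s in (1 / N)..w, ‖kernel N s‖ ≤ 2 * Real.pi / N * Real.log (N * w) := by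
    rw [← hval]
    refine intervalIntegral.integral_mono_on h2 (hii _ _) hrhs fun s hs => ?_
    have hs0 := hi0.trans_le hs.1
    have := norm_kernel_le hN hs0.ne' (by rw [abs_of_pos hs0]; exact hs.2.trans h1)
    rwa [abs_of_pos hs0] at this
  have hL : ∫ s in (-w)..(-(1 / N)), ‖kernel N s‖ ≤ 2 * Real.pi / N * Real.log (N * w) := by
    have e := intervalIntegral.integral_comp_neg (a := 1 / N) (b := w) fun s => ‖kernel N s‖
    rw [← e, ← hval]
    refine intervalIntegral.integral_mono_on h2 (hc'.intervalIntegrable _ _) hrhs fun s hs => ?_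
    have hs0 := hi0.trans_le hs.1
    have := norm_kernel_le hN (neg_ne_zero.2 hs0.ne') (by
      rw [abs_neg, abs_of_pos hs0]; exact hs.2.trans h1)
    rwa [abs_neg, abs_of_pos hs0] at this
  have hM : ∫ s in (-(1 / N))..(1 / N), ‖kernel N s‖ ≤ 2 / N := by
    have h3 := intervalIntegral.integral_mono_on (a := -(1 / N)) (b := 1 / N) (by linarith)
      (hii _ _) (intervalIntegrable_const (c := (1 : ℝ))) fun s _ => norm_kernel_le_one hN s
    rw [intervalIntegral.integral_const, smul_eq_mul, mul_one] at h3
    refine h3.trans (le_of_eq ?_)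
    ring
  rw [integral_Icc_eq_integral_Ioc, ← intervalIntegral.integral_of_le (by linarith),
    ← intervalIntegral.integral_add_adjacent_intervals (hii (-w) (-(1 / N))) (hii _ w),
    ← intervalIntegral.integral_add_adjacent_intervals (hii (-(1 / N)) (1 / N)) (hii _ w)]
  have e : (2 + 4 * Real.pi * Real.log (N * w)) / N
      = 2 * Real.pi / N * Real.log (N * w) + (2 / N + 2 * Real.pi / N * Real.log (N * w)) := by
    ring
  rw [e]
  linarith

lemma norm_neg_exp_mul (s : ℝ) (n : ℕ) : ‖Complex.exp (-(Complex.I * s * (n + 1)))‖ = 1 := by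
  have : -(Complex.I * s * (n + 1)) = ((-(s * (n + 1)) : ℝ) : ℂ) * Complex.I := by push_cast; ring
  rw [this, Complex.norm_exp_ofReal_mul_I]

/-- The trivial bound for the near-diagonal integral. -/
lemma norm_integral_nearDiagonal_le {N : ℝ} (hN : 6 ≤ N) (h1 : width N < Real.pi)
    (h2 : 1 / N ≤ width N) {G : ℝ → ℂ} (hG : Measurable G)
    {C : ℝ} (hC : ∀ t, ‖G t‖ ≤ C) (hper : Function.Periodic G (2 * Real.pi)) (m n : ℕ) :
    ‖∫ p in nearDiagonal N, G p.1 * (starRingEnd ℂ) (G p.2)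
      * Complex.exp (Complex.I * p.1 * (m + 1) - Complex.I * p.2 * (n + 1)) * kernel N (p.2 - p.1)‖
      ≤ (2 + 4 * Real.pi * Real.log (N * width N)) / N * ∫ t, ‖G t‖ ^ 2 ∂period := by
  have hC0 : 0 ≤ C := (norm_nonneg _).trans (hC 0)
  rw [integral_nearDiagonal_eq h1 hG hC hper]
  set Q := ∫ t, ‖G t‖ ^ 2 ∂period
  have hQ : 0 ≤ Q := integral_nonneg fun t => sq_nonneg _
  have hi0 : ∀ s, Integrable (fun t => ‖G (t + s)‖ ^ 2) period := fun s => by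
    have hm : Measurable fun t => ‖G (t + s)‖ ^ 2 :=
      ((hG.comp (measurable_id.add_const s)).norm).pow_const 2
    refine integrable_of_bound (C := C ^ 2) hm fun t => ?_
    rw [norm_pow, norm_norm]; exact pow_le_pow_left₀ (norm_nonneg _) (hC _) 2
  have hi1 : Integrable (fun t => ‖G t‖ ^ 2) period := by
    have := hi0 0
    simpa using this
  have hJ : ∀ s : ℝ, ‖∫ t, Complex.exp (Complex.I * ((m : ℤ) - n : ℤ) * t)
      * (G t * (starRingEnd ℂ) (G (t + s))) ∂period‖ ≤ Q := fun s => by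
    refine (norm_integral_le_integral_norm _).trans ?_
    have h3 : ∀ t : ℝ, ‖Complex.exp (Complex.I * ((m : ℤ) - n : ℤ) * t)
        * (G t * (starRingEnd ℂ) (G (t + s)))‖ ≤ (‖G t‖ ^ 2 + ‖G (t + s)‖ ^ 2) / 2 := fun t => by
      rw [norm_mul, norm_exp_int_mul, one_mul, norm_mul, RCLike.norm_conj]
      nlinarith [sq_nonneg (‖G t‖ - ‖G (t + s)‖)]
    refine (integral_mono_of_nonneg (Filter.Eventually.of_forall fun t => norm_nonneg _)
      ((integrable_fun_add hi1 (hi0 s)).div_const 2) (Filter.Eventually.of_forall h3)).trans ?_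
    have hp : Function.Periodic (fun t => ‖G t‖ ^ 2) (2 * Real.pi) := fun t => by
      beta_reduce; rw [hper t]
    have h4 := integral_period_add hp s
    rw [integral_div, integral_add hi1 (hi0 s), h4]
    exact le_of_eq (by simp only [Q]; ring)
  refine (norm_integral_le_integral_norm _).trans ?_
  have hkm := measurable_kernel N
  have hki : Integrable (fun s => ‖kernel N s‖)
      (volume.restrict (Set.Icc (-width N) (width N))) :=
    integrable_of_bound (C := 1) hkm.norm fun s => by
      rw [norm_norm]; exact norm_kernel_le_one hN s
  have h5 := integral_mono_of_nonneg (μ := volume.restrict (Set.Icc (-width N) (width N)))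
    (Filter.Eventually.of_forall fun s => norm_nonneg (kernel N s
      * Complex.exp (-(Complex.I * s * (n + 1))) * ∫ t, Complex.exp (Complex.I
      * ((m : ℤ) - n : ℤ) * t) * (G t * (starRingEnd ℂ) (G (t + s))) ∂period))
    (hki.mul_const Q) (Filter.Eventually.of_forall fun s => by
      beta_reduce
      rw [norm_mul, norm_mul, norm_neg_exp_mul, mul_one]
      exact mul_le_mul_of_nonneg_left (hJ s) (norm_nonneg _))
  refine h5.trans ?_
  rw [integral_mul_const]
  exact mul_le_mul_of_nonneg_right (integral_norm_kernel_le hN h1.le h2) hQ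

variable {u : ℕ → ℝ} {L : ℕ}

/-- The twisted correlation at shift `s`. -/
def twisted (u : ℕ → ℝ) (L : ℕ) (r : ℤ) (s : ℝ) (x : ℕ → ℂ) : ℂ :=
  ∫ t, Complex.exp (Complex.I * r * t) * corr u s L L t x ∂period

/-- The average over shifts of the twisted correlations. -/
def twistedAvg (u : ℕ → ℝ) (L : ℕ) (N : ℝ) (r : ℤ) (n : ℕ) (x : ℕ → ℂ) : ℂ :=
  ∫ s in Set.Icc (-width N) (width N),
    kernel N s * Complex.exp (-(Complex.I * s * (n + 1))) * twisted u L r s x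

lemma measurable_twisted (r : ℤ) :
    Measurable fun p : ℝ × (ℕ → ℂ) => twisted u L r p.1 p.2 := by
  have h1 : Measurable fun q : (ℝ × (ℕ → ℂ)) × ℝ => gpart u L q.2 q.1.2 :=
    Measurable.comp (g := fun p : ℝ × (ℕ → ℂ) => gpart u L p.1 p.2)
      (f := fun q : (ℝ × (ℕ → ℂ)) × ℝ => (q.2, q.1.2)) (measurable_gpart L)
      (measurable_snd.prodMk (measurable_snd.comp measurable_fst))
  have h2 : Measurable fun q : (ℝ × (ℕ → ℂ)) × ℝ => gpart u L (q.2 + q.1.1) q.1.2 :=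
    Measurable.comp (g := fun p : ℝ × (ℕ → ℂ) => gpart u L p.1 p.2)
      (f := fun q : (ℝ × (ℕ → ℂ)) × ℝ => (q.2 + q.1.1, q.1.2)) (measurable_gpart L)
      ((measurable_snd.add (measurable_fst.comp measurable_fst)).prodMk
        (measurable_snd.comp measurable_fst))
  have h3 : Measurable fun q : (ℝ × (ℕ → ℂ)) × ℝ =>
      (starRingEnd ℂ) (gpart u L (q.2 + q.1.1) q.1.2) := Complex.continuous_conj.measurable.comp h2
  have h4 : Measurable fun q : (ℝ × (ℕ → ℂ)) × ℝ => Complex.exp (Complex.I * r * q.2) := by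
    fun_prop
  have h5 := (h4.mul (h1.mul h3)).stronglyMeasurable.integral_prod_right' (ν := period)
  have h6 := h5.measurable
  simp only [Pi.mul_apply] at h6
  unfold twisted
  simp only [corr_self]
  exact h6

lemma exists_norm_twisted_le (u : ℕ → ℝ) (L : ℕ) (r : ℤ) :
    ∃ C, ∀ s x, ‖twisted u L r s x‖ ≤ C := by
  obtain ⟨C, hC⟩ := exists_theta_le u L
  refine ⟨C * (period).real Set.univ, fun s x => norm_integral_le_of_norm_le_const
    (Filter.Eventually.of_forall fun t => ?_)⟩
  rw [norm_mul, norm_exp_int_mul, one_mul]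
  have := norm_corr_le (u := u) (σ := s) (le_refl L) t x
  linarith [hC t x, hC (t + s) x]

lemma restrictedIntegral_eq {Ω : Type*} [MeasurableSpace Ω] {X : ℕ → Ω → ℂ} {N K : ℝ}
    (h1 : width N < Real.pi) (hK : 0 < K) (hL : Real.log K = L) (hL0 : 0 < L)
    (hq : 0 ≤ Real.log (Real.log N)) (m n : ℕ) (ω : Ω) :
    restrictedIntegral X N K m n ω = (Real.exp (V L) : ℝ)
      * twistedAvg (barr (Real.log (Real.log N)) L) L N ((m : ℤ) - n) n (coords X L ω) := by
  set u := barr (Real.log (Real.log N)) L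
  set x := coords X L ω
  set c : ℂ := ((Real.exp (V L / 2) : ℝ) : ℂ)
  have hG : ∀ t, restrictedF X N K t ω = c * gpart u L t x := fun t =>
    restrictedF_eq hK hL hL0 hq t ω
  have hgm : Measurable fun t => c * gpart u L t x := by
    refine Measurable.const_mul ?_ c
    exact Measurable.comp (g := fun p : ℝ × (ℕ → ℂ) => gpart u L p.1 p.2) (f := fun t => (t, x))
      (measurable_gpart L) (measurable_id.prodMk measurable_const)
  obtain ⟨C, hC⟩ := exists_theta_le u L
  have hgb : ∀ t, ‖c * gpart u L t x‖ ≤ ‖c‖ * √C := fun t => by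
    rw [norm_mul]
    refine mul_le_mul_of_nonneg_left ?_ (norm_nonneg _)
    exact Real.le_sqrt_of_sq_le (hC t x)
  have hgp : Function.Periodic (fun t => c * gpart u L t x) (2 * Real.pi) := fun t => by
    beta_reduce
    rw [gpart_congr (t' := t) (y := x) fun j _ => P_periodic j t x]
  have h2 := integral_nearDiagonal_eq h1 hgm hgb hgp m n
  rw [restrictedIntegral]
  simp_rw [hG]
  rw [h2, twistedAvg, ← integral_const_mul]
  refine integral_congr_ae (Filter.Eventually.of_forall fun s => ?_)
  beta_reduce
  have hcc : c * (starRingEnd ℂ) c = ((Real.exp (V L) : ℝ) : ℂ) := by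
    simp only [c]
    rw [Complex.conj_ofReal, ← Complex.ofReal_mul, ← Real.exp_add, add_halves]
  have h3 : ∀ t : ℝ, Complex.exp (Complex.I * ((m : ℤ) - n : ℤ) * t) * (c * gpart u L t x
      * (starRingEnd ℂ) (c * gpart u L (t + s) x)) = ((Real.exp (V L) : ℝ) : ℂ)
        * (Complex.exp (Complex.I * ((m : ℤ) - n : ℤ) * t) * corr u s L L t x) := fun t => by
    rw [corr_self, map_mul, ← hcc]; ring
  simp_rw [h3]
  rw [integral_const_mul, twisted]
  ring

end

/-! ### Large deviations of the twisted correlations. -/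

section

variable {Ω : Type*} [MeasurableSpace Ω] {μ : Measure Ω} [IsProbabilityMeasure μ]
  {X : ℕ → Ω → ℂ} {u : ℕ → ℝ} {L : ℕ} {lam : ℝ} {mu : ℕ → ℝ}

/-- The standing conditions of the exponential moment bound. -/
structure MomentSetup (u : ℕ → ℝ) (L : ℕ) (lam : ℝ) (mu : ℕ → ℝ) (n : ℕ) (E : Set (ℕ → ℂ))
    (r : ℤ) : Prop where
  lam_nonneg : 0 ≤ lam
  mu_nonneg : ∀ m, 0 ≤ mu m
  le : n ≤ L
  high : ∀ m, n ≤ m → m < L → StepOK u lam mu m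
  low : ∀ m < n, StepOK u 0 mu m
  meas : MeasurableSet E
  dep : ∀ x y : ℕ → ℂ, (∀ k ∈ Finset.Ioc 0 (top n), x k = y k) → (x ∈ E ↔ y ∈ E)
  small : ∀ x ∈ E, ∀ s, lam *
    ‖∫ t, Complex.exp (Complex.I * r * t) * corr u s L n t x ∂period‖ ≤ 1

lemma measurable_exp_int_mul (r : ℤ) : Measurable fun t : ℝ => Complex.exp (Complex.I * r * t) := by
  fun_prop

lemma integral_re_const_mul {m : ℕ} (hm : m ≤ L) (r : ℤ) (s : ℝ) (c : ℂ) (x : ℕ → ℂ) :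
    ∫ t, (c * Complex.exp (Complex.I * r * t) * corr u s L m t x).re ∂period
      = (c * ∫ t, Complex.exp (Complex.I * r * t) * corr u s L m t x ∂period).re := by
  obtain ⟨C, hC⟩ := exists_norm_corr_le (u := u) (σ := s) hm
  have hi : Integrable (fun t : ℝ => Complex.exp (Complex.I * r * t) * corr u s L m t x) period :=
    integrable_of_bound (C := C) ((measurable_exp_int_mul r).mul (measurable_corr_left hm x))
      fun t => by rw [norm_mul, norm_exp_int_mul, one_mul]; exact hC t x
  have h := integral_re (hi.const_mul c)
  simp only [RCLike.re_to_complex] at h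
  rw [← integral_const_mul, ← h]
  simp only [mul_assoc]

lemma lintegral_exp_twisted_le (hX : IsStdComplexGaussianSeq μ X) {n : ℕ} {E : Set (ℕ → ℂ)}
    {r : ℤ} (h : MomentSetup u L lam mu n E r) (s : ℝ) {c : ℂ} (hc : ‖c‖ ≤ 1) :
    ∫⁻ ω, E.indicator (fun x => ENNReal.ofReal (Real.exp (lam * (c * twisted u L r s x).re)))
        (coords X L ω) ∂μ ≤ ENNReal.ofReal (Real.exp (1 + 2 * Real.pi * mu 0)) := by
  have hψ : Measurable fun t : ℝ => c * Complex.exp (Complex.I * r * t) :=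
    (measurable_exp_int_mul r).const_mul c
  have hψ1 : ∀ t : ℝ, ‖c * Complex.exp (Complex.I * r * t)‖ ≤ 1 := fun t => by
    rw [norm_mul, norm_exp_int_mul, mul_one]; exact hc
  have hmeas : Measurable fun x => ENNReal.ofReal
      (Real.exp (lam * (c * twisted u L r s x).re)) := by
    have h1 : Measurable fun x => twisted u L r s x :=
      Measurable.comp (g := fun p : ℝ × (ℕ → ℂ) => twisted u L r p.1 p.2) (f := fun x => (s, x))
        (measurable_twisted r) (measurable_const.prodMk measurable_id)
    exact (Real.measurable_exp.comp
      ((Complex.measurable_re.comp (h1.const_mul c)).const_mul lam)).ennreal_ofReal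
  rw [lintegral_coords hX L (hmeas.indicator h.meas)]
  have key := gmarg_indicator_exp_le (u := u) (σ := s) hψ hψ1 h.lam_nonneg h.mu_nonneg h.le h.high
    h.low h.meas h.dep (fun x hx => by
      rw [integral_re_const_mul h.le]
      refine le_trans (mul_le_mul_of_nonneg_left ?_ h.lam_nonneg) (h.small x hx s)
      refine (Complex.re_le_norm _).trans ?_
      rw [norm_mul]
      exact mul_le_of_le_one_left (norm_nonneg _) hc) 0
  simp_rw [integral_re_const_mul (le_refl L)] at key
  exact key

/-- The uniform law on the shifts. -/
abbrev shiftLaw (N : ℝ) : Measure ℝ := volume[|Set.Icc (-width N) (width N)]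

lemma isProbabilityMeasure_shiftLaw {N : ℝ} (hw : 0 < width N) :
    IsProbabilityMeasure (shiftLaw N) := by
  refine cond_isProbabilityMeasure_of_finite ?_ ?_
  · rw [Real.volume_Icc]
    simp only [ne_eq, ENNReal.ofReal_eq_zero, not_le]
    linarith
  · rw [Real.volume_Icc]; exact ENNReal.ofReal_ne_top

lemma integral_shiftLaw {N : ℝ} (hw : 0 < width N) (f : ℝ → ℂ) :
    ∫ s in Set.Icc (-width N) (width N), f s = (2 * width N : ℝ) * ∫ s, f s ∂shiftLaw N := by
  rw [shiftLaw, ProbabilityTheory.cond, integral_smul_measure, Real.volume_Icc,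
    show width N - -width N = 2 * width N by ring, ENNReal.toReal_inv,
    ENNReal.toReal_ofReal (by linarith), Complex.real_smul, ← mul_assoc, ← Complex.ofReal_mul,
    mul_inv_cancel₀ (by linarith)]
  simp

/-- Jensen's inequality for the uniform law of the shift reduces the average to single shifts. The
kernel is at most 1 in modulus and is treated as part of the phase. -/
lemma exp_re_twistedAvg_le {N : ℝ} (hN : 6 ≤ N) (hw : 0 < width N) (r : ℤ) (n : ℕ) (c : ℂ)
    (x : ℕ → ℂ) :
    ENNReal.ofReal (Real.exp (lam * ((c * twistedAvg u L N r n x).re / (2 * width N))))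
      ≤ ∫⁻ s, ENNReal.ofReal (Real.exp (lam *
        (c * (kernel N s * Complex.exp (-(Complex.I * s * (n + 1)))) * twisted u L r s x).re))
        ∂shiftLaw N := by
  have := isProbabilityMeasure_shiftLaw hw
  obtain ⟨C, hC⟩ := exists_norm_twisted_le u L r
  have hC0 : 0 ≤ C := (norm_nonneg _).trans (hC 0 x)
  have htm : Measurable fun s => twisted u L r s x :=
    Measurable.comp (g := fun p : ℝ × (ℕ → ℂ) => twisted u L r p.1 p.2) (f := fun s => (s, x))
      (measurable_twisted r) (measurable_id.prodMk measurable_const)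
  have hkm : Measurable fun s : ℝ => kernel N s * Complex.exp (-(Complex.I * s * (n + 1))) :=
    (measurable_kernel N).mul (by fun_prop)
  let f : ℝ → ℂ := fun s =>
    c * (kernel N s * Complex.exp (-(Complex.I * s * (n + 1)))) * twisted u L r s x
  have hfm : Measurable f := (hkm.const_mul c).mul htm
  have hfb : ∀ s, ‖f s‖ ≤ ‖c‖ * C := fun s => by
    simp only [f]
    rw [norm_mul, norm_mul, norm_mul, norm_neg_exp_mul, mul_one]
    refine mul_le_mul ?_ (hC s x) (norm_nonneg _) (norm_nonneg _)
    exact mul_le_of_le_one_right (norm_nonneg _) (norm_kernel_le_one hN s)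
  have hfi : Integrable f (shiftLaw N) := integrable_of_bound hfm hfb
  have e1 : (c * twistedAvg u L N r n x).re / (2 * width N) = ∫ s, (f s).re ∂shiftLaw N := by
    have h1 := integral_re hfi
    simp only [RCLike.re_to_complex] at h1
    rw [twistedAvg, ← integral_const_mul, h1]
    have h2 := integral_shiftLaw hw f
    have h3 : (∫ s in Set.Icc (-width N) (width N), c * (kernel N s
        * Complex.exp (-(Complex.I * s * (n + 1))) * twisted u L r s x))
        = ∫ s in Set.Icc (-width N) (width N), f s := by
      simp only [f, mul_assoc]
    rw [h3, h2, Complex.re_ofReal_mul]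
    field_simp
  have hgm : Measurable fun s => lam * (f s).re := (Complex.measurable_re.comp hfm).const_mul lam
  have hgb : ∀ s, |lam * (f s).re| ≤ |lam| * (‖c‖ * C) := fun s => by
    rw [abs_mul]
    exact mul_le_mul_of_nonneg_left ((Complex.abs_re_le_norm _).trans (hfb s)) (abs_nonneg _)
  have hgi : Integrable (fun s => lam * (f s).re) (shiftLaw N) :=
    integrable_of_bound hgm fun s => by rw [Real.norm_eq_abs]; exact hgb s
  have hei : Integrable (fun s => Real.exp (lam * (f s).re)) (shiftLaw N) :=
    integrable_of_bound (C := Real.exp (|lam| * (‖c‖ * C))) (Real.measurable_exp.comp hgm)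
      fun s => by
        rw [Real.norm_eq_abs, Real.abs_exp]
        exact Real.exp_le_exp.2 ((le_abs_self _).trans (hgb s))
  rw [e1, ← integral_const_mul, ← ofReal_integral_eq_lintegral_ofReal hei
    (Filter.Eventually.of_forall fun s => (Real.exp_pos _).le)]
  refine ENNReal.ofReal_le_ofReal ?_
  exact convexOn_exp.map_integral_le Real.continuous_exp.continuousOn isClosed_univ
    (Filter.Eventually.of_forall fun s => Set.mem_univ _) hgi hei

lemma measurable_twistedAvg (N : ℝ) (r : ℤ) (n : ℕ) :
    Measurable fun x => twistedAvg u L N r n x := by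
  have h1 : Measurable fun p : (ℕ → ℂ) × ℝ => kernel N p.2
      * Complex.exp (-(Complex.I * p.2 * (n + 1))) * twisted u L r p.2 p.1 :=
    (((measurable_kernel N).comp measurable_snd).mul (by fun_prop)).mul
      ((measurable_twisted r).comp measurable_swap)
  exact h1.stronglyMeasurable.integral_prod_right'.measurable

lemma lintegral_exp_twistedAvg_le (hX : IsStdComplexGaussianSeq μ X) {N : ℝ} (hN : 6 ≤ N)
    (hw : 0 < width N) {n₀ : ℕ} {E : Set (ℕ → ℂ)} {r : ℤ}
    (h : MomentSetup u L lam mu n₀ E r) (n : ℕ) {c : ℂ} (hc : ‖c‖ ≤ 1) :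
    ∫⁻ ω, E.indicator (fun x => ENNReal.ofReal
        (Real.exp (lam * ((c * twistedAvg u L N r n x).re / (2 * width N))))) (coords X L ω) ∂μ
      ≤ ENNReal.ofReal (Real.exp (1 + 2 * Real.pi * mu 0)) := by
  have := isProbabilityMeasure_shiftLaw hw
  let κ : ℝ → ℂ := fun s => c * (kernel N s * Complex.exp (-(Complex.I * s * (n + 1))))
  have hκm : Measurable κ := by
    refine Measurable.const_mul ?_ c
    exact (measurable_kernel N).mul (by fun_prop)
  have hκ : ∀ s, ‖κ s‖ ≤ 1 := fun s => by
    simp only [κ]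
    rw [norm_mul, norm_mul, norm_neg_exp_mul, mul_one]
    exact mul_le_one₀ hc (norm_nonneg _) (norm_kernel_le_one hN s)
  let Q : ℝ → (ℕ → ℂ) → ENNReal := fun s =>
    E.indicator fun x => ENNReal.ofReal (Real.exp (lam * (κ s * twisted u L r s x).re))
  have hQm : Measurable fun p : Ω × ℝ => Q p.2 (coords X L p.1) := by
    have h1 : Measurable fun p : ℝ × (ℕ → ℂ) => ENNReal.ofReal
        (Real.exp (lam * (κ p.1 * twisted u L r p.1 p.2).re)) :=
      (Real.measurable_exp.comp ((Complex.measurable_re.comp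
        ((hκm.comp measurable_fst).mul (measurable_twisted r))).const_mul lam)).ennreal_ofReal
    have h2 : Measurable fun p : ℝ × (ℕ → ℂ) => Q p.1 p.2 := h1.indicator (measurable_snd h.meas)
    exact h2.comp (measurable_snd.prodMk ((measurable_coords hX L).comp measurable_fst))
  have hpt : ∀ ω, E.indicator (fun x => ENNReal.ofReal
      (Real.exp (lam * ((c * twistedAvg u L N r n x).re / (2 * width N))))) (coords X L ω)
      ≤ ∫⁻ s, Q s (coords X L ω) ∂shiftLaw N := fun ω => by
    by_cases hE : coords X L ω ∈ E
    · simp only [Q, Set.indicator_of_mem hE]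
      exact exp_re_twistedAvg_le hN hw r n c _
    · rw [Set.indicator_of_notMem hE]; exact zero_le
  refine (lintegral_mono hpt).trans ?_
  rw [lintegral_lintegral_swap hQm.aemeasurable]
  refine (lintegral_mono fun s => lintegral_exp_twisted_le hX h s (hκ s)).trans ?_
  simp

/-- One of |Re z|, |Im z| is at least half of |z|. Four directions thus suffice to pass from the
modulus to real linear functionals, which is what the exponential moments control. -/
lemma exists_direction {z : ℂ} {a : ℝ} (h : 2 * a < ‖z‖) :
    ∃ c ∈ ({1, -1, Complex.I, -Complex.I} : Finset ℂ), a ≤ (c * z).re := by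
  have h1 := Complex.norm_le_abs_re_add_abs_im z
  rcases le_or_gt a |z.re| with h2 | h2
  · rcases abs_cases z.re with ⟨e, -⟩ | ⟨e, -⟩
    · exact ⟨1, by simp, by simp; linarith⟩
    · exact ⟨-1, by simp, by simp; linarith⟩
  · have h3 : a ≤ |z.im| := by linarith
    rcases abs_cases z.im with ⟨e, -⟩ | ⟨e, -⟩
    · exact ⟨-Complex.I, by simp, by simp; linarith⟩
    · exact ⟨Complex.I, by simp, by simp; linarith⟩

/-- Large deviations of the averaged twisted correlation. -/
lemma measure_twistedAvg_gt_le (hX : IsStdComplexGaussianSeq μ X) {N : ℝ} (hN : 6 ≤ N)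
    (hw : 0 < width N) {n₀ : ℕ} {E : Set (ℕ → ℂ)} {r : ℤ}
    (h : MomentSetup u L lam mu n₀ E r) (n : ℕ) (a : ℝ) :
    μ {ω | coords X L ω ∈ E ∧ 2 * a < ‖twistedAvg u L N r n (coords X L ω)‖}
      ≤ 4 * ENNReal.ofReal (Real.exp (1 + 2 * Real.pi * mu 0 - lam * (a / (2 * width N)))) := by
  set D : Finset ℂ := {1, -1, Complex.I, -Complex.I}
  have hD : ∀ c ∈ D, ‖c‖ ≤ 1 := fun c hc => by
    simp only [D, Finset.mem_insert, Finset.mem_singleton] at hc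
    rcases hc with rfl | rfl | rfl | rfl <;> simp
  have hcard : D.card ≤ 4 := Finset.card_le_four
  have hsub : {ω | coords X L ω ∈ E ∧ 2 * a < ‖twistedAvg u L N r n (coords X L ω)‖}
      ⊆ ⋃ c ∈ D, {ω | coords X L ω ∈ E ∧ a ≤ (c * twistedAvg u L N r n (coords X L ω)).re} := by
    rintro ω ⟨h1, h2⟩
    obtain ⟨c, hc, h3⟩ := exists_direction h2
    exact Set.mem_biUnion hc ⟨h1, h3⟩
  refine (measure_mono hsub).trans ((measure_biUnion_finset_le _ _).trans ?_)
  have hone : ∀ c ∈ D, μ {ω | coords X L ω ∈ E ∧ a ≤ (c * twistedAvg u L N r n (coords X L ω)).re}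
      ≤ ENNReal.ofReal (Real.exp (1 + 2 * Real.pi * mu 0 - lam * (a / (2 * width N)))) := by
    intro c hc
    set f : Ω → ENNReal := fun ω => E.indicator (fun x => ENNReal.ofReal
        (Real.exp (lam * ((c * twistedAvg u L N r n x).re / (2 * width N))))) (coords X L ω)
    have hfm : Measurable f := by
      have h1 : Measurable fun x => ENNReal.ofReal
          (Real.exp (lam * ((c * twistedAvg u L N r n x).re / (2 * width N)))) :=
        (Real.measurable_exp.comp (((Complex.measurable_re.comp
          ((measurable_twistedAvg N r n).const_mul c)).div_const _).const_mul lam)).ennreal_ofReal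
      exact (h1.indicator h.meas).comp (measurable_coords hX L)
    have h1 := mul_meas_ge_le_lintegral (μ := μ) hfm
      (ENNReal.ofReal (Real.exp (lam * (a / (2 * width N)))))
    have h2 := h1.trans (lintegral_exp_twistedAvg_le hX hN hw h n (hD c hc))
    have h3 : {ω | coords X L ω ∈ E ∧ a ≤ (c * twistedAvg u L N r n (coords X L ω)).re}
        ⊆ {ω | ENNReal.ofReal (Real.exp (lam * (a / (2 * width N)))) ≤ f ω} := by
      rintro ω ⟨h4, h5⟩
      simp only [f, Set.mem_ofPred_eq, Set.indicator_of_mem h4]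
      have h6 := h.lam_nonneg
      refine ENNReal.ofReal_le_ofReal (Real.exp_le_exp.2 ?_)
      gcongr
    have hpos : 0 < Real.exp (lam * (a / (2 * width N))) := Real.exp_pos _
    refine (measure_mono h3).trans ?_
    rw [Real.exp_sub, ENNReal.ofReal_div_of_pos hpos,
      ENNReal.le_div_iff_mul_le (Or.inl (by simpa using hpos)) (Or.inl ENNReal.ofReal_ne_top),
      mul_comm]
    exact h2
  refine (Finset.sum_le_sum hone).trans ?_
  rw [Finset.sum_const, nsmul_eq_mul]
  gcongr
  exact_mod_cast hcard

end

/-! ### Choice of the weights and of the range of N. -/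

lemma kap_mul_thetaMax_le (u : ℕ → ℝ) (m : ℕ) :
    kap (m + 1) * thetaMax u (m + 1) ≤ 60000 * Real.exp (2 * u (m + 1)) := by
  have h1 := V_le (m + 1)
  have h2 : kap (m + 1) * thetaMax u (m + 1)
      = 20000 * Real.exp (V (m + 1) - (m + 1 : ℕ)) * Real.exp (2 * u (m + 1)) := by
    rw [kap, thetaMax, Real.exp_add, sub_eq_add_neg, Real.exp_add]; ring
  rw [h2]
  refine mul_le_mul_of_nonneg_right ?_ (Real.exp_pos _).le
  have h3 : Real.exp (V (m + 1) - (m + 1 : ℕ)) ≤ Real.exp 1 :=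
    Real.exp_le_exp.2 (by linarith)
  linarith [Real.exp_one_lt_d9]

/-- The weights of the recursion. -/
def weight (l : ℝ) (L m : ℕ) : ℝ := ((L - m : ℕ) : ℝ) / l ^ 100

lemma weight_nonneg (l : ℝ) (L m : ℕ) : 0 ≤ weight l L m := by
  unfold weight; positivity

lemma weight_le {l : ℝ} (hl : 0 < l) {L : ℕ} (hL : (L : ℝ) ≤ l) (m : ℕ) :
    weight l L m * l ^ 99 ≤ 1 := by
  have h1 : ((L - m : ℕ) : ℝ) ≤ l := (Nat.cast_le.2 (Nat.sub_le L m)).trans hL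
  rw [weight, div_mul_eq_mul_div, div_le_one (by positivity), pow_succ l 99, mul_comm (l ^ 99)]
  gcongr

lemma weight_succ {l : ℝ} {L m : ℕ} (hm : m < L) :
    weight l L (m + 1) + 1 / l ^ 100 = weight l L m := by
  have : ((L - m : ℕ) : ℝ) = ((L - (m + 1) : ℕ) : ℝ) + 1 := by
    have : L - m = (L - (m + 1)) + 1 := by omega
    rw [this]; push_cast; ring
  rw [weight, weight, this, add_div]

/-- The barrier contributes e^{2u} = l^(-4000), while lam² = l^2400. The cost per block is
O(l^(-1600)), far below the increment l^(-100) of the weights. -/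
lemma stepOK_high {l : ℝ} (hl : 1000000 ≤ l) {L : ℕ} (hL : (L : ℝ) ≤ l) {u : ℕ → ℝ} {m : ℕ}
    (hm : m < L) (hu : u (m + 1) = -2000 * Real.log l) :
    StepOK u (l ^ 1200) (weight l L) m := by
  have hl0 : 0 < l := by linarith
  have hl1 : 1 ≤ l := by linarith
  have hk := kap_mul_thetaMax_le u m
  have he : Real.exp (2 * u (m + 1)) = (l ^ 4000)⁻¹ := by
    rw [hu, show 2 * (-2000 * Real.log l) = -((4000 : ℕ) * Real.log l) by push_cast; ring,
      Real.exp_neg, Real.exp_nat_mul, Real.exp_log hl0]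
  rw [he] at hk
  have hw0 := weight_nonneg l L (m + 1)
  have hw1 : weight l L (m + 1) ≤ 1 := by
    have h1 := weight_le hl0 hL (m + 1)
    have h2 : 1 ≤ l ^ 99 := one_le_pow₀ hl1
    nlinarith
  have hp : 1 ≤ l ^ 1200 := one_le_pow₀ hl1
  have hkt : 0 ≤ kap (m + 1) * thetaMax u (m + 1) :=
    mul_nonneg (kap_pos _).le (Real.exp_pos _).le
  have hbig : ∀ k, 1 ≤ k → 1000000 ≤ l ^ k := fun k hk => hl.trans (le_self_pow₀ hl1 (by omega))
  constructor
  · calc kap (m + 1) * ((l ^ 1200 + weight l L (m + 1)) * thetaMax u (m + 1))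
        = (kap (m + 1) * thetaMax u (m + 1)) * (l ^ 1200 + weight l L (m + 1)) := by ring
      _ ≤ (60000 * (l ^ 4000)⁻¹) * (l ^ 1200 + l ^ 1200) := by gcongr; linarith
      _ = 120000 / l ^ 2800 := by
        have : l ^ 4000 = l ^ 1200 * l ^ 2800 := by rw [← pow_add]
        rw [this]; field_simp; ring
      _ ≤ 1 := by
        rw [div_le_one (by positivity)]
        linarith [hbig 2800 (by norm_num)]
  · rw [← weight_succ hm]
    have h1 : (l ^ 1200) ^ 2 + weight l L (m + 1) ^ 2 ≤ 2 * l ^ 2400 := by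
      have h2 : (l ^ 1200) ^ 2 = l ^ 2400 := by rw [← pow_mul]
      have h3 : 1 ≤ l ^ 2400 := one_le_pow₀ hl1
      rw [h2]
      have : weight l L (m + 1) ^ 2 ≤ 1 := pow_le_one₀ hw0 hw1
      linarith
    have h2 : 2 * (kap (m + 1) * thetaMax u (m + 1)) * ((l ^ 1200) ^ 2 + weight l L (m + 1) ^ 2)
        ≤ 1 / l ^ 100 := by
      calc _ ≤ 2 * (60000 * (l ^ 4000)⁻¹) * (2 * l ^ 2400) := by gcongr
        _ = 240000 / l ^ 1500 * (1 / l ^ 100) := by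
          have : l ^ 4000 = l ^ 2400 * l ^ 1500 * l ^ 100 := by rw [← pow_add, ← pow_add]
          rw [this]; field_simp; ring
        _ ≤ 1 * (1 / l ^ 100) := by
          gcongr
          rw [div_le_one (by positivity)]
          linarith [hbig 1500 (by norm_num)]
        _ = _ := one_mul _
    linarith

/-- Here the barrier may contribute l^24, but lam is 0 and the weights are at most l^(-99). The cost
O(l^(24 - 198)) is again below l^(-100). -/
lemma stepOK_low {l : ℝ} (hl : 1000000 ≤ l) {L : ℕ} (hL : (L : ℝ) ≤ l) {u : ℕ → ℝ} {m : ℕ}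
    (hm : m < L) (hu : u (m + 1) ≤ 12 * Real.log l) :
    StepOK u 0 (weight l L) m := by
  have hl0 : 0 < l := by linarith
  have hl1 : 1 ≤ l := by linarith
  have hk := kap_mul_thetaMax_le u m
  have he : Real.exp (2 * u (m + 1)) ≤ l ^ 24 := by
    have : Real.exp (2 * (12 * Real.log l)) = l ^ 24 := by
      rw [show 2 * (12 * Real.log l) = (24 : ℕ) * Real.log l by push_cast; ring,
        Real.exp_nat_mul, Real.exp_log hl0]
    rw [← this]
    exact Real.exp_le_exp.2 (by linarith)
  have hk' : kap (m + 1) * thetaMax u (m + 1) ≤ 60000 * l ^ 24 := by linarith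
  have hkt : 0 ≤ kap (m + 1) * thetaMax u (m + 1) :=
    mul_nonneg (kap_pos _).le (Real.exp_pos _).le
  have hw0 := weight_nonneg l L (m + 1)
  have hw1 : weight l L (m + 1) ≤ 1 / l ^ 99 := by
    rw [le_div_iff₀ (by positivity)]; exact weight_le hl0 hL (m + 1)
  have hbig : ∀ k, 1 ≤ k → 1000000 ≤ l ^ k := fun k hk => hl.trans (le_self_pow₀ hl1 (by omega))
  constructor
  · calc kap (m + 1) * ((0 + weight l L (m + 1)) * thetaMax u (m + 1))
        = (kap (m + 1) * thetaMax u (m + 1)) * weight l L (m + 1) := by ring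
      _ ≤ (60000 * l ^ 24) * (1 / l ^ 99) := by gcongr
      _ = 60000 / l ^ 75 := by
        have : l ^ 99 = l ^ 24 * l ^ 75 := by rw [← pow_add]
        rw [this]; field_simp
      _ ≤ 1 := by
        rw [div_le_one (by positivity)]
        linarith [hbig 75 (by norm_num)]
  · rw [← weight_succ hm]
    have h2 : 2 * (kap (m + 1) * thetaMax u (m + 1)) * (0 ^ 2 + weight l L (m + 1) ^ 2)
        ≤ 1 / l ^ 100 := by
      calc _ ≤ 2 * (60000 * l ^ 24) * (0 ^ 2 + (1 / l ^ 99) ^ 2) := by gcongr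
        _ = 120000 / l ^ 74 * (1 / l ^ 100) := by
          have h3 : (l ^ 99) ^ 2 = l ^ 24 * l ^ 74 * l ^ 100 := by
            rw [← pow_add, ← pow_add, ← pow_mul]
          rw [div_pow, h3]; field_simp; ring
        _ ≤ 1 * (1 / l ^ 100) := by
          gcongr
          rw [div_le_one (by positivity)]
          linarith [hbig 74 (by norm_num)]
        _ = _ := one_mul _
    linarith

/-- The configurations with bounded low coordinates. -/
def boundedLow (n : ℕ) (R : ℝ) : Set (ℕ → ℂ) := {x | ∀ k ∈ Finset.Ioc 0 (top n), ‖x k‖ ≤ R}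

lemma measurableSet_boundedLow (n : ℕ) (R : ℝ) : MeasurableSet (boundedLow n R) := by
  have : boundedLow n R = ⋂ k ∈ Finset.Ioc 0 (top n), {x : ℕ → ℂ | ‖x k‖ ≤ R} := by
    ext x; simp [boundedLow]
  rw [this]
  exact Finset.measurableSet_biInter _ fun k _ =>
    measurableSet_le (measurable_pi_apply k).norm measurable_const

lemma top_le_exp (n : ℕ) : (top n : ℝ) ≤ Real.exp n := by
  unfold top
  split_ifs
  · simpa using (Real.exp_pos _).le
  · exact Nat.floor_le (Real.exp_pos _).le

lemma lipC_le {n : ℕ} {R : ℝ} {x : ℕ → ℂ} (hx : x ∈ boundedLow n R) (hR : 0 ≤ R) :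
    lipC n x ≤ R * Real.exp n ^ 2 := by
  have h1 : ∀ k ∈ Finset.Ioc 0 (top n), ‖x k‖ * √(k : ℝ) ≤ R * top n := fun k hk => by
    rw [Finset.mem_Ioc] at hk
    have h2 : √(k : ℝ) ≤ top n := by
      have h3 : (1 : ℝ) ≤ k := by exact_mod_cast hk.1
      have h4 : (k : ℝ) ≤ top n := by exact_mod_cast hk.2
      refine le_trans ?_ h4
      rw [Real.sqrt_le_left (by linarith)]
      nlinarith
    exact mul_le_mul (hx k (Finset.mem_Ioc.2 hk)) h2 (Real.sqrt_nonneg _) hR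
  refine (Finset.sum_le_sum h1).trans ?_
  rw [Finset.sum_const, Nat.card_Ioc, Nat.sub_zero, nsmul_eq_mul]
  have := top_le_exp n
  calc (top n : ℝ) * (R * top n) = R * (top n) ^ 2 := by ring
    _ ≤ _ := by gcongr

/-- The requirements on the size of `N`. -/
structure LargeN (N : ℝ) : Prop where
  pos : 0 < N
  log_ge : 1000000 ≤ Real.log N
  width : Real.log N ^ 100 ≤ N
  -- Makes the twisted integral over the low blocks beat lam = (log N)^1200.
  low : 300000 * Real.log N ^ 1201 ≤ N ^ (2 / 5 : ℝ)
  -- Used for the Gaussian tails of the low coordinates.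
  tail : 40 * Real.log N ≤ N ^ (3 / 20 : ℝ)
  six : 100 ≤ N
  third : 64 ≤ N ^ (2 / 3 : ℝ)

lemma eventually_log_pow_le (C : ℝ) (k : ℕ) {s : ℝ} (hs : 0 < s) :
    ∀ᶠ N : ℝ in Filter.atTop, C * Real.log N ^ k ≤ N ^ s := by
  have h1 := isLittleO_log_rpow_rpow_atTop (k : ℝ) hs
  have h2 := h1.def (show 0 < 1 / (|C| + 1) by positivity)
  filter_upwards [h2, Filter.eventually_ge_atTop 1] with N hN hN1
  have hN0 : (0 : ℝ) < N := by linarith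
  have hlog : 0 ≤ Real.log N := Real.log_nonneg hN1
  rw [Real.rpow_natCast, Real.norm_of_nonneg (by positivity),
    Real.norm_of_nonneg (Real.rpow_nonneg hN0.le _), one_div, ← div_eq_inv_mul,
    le_div_iff₀ (by positivity)] at hN
  have h3 : C ≤ |C| + 1 := by linarith [le_abs_self C]
  calc C * Real.log N ^ k ≤ (|C| + 1) * Real.log N ^ k := by gcongr
    _ ≤ _ := by linarith

lemma eventually_largeN : ∀ᶠ N : ℝ in Filter.atTop, LargeN N := by
  have h2 := eventually_log_pow_le 1 100 one_pos
  have h3 := eventually_log_pow_le 300000 1201 (show (0 : ℝ) < 2 / 5 by norm_num)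
  have h4 := eventually_log_pow_le 40 1 (show (0 : ℝ) < 3 / 20 by norm_num)
  have h5 := Real.tendsto_log_atTop.eventually_ge_atTop 1000000
  have h6 := (tendsto_rpow_atTop (show (0 : ℝ) < 2 / 3 by norm_num)).eventually_ge_atTop 64
  filter_upwards [h2, h3, h4, h5, h6, Filter.eventually_ge_atTop 100] with N h2 h3 h4 h5 h6 h7
  exact ⟨by linarith, h5, by simpa using h2, h3, by simpa using h4, h7, h6⟩

/-! ### Verification of the moment conditions and Gaussian tails. -/

section

/-- The number of low blocks. -/
def lowBlocks (L : ℕ) : ℕ := ⌈(1 / 100 : ℝ) * L⌉₊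

lemma lowBlocks_le (L : ℕ) : lowBlocks L ≤ L := by
  refine Nat.ceil_le.2 ?_
  have : (0 : ℝ) ≤ L := Nat.cast_nonneg L
  linarith

lemma lowBlocks_lt (L : ℕ) : (lowBlocks L : ℝ) < (1 / 100 : ℝ) * L + 1 :=
  Nat.ceil_lt_add_one (by positivity)

/-- Intended values: W = e^n for n low blocks, R = N^(1/5) the bound on the low coordinates, A =
N^(2/3), B = N^(2/5), h = π/|r| the half period, and b = e^{2(V n + u n)}. -/
lemma low_arith {l W R A B b h top L lip : ℝ} (hl : 1 ≤ l) (hW : 1 ≤ W) (hR : 1 ≤ R)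
    (hB : 300000 * l ^ 1201 ≤ B) (hRW : R * W ^ 4 * B ≤ 60 * A)
    (hb : b ≤ 7.5 * W ^ 2) (h0 : 0 ≤ h) (hh : h * A ≤ 12.6) (ht : top ≤ W)
    (ht0 : 0 ≤ top) (hL : L ≤ l) (hL0 : 0 ≤ L) (hlip : lip ≤ R * W ^ 2) (hlip0 : 0 ≤ lip) :
    2 * lip * h ≤ 1 ∧ l ^ 1200 * (b * h * (12 * L * top + 4 * Real.pi * lip)) ≤ 1 := by
  have hpi := Real.pi_lt_d2
  have hpi0 := Real.pi_pos
  have hl1 : 1 ≤ l ^ 1201 := one_le_pow₀ hl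
  have hW2 : 1 ≤ W ^ 2 := one_le_pow₀ hW
  have hW24 : W ^ 2 ≤ W ^ 4 := pow_le_pow_right₀ hW (by norm_num)
  have hB0 : 0 < B := by linarith
  have hRW4 : 0 < R * W ^ 4 := by positivity
  have h1 : R * W ^ 4 * (300000 * l ^ 1201) ≤ 60 * A :=
    (mul_le_mul_of_nonneg_left hB hRW4.le).trans hRW
  have key : R * W ^ 4 * l ^ 1201 * h * 5000 ≤ 12.6 := by
    have h2 : R * W ^ 4 * l ^ 1201 * 5000 ≤ A := by linarith
    calc R * W ^ 4 * l ^ 1201 * h * 5000 = (R * W ^ 4 * l ^ 1201 * 5000) * h := by ring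
      _ ≤ A * h := by gcongr
      _ ≤ 12.6 := by linarith
  constructor
  · have h3 : lip * h ≤ R * W ^ 4 * l ^ 1201 * h := by
      have : lip ≤ R * W ^ 4 * l ^ 1201 := by
        calc lip ≤ R * W ^ 2 := hlip
          _ ≤ R * W ^ 4 := by gcongr
          _ ≤ R * W ^ 4 * l ^ 1201 := le_mul_of_one_le_right hRW4.le hl1
      gcongr
    linarith
  · have h4 : 12 * L * top + 4 * Real.pi * lip ≤ 24.6 * (l * (R * W ^ 2)) := by
      have h5 : L * top ≤ l * (R * W ^ 2) := by
        have : top ≤ R * W ^ 2 := by nlinarith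
        gcongr
      have h6 : lip ≤ l * (R * W ^ 2) := hlip.trans (le_mul_of_one_le_left (by positivity) hl)
      have h7 : 4 * Real.pi * lip ≤ 12.6 * lip :=
        mul_le_mul_of_nonneg_right (by linarith) hlip0
      nlinarith
    have h5 : 0 ≤ 12 * L * top + 4 * Real.pi * lip := by positivity
    calc l ^ 1200 * (b * h * (12 * L * top + 4 * Real.pi * lip))
        ≤ l ^ 1200 * (7.5 * W ^ 2 * h * (24.6 * (l * (R * W ^ 2)))) := by gcongr
      _ = 184.5 * (R * W ^ 4 * l ^ 1201 * h) := by rw [pow_succ l 1200]; ring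
      _ ≤ 1 := by linarith

lemma LargeN.rpow_eq {N : ℝ} (hN : LargeN N) (s : ℝ) : N ^ s = Real.exp (Real.log N * s) :=
  Real.rpow_def_of_pos hN.pos s

lemma LargeN.one_le_loglog {N : ℝ} (hN : LargeN N) : 1 ≤ Real.log (Real.log N) := by
  have h := hN.log_ge
  rw [Real.le_log_iff_exp_le (by linarith)]
  linarith [Real.exp_one_lt_d9]

lemma LargeN.loglog_le {N : ℝ} (hN : LargeN N) : Real.log (Real.log N) ≤ Real.log N := by
  have h := hN.log_ge
  linarith [Real.log_le_sub_one_of_pos (show 0 < Real.log N by linarith)]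

lemma LargeN.natLog_le {N K : ℝ} {L : ℕ} (hN : LargeN N) (hK1 : N / 3 ≤ K) (hK2 : K ≤ N)
    (hL : Real.log K = L) : (L : ℝ) ≤ Real.log N := by
  rw [← hL]
  have := hN.pos
  exact Real.log_le_log (by linarith) hK2

lemma LargeN.le_natLog {N K : ℝ} {L : ℕ} (hN : LargeN N) (hK1 : N / 3 ≤ K)
    (hL : Real.log K = L) : 0 < L := by
  have h0 := hN.pos
  have h1 := Real.log_le_log (show 0 < N / 3 by linarith) hK1
  rw [Real.log_div h0.ne' (by norm_num), hL] at h1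
  have h2 : Real.log 3 ≤ 2 := by linarith [Real.log_le_sub_one_of_pos (show (0 : ℝ) < 3 by norm_num)]
  have h3 := hN.log_ge
  have : (0 : ℝ) < L := by linarith
  exact_mod_cast this

lemma momentSetup {N K : ℝ} {L : ℕ} (hN : LargeN N) (hK1 : N / 3 ≤ K) (hK2 : K ≤ N)
    (hL : Real.log K = L) {r : ℤ} (hr : N ^ (2 / 3 : ℝ) / 4 ≤ |(r : ℝ)|) :
    MomentSetup (barr (Real.log (Real.log N)) L) L (Real.log N ^ 1200) (weight (Real.log N) L)
      (lowBlocks L) (boundedLow (lowBlocks L) (N ^ (1 / 5 : ℝ))) r := by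
  have hl := hN.log_ge
  have hq := hN.one_le_loglog
  have hLl := hN.natLog_le hK1 hK2 hL
  have hL0 := hN.le_natLog hK1 hL
  have hL0' : (0 : ℝ) < L := by exact_mod_cast hL0
  have hthird := hN.third
  set l := Real.log N with hldef
  set q := Real.log l
  set n := lowBlocks L
  have hn1 : 1 ≤ n := Nat.ceil_pos.2 (by positivity)
  have hnL : n ≤ L := lowBlocks_le L
  have hn2 : (n : ℝ) < 1 / 100 * L + 1 := lowBlocks_lt L
  have hn3 : (1 / 100 : ℝ) * L ≤ n := Nat.le_ceil _
  refine ⟨by positivity, fun m => weight_nonneg l L m, hnL, fun m h1 h2 => ?_,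
    fun m hm => ?_, measurableSet_boundedLow _ _, fun x y hxy => ?_, fun x hx s => ?_⟩
  · refine stepOK_high hl hLl h2 ?_
    have h3 : (1 / 100 : ℝ) * L ≤ (m + 1 : ℕ) := by
      have : (n : ℝ) ≤ m := by exact_mod_cast h1
      push_cast; linarith
    rw [barr, if_pos h3]
  · refine stepOK_low hl hLl (by omega) ?_
    rw [barr]
    split_ifs
    · change -2000 * q ≤ 12 * q
      linarith
    · exact le_rfl
  · simp only [boundedLow, Set.mem_ofPred_eq]
    exact forall₂_congr fun k hk => by rw [hxy k hk]
  · have hr0 : 0 < |(r : ℝ)| := by linarith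
    have hrne : r ≠ 0 := by
      rintro rfl; simp at hr0
    have hR : 1 ≤ N ^ (1 / 5 : ℝ) := Real.one_le_rpow (by linarith [hN.six]) (by norm_num)
    have hlip := lipC_le hx (by linarith)
    have hlip0 : 0 ≤ lipC n x := Finset.sum_nonneg fun k _ => by positivity
    -- The number of low blocks is rounded up, so at time n the lower barrier is already in force.
    have hun : barr q L n ≤ 0 := by
      rw [barr, if_pos hn3]; linarith
    have hVn := V_le n
    have hb : Real.exp (2 * (V n + barr q L n)) ≤ 7.5 * Real.exp n ^ 2 := by
      have h1 : Real.exp (2 * (V n + barr q L n)) ≤ Real.exp 1 ^ 2 * Real.exp n ^ 2 := by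
        rw [← mul_pow, ← Real.exp_add, ← Real.exp_nat_mul]
        refine Real.exp_le_exp.2 ?_
        push_cast; linarith
      have h2 : Real.exp 1 ^ 2 ≤ 7.5 := by
        nlinarith [Real.exp_one_lt_d9, Real.exp_pos 1]
      exact h1.trans (mul_le_mul_of_nonneg_right h2 (by positivity))
    have hh : Real.pi / |(r : ℝ)| * N ^ (2 / 3 : ℝ) ≤ 12.6 := by
      rw [div_mul_eq_mul_div, div_le_iff₀ hr0]
      have hpi := Real.pi_lt_d2
      have hpi0 := Real.pi_pos
      nlinarith
    -- The exponents add up to 1/5 + 4/100 + 2/5 = 16/25 < 2/3. The factor e^4 < 60 comes from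
    -- rounding n up.
    have hRW : N ^ (1 / 5 : ℝ) * Real.exp n ^ 4 * N ^ (2 / 5 : ℝ) ≤ 60 * N ^ (2 / 3 : ℝ) := by
      have h1 : N ^ (1 / 5 : ℝ) * Real.exp n ^ 4 * N ^ (2 / 5 : ℝ)
          ≤ Real.exp 1 ^ 4 * N ^ (2 / 3 : ℝ) := by
        rw [hN.rpow_eq, hN.rpow_eq, hN.rpow_eq, ← Real.exp_nat_mul, ← Real.exp_nat_mul,
          ← Real.exp_add, ← Real.exp_add, ← Real.exp_add, ← hldef]
        refine Real.exp_le_exp.2 ?_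
        push_cast; linarith
      have h2 : Real.exp 1 ^ 4 ≤ 60 := by
        have h3 : Real.exp 1 ^ 2 ≤ 7.5 := by nlinarith [Real.exp_one_lt_d9, Real.exp_pos 1]
        calc Real.exp 1 ^ 4 = (Real.exp 1 ^ 2) ^ 2 := by ring
          _ ≤ 7.5 ^ 2 := by gcongr
          _ ≤ 60 := by norm_num
      exact h1.trans (mul_le_mul_of_nonneg_right h2 (by positivity))
    obtain ⟨h1, h2⟩ := low_arith (by linarith) (Real.one_le_exp (Nat.cast_nonneg n)) hR
      hN.low hRW hb (by positivity) hh (top_le_exp n)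
      (Nat.cast_nonneg _) hLl hL0'.le hlip hlip0
    refine le_trans (mul_le_mul_of_nonneg_left ?_ (by positivity)) h2
    exact norm_integral_corr_low_le hn1 hnL hrne h1

variable {Ω : Type*} [MeasurableSpace Ω] {μ : Measure Ω} [IsProbabilityMeasure μ]
  {X : ℕ → Ω → ℂ}

/-- Chernoff's bound with parameter R, which is optimal for variance 1/2 at level R/2. -/
lemma measureReal_abs_ge_le {f : Ω → ℝ} (hf : Measurable f)
    (h : μ.map f = gaussianReal 0 (1 / 2)) {R : ℝ} (hR : 0 ≤ R) :
    μ.real {ω | R / 2 ≤ |f ω|} ≤ 2 * Real.exp (-(R ^ 2 / 4)) := by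
  have hint : ∀ t, Integrable (fun ω => Real.exp (t * f ω)) μ := fun t => by
    have h1 := integrable_exp_mul_gaussianReal (μ := 0) (v := 1 / 2) t
    rw [← h, integrable_map_measure (by fun_prop) hf.aemeasurable] at h1
    exact h1
  have h1 := measure_ge_le_exp_mul_mgf (R / 2) hR (hint R)
  have h2 := measure_le_le_exp_mul_mgf (-(R / 2)) (neg_nonpos.2 hR) (hint (-R))
  rw [mgf_gaussianReal h, ← Real.exp_add] at h1 h2
  have e1 : -R * (R / 2) + (0 * R + ((1 / 2 : NNReal) : ℝ) * R ^ 2 / 2) = -(R ^ 2 / 4) := by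
    push_cast; ring
  have e2 : -(-R) * (-(R / 2)) + (0 * -R + ((1 / 2 : NNReal) : ℝ) * (-R) ^ 2 / 2)
      = -(R ^ 2 / 4) := by
    push_cast; ring
  rw [e1] at h1
  rw [e2] at h2
  have hsub : {ω | R / 2 ≤ |f ω|} ⊆ {ω | R / 2 ≤ f ω} ∪ {ω | f ω ≤ -(R / 2)} := by
    intro ω hω
    rcases le_abs.1 (show R / 2 ≤ |f ω| from hω) with h3 | h3
    · exact Or.inl h3
    · exact Or.inr (show f ω ≤ -(R / 2) by linarith)
  have h3 := (measureReal_mono (μ := μ) hsub (measure_ne_top _ _)).trans (measureReal_union_le _ _)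
  linarith

lemma measure_norm_gt_le (hX : IsStdComplexGaussianSeq μ X) {k : ℕ} (hk : 1 ≤ k) {R : ℝ}
    (hR : 0 ≤ R) : μ {ω | R < ‖X k ω‖} ≤ ENNReal.ofReal (4 * Real.exp (-(R ^ 2 / 4))) := by
  have hm := hX.measurable k hk
  have h1 := measureReal_abs_ge_le (Complex.measurable_re.comp hm) (hX.law_re k hk) hR
  have h2 := measureReal_abs_ge_le (Complex.measurable_im.comp hm) (hX.law_im k hk) hR
  have hsub : {ω | R < ‖X k ω‖} ⊆ {ω | R / 2 ≤ |(X k ω).re|} ∪ {ω | R / 2 ≤ |(X k ω).im|} := by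
    intro ω hω
    have h3 := Complex.norm_le_abs_re_add_abs_im (X k ω)
    have h4 : R < ‖X k ω‖ := hω
    rcases le_or_gt (R / 2) |(X k ω).re| with h5 | h5
    · exact Or.inl h5
    · exact Or.inr (show R / 2 ≤ |(X k ω).im| by linarith)
  have h3 := (measureReal_mono (μ := μ) hsub (measure_ne_top _ _)).trans (measureReal_union_le _ _)
  rw [← ofReal_measureReal]
  refine ENNReal.ofReal_le_ofReal ?_
  simp only [Function.comp] at h1 h2
  linarith

lemma measure_notMem_boundedLow_le (hX : IsStdComplexGaussianSeq μ X) {n L : ℕ} (hn : n ≤ L)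
    {R : ℝ} (hR : 0 ≤ R) : μ {ω | coords X L ω ∉ boundedLow n R}
      ≤ ENNReal.ofReal (Real.exp n * (4 * Real.exp (-(R ^ 2 / 4)))) := by
  have hsub : {ω | coords X L ω ∉ boundedLow n R}
      ⊆ ⋃ k ∈ Finset.Ioc 0 (top n), {ω | R < ‖X k ω‖} := by
    intro ω hω
    simp only [boundedLow, Set.mem_ofPred_eq, not_forall, not_le] at hω
    obtain ⟨k, hk, h⟩ := hω
    have hk' : k ∈ Finset.Ioc 0 (top L) :=
      Finset.Ioc_subset_Ioc_right (top_mono hn) hk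
    rw [coords_apply hk'] at h
    exact Set.mem_biUnion hk h
  refine (measure_mono hsub).trans ((measure_biUnion_finset_le _ _).trans ?_)
  refine (Finset.sum_le_sum fun k hk => measure_norm_gt_le hX (Finset.mem_Ioc.1 hk).1 hR).trans ?_
  rw [Finset.sum_const, Nat.card_Ioc, Nat.sub_zero, nsmul_eq_mul, ← ENNReal.ofReal_natCast,
    ← ENNReal.ofReal_mul (Nat.cast_nonneg _)]
  refine ENNReal.ofReal_le_ofReal ?_
  have := top_le_exp n
  gcongr

/-- The Gaussian exponent N^(2/5) factors as N^(1/4) · N^(3/20). The first factor dominates p and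
the second dominates 40 log N, so the tail beats (log N)^(-2p) and the number of low coordinates.
This is where p ≤ N^(1/4) enters. -/
lemma LargeN.tail_le {N K : ℝ} {L p : ℕ} (hN : LargeN N) (hK1 : N / 3 ≤ K) (hK2 : K ≤ N)
    (hL : Real.log K = L) (hp : (p : ℝ) ≤ N ^ (1 / 4 : ℝ)) :
    Real.exp (lowBlocks L) * (4 * Real.exp (-((N ^ (1 / 5 : ℝ)) ^ 2 / 4)))
      ≤ 1 / Real.log N ^ (2 * p) := by
  have hl := hN.log_ge
  have hq := hN.one_le_loglog
  have hql := hN.loglog_le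
  have hLl := hN.natLog_le hK1 hK2 hL
  have htail := hN.tail
  have h100 := hN.six
  have hn := lowBlocks_lt L
  have hlpos : 0 < Real.log N := by linarith
  have e1 : Real.log N ^ (2 * p) = Real.exp (2 * p * Real.log (Real.log N)) := by
    rw [← Real.exp_log (pow_pos hlpos (2 * p)), Real.log_pow]; push_cast; rfl
  have e2 : (N ^ (1 / 5 : ℝ)) ^ 2 = N ^ (1 / 4 : ℝ) * N ^ (3 / 20 : ℝ) := by
    rw [← Real.rpow_natCast, ← Real.rpow_mul hN.pos.le, ← Real.rpow_add hN.pos]; norm_num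
  have h4 : (4 : ℝ) ≤ Real.exp 2 := by
    have h := Real.add_one_le_exp (1 : ℝ)
    have : Real.exp 2 = Real.exp 1 * Real.exp 1 := by rw [← Real.exp_add]; norm_num
    rw [this]; nlinarith
  have hg : 1 ≤ N ^ (1 / 4 : ℝ) := Real.one_le_rpow (by linarith) (by norm_num)
  set l := Real.log N
  set q := Real.log l
  set g := N ^ (1 / 4 : ℝ)
  rw [e1, e2, one_div, ← Real.exp_neg]
  calc Real.exp (lowBlocks L) * (4 * Real.exp (-(g * N ^ (3 / 20 : ℝ) / 4)))
      ≤ Real.exp (lowBlocks L) * (Real.exp 2 * Real.exp (-(g * N ^ (3 / 20 : ℝ) / 4))) := by gcongr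
    _ = Real.exp (lowBlocks L + (2 + -(g * N ^ (3 / 20 : ℝ) / 4))) := by
        rw [← Real.exp_add, ← Real.exp_add]
    _ ≤ _ := by
        refine Real.exp_le_exp.2 ?_
        have h5 : g * (40 * l) ≤ g * N ^ (3 / 20 : ℝ) := by gcongr
        have h6 : (p : ℝ) * q ≤ g * l := by gcongr
        have h7 : l ≤ g * l := le_mul_of_one_le_left (by linarith) hg
        linarith

end

/-! ### The exceptional event and the near-diagonal pairs. -/

section

lemma LargeN.log_pow_eq {N : ℝ} (hN : LargeN N) (p : ℕ) :
    Real.log N ^ (2 * p) = Real.exp (2 * p * Real.log (Real.log N)) := by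
  have hlpos : 0 < Real.log N := by linarith [hN.log_ge]
  rw [← Real.exp_log (pow_pos hlpos (2 * p)), Real.log_pow]; push_cast; rfl

lemma LargeN.width_pos {N : ℝ} (hN : LargeN N) : 0 < GaussianBL.width N := by
  have := hN.log_ge
  have := hN.pos
  rw [GaussianBL.width]; positivity

lemma LargeN.width_lt_pi {N : ℝ} (hN : LargeN N) : GaussianBL.width N < Real.pi := by
  have h : GaussianBL.width N ≤ 1 := (div_le_one hN.pos).2 hN.width
  linarith [Real.pi_gt_three]

lemma exp_V_le {N K : ℝ} {L : ℕ} (hN : LargeN N) (hK1 : N / 3 ≤ K) (hK2 : K ≤ N)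
    (hL : Real.log K = L) : Real.exp (V L) ≤ 3 * N := by
  have h0 := hN.pos
  have hKL : Real.exp L = K := by rw [← hL, Real.exp_log (by linarith)]
  have h1 : Real.exp (V L) ≤ Real.exp L * Real.exp 1 := by
    rw [← Real.exp_add]; exact Real.exp_le_exp.2 (V_le L)
  rw [hKL] at h1
  have h2 : K * Real.exp 1 ≤ N * 3 :=
    mul_le_mul hK2 (by linarith [Real.exp_one_lt_d9]) (Real.exp_pos _).le h0.le
  linarith

/-- E stands for e^{V L}, which is at most 3N and cancels the 1/N in the width. The large-deviation
exponent is then at least p^25 l^(1200 - 985 - 100)/12 with l = log N. This exceeds 2 log N + 2p log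
log N plus constants, leaving room for a union bound over N² pairs. -/
lemma LargeN.deviation_le {N : ℝ} (hN : LargeN N) {p : ℕ} (hp : 1 ≤ p) {w E : ℝ} (hw : w ≤ 1)
    (hE0 : 0 < E) (hE : E ≤ 3 * N) :
    4 * Real.exp (1 + 2 * Real.pi * w - Real.log N ^ 1200
        * ((p : ℝ) ^ 25 / Real.log N ^ 985 / (2 * E) / (2 * GaussianBL.width N)))
      ≤ 1 / (N ^ 2 * Real.log N ^ (2 * p)) := by
  have hl := hN.log_ge
  have hql := hN.loglog_le
  have h0 := hN.pos
  have hp1 : (1 : ℝ) ≤ p := by exact_mod_cast hp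
  have e2 : N ^ 2 = Real.exp (2 * Real.log N) := by
    rw [← Real.exp_log (pow_pos h0 2), Real.log_pow]; push_cast; rfl
  have h4 : (4 : ℝ) ≤ Real.exp 2 := by
    have h := Real.add_one_le_exp (1 : ℝ)
    have : Real.exp 2 = Real.exp 1 * Real.exp 1 := by rw [← Real.exp_add]; norm_num
    rw [this]; nlinarith
  rw [hN.log_pow_eq, GaussianBL.width]
  set l := Real.log N
  set q := Real.log l
  have hlpos : 0 < l := by linarith
  have e3 : l ^ 1200 * ((p : ℝ) ^ 25 / l ^ 985 / (2 * E) / (2 * (l ^ 100 / N)))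
      = (p : ℝ) ^ 25 * l ^ 115 * (N / (4 * E)) := by
    have : l ^ 1200 = l ^ 115 * l ^ 985 * l ^ 100 := by rw [← pow_add, ← pow_add]
    rw [this]
    field_simp
    norm_num
  have h5 : (1 : ℝ) / 12 ≤ N / (4 * E) := by
    rw [div_le_div_iff₀ (by norm_num) (by positivity)]; linarith
  have h6 : (p : ℝ) ≤ (p : ℝ) ^ 25 := le_self_pow₀ hp1 (by norm_num)
  have h7 : l ^ 2 ≤ l ^ 115 := pow_le_pow_right₀ (by linarith) (by norm_num)
  have h8 : (p : ℝ) * l ^ 2 * (1 / 12) ≤ (p : ℝ) ^ 25 * l ^ 115 * (N / (4 * E)) := by gcongr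
  rw [e3, e2, ← Real.exp_add, one_div, ← Real.exp_neg]
  refine (mul_le_mul_of_nonneg_right h4 (Real.exp_pos _).le).trans ?_
  rw [← Real.exp_add]
  refine Real.exp_le_exp.2 ?_
  have h9 : 2 * Real.pi * w ≤ 7 := by nlinarith [Real.pi_lt_d2, Real.pi_pos]
  have h10 : (p : ℝ) * q ≤ p * l := by gcongr
  have h11 : l ≤ p * l := le_mul_of_one_le_left hlpos.le hp1
  have h12 : (p : ℝ) * l * 1000000 ≤ p * l * l := by gcongr
  have h13 : (p : ℝ) * l ^ 2 = p * l * l := by ring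
  rw [h13] at h8
  linarith

variable {Ω : Type*} [MeasurableSpace Ω] {μ : Measure Ω} [IsProbabilityMeasure μ]
  {X : ℕ → Ω → ℂ}

lemma measure_restrictedIntegral_gt_le (hX : IsStdComplexGaussianSeq μ X) {N K : ℝ} {L : ℕ}
    (hN : LargeN N) (hK1 : N / 3 ≤ K) (hK2 : K ≤ N) (hL : Real.log K = L) {p : ℕ} (hp : 1 ≤ p)
    {m n : ℕ} (hmn : N ^ (2 / 3 : ℝ) / 4 ≤ |(((m : ℤ) - n : ℤ) : ℝ)|) :
    μ {ω | coords X L ω ∈ boundedLow (lowBlocks L) (N ^ (1 / 5 : ℝ)) ∧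
        (p : ℝ) ^ 25 / Real.log N ^ 985 < ‖restrictedIntegral X N K m n ω‖}
      ≤ ENNReal.ofReal (1 / (N ^ 2 * Real.log N ^ (2 * p))) := by
  have h0 := hN.pos
  have hq := hN.one_le_loglog
  have hl := hN.log_ge
  have hL0 := hN.le_natLog hK1 hL
  have h := measure_twistedAvg_gt_le hX (show 6 ≤ N by linarith [hN.six]) hN.width_pos
    (momentSetup hN hK1 hK2 hL hmn) n
    ((p : ℝ) ^ 25 / Real.log N ^ 985 / (2 * Real.exp (V L)))
  have hE := Real.exp_pos (V L)
  refine (measure_mono ?_).trans (h.trans ?_)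
  · rintro ω ⟨h1, h2⟩
    refine ⟨h1, ?_⟩
    rw [restrictedIntegral_eq hN.width_lt_pi (by linarith) hL hL0 (by linarith), norm_mul,
      Complex.norm_real, Real.norm_of_nonneg hE.le] at h2
    have h3 := (div_lt_iff₀' hE).2 h2
    refine lt_of_eq_of_lt ?_ h3
    field_simp
  · rw [← ENNReal.ofReal_ofNat 4, ← ENNReal.ofReal_mul (by norm_num)]
    refine ENNReal.ofReal_le_ofReal (hN.deviation_le hp ?_ hE (exp_V_le hN hK1 hK2 hL))
    have h1 := weight_le (l := Real.log N) (by linarith) (hN.natLog_le hK1 hK2 hL) 0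
    have h2 : 1 ≤ Real.log N ^ 99 := one_le_pow₀ (by linarith)
    have h3 := weight_nonneg (Real.log N) L 0
    nlinarith

lemma LargeN.card_window_le {N : ℝ} (hN : LargeN N) : ((window N).card : ℝ) ≤ N := by
  have h0 := hN.six
  rw [window, Nat.card_Ioc]
  refine (Nat.cast_le.2 (Nat.sub_le_sub_left
    (Nat.floor_le_floor (show N / 2 ≤ 8 * N / 7 by linarith)) _)).trans ?_
  have h1 : (⌊4 * N / 3⌋₊ : ℝ) ≤ 4 * N / 3 := Nat.floor_le (by linarith)
  have h2 : N / 2 < ⌊N / 2⌋₊ + 1 := Nat.lt_floor_add_one _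
  rw [Nat.cast_sub (Nat.floor_le_floor (by linarith))]
  linarith

/-- All the off-diagonal integrals are small outside an event of small probability. -/
lemma measure_bad_le (hX : IsStdComplexGaussianSeq μ X) {N K : ℝ} {L : ℕ}
    (hN : LargeN N) (hK1 : N / 3 ≤ K) (hK2 : K ≤ N) (hL : Real.log K = L) {p : ℕ} (hp : 1 ≤ p)
    (hp' : (p : ℝ) ≤ N ^ (1 / 4 : ℝ)) :
    μ {ω | ∃ m ∈ window N, ∃ n ∈ window N, N ^ (2 / 3 : ℝ) / 4 ≤ |(((m : ℤ) - n : ℤ) : ℝ)| ∧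
        (p : ℝ) ^ 25 / Real.log N ^ 985 < ‖restrictedIntegral X N K m n ω‖}
      ≤ ENNReal.ofReal (2 / Real.log N ^ (2 * p)) := by
  have h0 := hN.pos
  have hl := hN.log_ge
  set E := boundedLow (lowBlocks L) (N ^ (1 / 5 : ℝ))
  let S : ℕ × ℕ → Set Ω := fun a => {ω | coords X L ω ∈ E ∧
    N ^ (2 / 3 : ℝ) / 4 ≤ |(((a.1 : ℤ) - a.2 : ℤ) : ℝ)| ∧
    (p : ℝ) ^ 25 / Real.log N ^ 985 < ‖restrictedIntegral X N K a.1 a.2 ω‖}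
  have hS : ∀ a ∈ window N ×ˢ window N,
      μ (S a) ≤ ENNReal.ofReal (1 / (N ^ 2 * Real.log N ^ (2 * p))) := fun a _ => by
    by_cases h : N ^ (2 / 3 : ℝ) / 4 ≤ |(((a.1 : ℤ) - a.2 : ℤ) : ℝ)|
    · refine (measure_mono ?_).trans (measure_restrictedIntegral_gt_le hX hN hK1 hK2 hL hp h)
      rintro ω ⟨h1, -, h2⟩
      exact ⟨h1, h2⟩
    · have : S a = ∅ := Set.eq_empty_of_forall_notMem fun ω hω => h hω.2.1
      rw [this, measure_empty]; exact zero_le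
  refine (measure_mono (t := {ω | coords X L ω ∉ E} ∪ ⋃ a ∈ window N ×ˢ window N, S a)
    ?_).trans ((measure_union_le _ _).trans ?_)
  · rintro ω ⟨m, hm, n, hn, h1, h2⟩
    by_cases hE : coords X L ω ∈ E
    · exact Or.inr (Set.mem_biUnion (Finset.mem_product.2 ⟨hm, hn⟩ :
        ((m, n) : ℕ × ℕ) ∈ window N ×ˢ window N) ⟨hE, h1, h2⟩)
    · exact Or.inl hE
  have h1 := (measure_notMem_boundedLow_le hX (lowBlocks_le L)
    (show 0 ≤ N ^ (1 / 5 : ℝ) by positivity)).trans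
      (ENNReal.ofReal_le_ofReal (hN.tail_le hK1 hK2 hL hp'))
  have h2 : μ (⋃ a ∈ window N ×ˢ window N, S a)
      ≤ ENNReal.ofReal (1 / Real.log N ^ (2 * p)) := by
    refine (measure_biUnion_finset_le _ _).trans ((Finset.sum_le_sum hS).trans ?_)
    rw [Finset.sum_const, Finset.card_product, nsmul_eq_mul, ← ENNReal.ofReal_natCast,
      ← ENNReal.ofReal_mul (Nat.cast_nonneg _)]
    refine ENNReal.ofReal_le_ofReal ?_
    have hc := hN.card_window_le
    have hcc : (((window N).card * (window N).card : ℕ) : ℝ) ≤ N ^ 2 := by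
      push_cast; rw [sq]; gcongr
    have hlp : 0 < Real.log N ^ (2 * p) := by positivity
    calc _ ≤ N ^ 2 * (1 / (N ^ 2 * Real.log N ^ (2 * p))) := by gcongr
      _ = _ := by field_simp
  -- One (log N)^(-2p) comes from an unusually large low coordinate, the other from the union over
  -- at most N² far pairs.
  refine (add_le_add h1 h2).trans ?_
  rw [← ENNReal.ofReal_add (by positivity) (by positivity), ← add_div]
  norm_num

/-- With y = N^(2/3)/4 there are at most 2⌊y⌋ + 1 integers within distance y of m, and 2y + 1 ≤ 4y.
-/
lemma LargeN.card_near_le {N : ℝ} (hN : LargeN N) (m : ℕ) :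
    (((window N).filter fun n : ℕ => |(((m : ℤ) - n : ℤ) : ℝ)| < N ^ (2 / 3 : ℝ) / 4).card : ℝ)
      ≤ N ^ (2 / 3 : ℝ) := by
  have h3 := hN.third
  set y := N ^ (2 / 3 : ℝ) / 4 with hy
  have hf : (⌊y⌋₊ : ℝ) ≤ y := Nat.floor_le (by linarith)
  have hsub : (window N).filter (fun n : ℕ => |(((m : ℤ) - n : ℤ) : ℝ)| < y)
      ⊆ Finset.Icc (m - ⌊y⌋₊) (m + ⌊y⌋₊) := by
    intro n hn
    have h := (Finset.mem_filter.1 hn).2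
    have h1 : ((m : ℤ) - n).natAbs ≤ ⌊y⌋₊ := by
      refine Nat.le_floor ?_
      rw [Nat.cast_natAbs, Int.cast_abs]
      exact h.le
    rw [Finset.mem_Icc]
    omega
  have h4 := Finset.card_le_card hsub
  rw [Nat.card_Icc] at h4
  have h5 : (m + ⌊y⌋₊ + 1 - (m - ⌊y⌋₊)) ≤ 2 * ⌊y⌋₊ + 1 := by omega
  refine (Nat.cast_le.2 (h4.trans h5)).trans ?_
  push_cast
  linarith

/-- The diagonal integrals are bounded by the mean square of `F`. -/
lemma norm_restrictedIntegral_le {N K : ℝ} {L : ℕ} (hN : LargeN N) (hK1 : N / 3 ≤ K)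
    (hL : Real.log K = L) (m n : ℕ) (ω : Ω) :
    ‖restrictedIntegral X N K m n ω‖ ≤ 1300 * Real.log (Real.log N) / N *
      ∫ t in (0 : ℝ)..(2 * Real.pi), ‖F X K (Complex.exp (Complex.I * t)) ω‖ ^ 2 := by
  have h0 := hN.pos
  have hq := hN.one_le_loglog
  have hl := hN.log_ge
  have hK : 0 < K := by linarith
  have hL0 := hN.le_natLog hK1 hL
  set q := Real.log (Real.log N) with hqdef
  set u := barr q L
  set x := coords X L ω
  set c : ℂ := ((Real.exp (V L / 2) : ℝ) : ℂ)
  have hG : ∀ t, restrictedF X N K t ω = c * gpart u L t x := fun t =>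
    restrictedF_eq hK hL hL0 (by linarith) t ω
  have hgm : Measurable fun t => restrictedF X N K t ω := by
    simp_rw [hG]
    refine Measurable.const_mul ?_ c
    exact Measurable.comp (g := fun p : ℝ × (ℕ → ℂ) => gpart u L p.1 p.2) (f := fun t => (t, x))
      (measurable_gpart L) (measurable_id.prodMk measurable_const)
  obtain ⟨C, hC⟩ := exists_theta_le u L
  have hgb : ∀ t, ‖restrictedF X N K t ω‖ ≤ ‖c‖ * √C := fun t => by
    rw [hG, norm_mul]
    refine mul_le_mul_of_nonneg_left ?_ (norm_nonneg _)
    exact Real.le_sqrt_of_sq_le (hC t x)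
  have hgp : Function.Periodic (fun t => restrictedF X N K t ω) (2 * Real.pi) := fun t => by
    beta_reduce
    rw [hG, hG, gpart_congr (t' := t) (y := x) fun j _ => P_periodic j t x]
  have hlw : N * width N = Real.log N ^ 100 := by rw [width]; field_simp
  have hw : 1 / N ≤ width N := by
    rw [width]
    exact div_le_div_of_nonneg_right (one_le_pow₀ (by linarith)) h0.le
  have h2 := norm_integral_nearDiagonal_le (by linarith [hN.six]) hN.width_lt_pi hw hgm hgb hgp m n
  rw [hlw, Real.log_pow, ← hqdef] at h2
  have hFc : Continuous fun t : ℝ => ‖F X K (Complex.exp (Complex.I * t)) ω‖ ^ 2 := by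
    simp_rw [F_eq hK hL hL0, psum_eq]
    refine ((Complex.continuous_exp.comp (continuous_finsetSum _ fun k _ =>
      continuous_const.mul (continuous_wave k))).norm).pow 2
  have h3 : ∫ t, ‖restrictedF X N K t ω‖ ^ 2 ∂period
      ≤ ∫ t in (0 : ℝ)..(2 * Real.pi), ‖F X K (Complex.exp (Complex.I * t)) ω‖ ^ 2 := by
    rw [intervalIntegral.integral_of_le Real.two_pi_pos.le]
    refine integral_mono_of_nonneg (Filter.Eventually.of_forall fun t => by positivity)
      ((hFc.intervalIntegrable 0 (2 * Real.pi)).1) (Filter.Eventually.of_forall fun t => ?_)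
    exact pow_le_pow_left₀ (norm_nonneg _) (norm_restrictedF_le X N K t ω) 2
  refine h2.trans (mul_le_mul ?_ h3 (integral_nonneg fun t => by positivity) (by positivity))
  have hpi := Real.pi_lt_d2
  have hpi0 := Real.pi_pos
  -- The numerator is 2 + 400π log log N. As log log N ≥ 1, it is at most 1300 log log N.
  refine div_le_div_of_nonneg_right ?_ h0.le
  push_cast
  nlinarith

end

end GaussianBL

end

theorem mainTheorem5 :
    ∃ N₀ C B₁ B₂ : ℝ, 0 < N₀ ∧ 0 < C ∧ 0 < B₁ ∧ 0 < B₂ ∧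
      ∀ (Ω : Type*) [MeasurableSpace Ω] (μ : Measure Ω) [IsProbabilityMeasure μ]
        (X : ℕ → Ω → ℂ), ModelChaos.IsStdComplexGaussianSeq μ X →
      ∀ (N K : ℝ) (p : ℕ), N₀ ≤ N → N / 3 ≤ K → K ≤ N → (∃ L : ℕ, Real.log K = L) →
        2 ≤ p → (p : ℝ) ≤ N ^ (1 / 4 : ℝ) →
        μ {ω | ¬ ∀ m ∈ ModelChaos.window N,
            ∑ n ∈ ModelChaos.window N, ‖ModelChaos.restrictedIntegral X N K m n ω‖ ^ (2 * p) ≤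
              B₁ * (N ^ (2 / 3 : ℝ) * (C * Real.log (Real.log N) / N *
                    ∫ t in (0 : ℝ)..(2 * Real.pi),
                      ‖ModelChaos.F X K (Complex.exp (Complex.I * t)) ω‖ ^ 2) ^ (2 * p)
                + N ^ (2 / 3 : ℝ) * ((p : ℝ) ^ 25 * Real.log N ^ 27) ^ (2 * p)
                + N * ((p : ℝ) ^ 25 / Real.log N ^ 985) ^ (2 * p))}
          ≤ ENNReal.ofReal (B₂ / Real.log N ^ (2 * p)) := by
  obtain ⟨N₀, hN₀⟩ := Filter.eventually_atTop.1 GaussianBL.eventually_largeN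
  -- C = 1300 is the constant of the trivial bound for near pairs, and B₂ = 2 counts the two sources
  -- of exceptional probability.
  refine ⟨max N₀ 1, 1300, 1, 2, by positivity, by norm_num, by norm_num, by norm_num, ?_⟩
  intro Ω _ μ _ X hX N K p hNN hK1 hK2 ⟨L, hL⟩ hp hp'
  have hN : GaussianBL.LargeN N := hN₀ N ((le_max_left _ _).trans hNN)
  have h0 := hN.pos
  have hl := hN.log_ge
  refine (measure_mono ?_).trans
    (GaussianBL.measure_bad_le hX hN hK1 hK2 hL (by omega : 1 ≤ p) hp')
  intro ω hω
  by_contra hgood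
  refine hω fun m hm => ?_
  set J := ∫ t in (0 : ℝ)..(2 * Real.pi),
    ‖ModelChaos.F X K (Complex.exp (Complex.I * t)) ω‖ ^ 2
  set A := 1300 * Real.log (Real.log N) / N * J
  set τ := (p : ℝ) ^ 25 / Real.log N ^ 985
  have hA : ∀ n, ‖ModelChaos.restrictedIntegral X N K m n ω‖ ≤ A := fun n =>
    GaussianBL.norm_restrictedIntegral_le hN hK1 hL m n ω
  have hA0 : 0 ≤ A := (norm_nonneg _).trans (hA 0)
  have hτ0 : 0 ≤ τ := by positivity
  rw [← Finset.sum_filter_add_sum_filter_not _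
    (fun n : ℕ => |(((m : ℤ) - n : ℤ) : ℝ)| < N ^ (2 / 3 : ℝ) / 4)]
  have hnear : ∑ n ∈ (ModelChaos.window N).filter
      (fun n : ℕ => |(((m : ℤ) - n : ℤ) : ℝ)| < N ^ (2 / 3 : ℝ) / 4),
      ‖ModelChaos.restrictedIntegral X N K m n ω‖ ^ (2 * p) ≤ N ^ (2 / 3 : ℝ) * A ^ (2 * p) := by
    refine (Finset.sum_le_card_nsmul _ _ _ fun n _ =>
      pow_le_pow_left₀ (norm_nonneg _) (hA n) (2 * p)).trans ?_
    rw [nsmul_eq_mul]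
    exact mul_le_mul_of_nonneg_right (hN.card_near_le m) (by positivity)
  have hfar : ∑ n ∈ (ModelChaos.window N).filter
      (fun n : ℕ => ¬ |(((m : ℤ) - n : ℤ) : ℝ)| < N ^ (2 / 3 : ℝ) / 4),
      ‖ModelChaos.restrictedIntegral X N K m n ω‖ ^ (2 * p) ≤ N * τ ^ (2 * p) := by
    refine (Finset.sum_le_card_nsmul _ _ (τ ^ (2 * p)) fun n hn => ?_).trans ?_
    · rw [Finset.mem_filter, not_lt] at hn
      refine pow_le_pow_left₀ (norm_nonneg _) (not_lt.1 fun h => hgood ?_) (2 * p)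
      exact ⟨m, hm, n, hn.1, hn.2, h⟩
    · rw [nsmul_eq_mul]
      refine mul_le_mul_of_nonneg_right ?_ (by positivity)
      exact (Nat.cast_le.2 (Finset.card_le_card (Finset.filter_subset _ _))).trans
        hN.card_window_le
  -- The near and far sums are already covered by the first and third terms. The middle one only has
  -- to be nonnegative.
  have hmid : 0 ≤ N ^ (2 / 3 : ℝ) * ((p : ℝ) ^ 25 * Real.log N ^ 27) ^ (2 * p) := by positivity
  linarith
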